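/- Let $\mathbf V$ be a smooth (Hausdorff, $\sigma$-compact) manifold of dimension $n+m$ with a local fibred structure: there is a vertical subbundle $v\mathbf V\subset T\mathbf V$ which is locally the kernel of the differential of a submersion to $\mathbb R^n$. Let $\mathbf N:T\mathbf V\to v\mathbf V$ be an N-connection (a smooth bundle morphism that is the identity on $v\mathbf V$), so that $T\mathbf V=h\mathbf V\oplus v\mathbf V$ with $h\mathbf V=\ker\mathbf N$. Let $\mathbf g$ be a d-metric (a smooth symmetric form with $h\mathbf V\perp v\mathbf V$, nondegenerate and of constant signature on $h\mathbf V$ and on $v\mathbf V$) and $\mathbf D$ a metric d-connection (a smooth linear connection that preserves $h\mathbf V$ and $v\mathbf V$, with $\mathbf D\mathbf g=0$); thus $\mathbf V$ is an N-anholonomic Riemann--Cartan manifold. A d-object is a couple consisting of a horizontal and a vertical object, indexed by $c\in\{h,v\}$. Write $O_c$ for the pseudo-orthogonal group of the signature of $\mathbf g$ on $c\mathbf V$ and $\mathfrak o_c$ for its Lie algebra. Then: 1. The orthonormal frames of $h\mathbf V$ and of $v\mathbf V$ form principal bundles (with smooth local sections) with groups $O_h$ and $O_v$. 2. There is a unique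 canonical d-connection $\widehat{\mathbf D}$: the metric d-connection with vanishing $h(hh)$- and $v(vv)$-torsions for which $$2\mathbf g(\widehat{\mathbf D}_XY,Z)=X\,\mathbf g(Y,Z)+\mathbf g([X,Y],Z)-\mathbf g([X,Z],Y)$$ whenever $X$ is horizontal and $Y,Z$ are vertical, and whenever $X$ is vertical and $Y,Z$ are horizontal. 3. Let $\mathbf B=(B_c)$ be a reduction of these frame bundles to open subgroups $G_c\subset O_c$, let $0\to\mathbb Z_k\to\check G_c\xrightarrow{\pi}G_c\to1$ $(c=h,v)$ be central extensions of Lie groups, with $k\ge1$ and $\mathbb Z_k\subset U(1)$, and let $\mathbf\Psi_{(b_1,b_2)}=\{a\in\check G_c: b_1\pi(a)=b_2\}$ for $b_1,b_2$ in the same fibre of $B_c$. Then $\mathbf\Psi$ with the product of $\check G_c$ is a bundle gerbe over $\mathbf B\to\mathbf V$ (a locally trivial $\mathbb Z_k$-bundle over $B_c\times_{\mathbf V}B_c$ with an associative, $\mathbb Z_k$-bilinear product $\mathbf\Psi_{(b_1,b_2)}\times\mathbf\Psi_{(b_2,b_3)}\to\mathbf\Psi_{(b_1,b_3)}$). 4.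 Let $q\in\mathbb Z$ and let $\mathbf W=(W_c)$ be a $\mathbf\Psi^q$-module with finite-dimensional complex fibres, i.e. a couple of $\check G_c$-equivariant vector bundles $W_c\to B_c$ on which $z\in\mathbb Z_k$ acts as multiplication by $z^q$. A $\mathbf\Psi^q$-module d-connection on $\mathbf W$ is a couple of $\check G_c$-equivariant connections which along the fibres of $B_c$ are the canonical flat ones; equivalently, a family of connection forms along the local sections of $B_c$, compatible with the action of $\mathbf\Psi$. The curvature $\overleftarrow{\mathbf R}$ of each such connection descends to a 2-form on $\mathbf V$ with values in $\mathrm{End}(\mathbf W)/\mathbf G$. The homogeneous parts of the (twisted) Chern character $$ch(\overleftarrow{\mathbf R})=\operatorname{tr}\exp\frac{\overleftarrow{\mathbf R}}{2\pi i}=\sum_{p\ge0}\frac1{p!\,(2\pi i)^p}\operatorname{tr}\overleftarrow{\mathbf R}{}^{\wedge p}$$ (the trace being taken over $W_h\oplus W_v$) are well-defined smooth closed forms of degree $2p$ on $\mathbf V$, and their de Rham classes do not depend on the choice of the module d-connection on $\mathbf W$. 5. Let $\rho_c:\check G_c\to GL(v_c)$ be smooth finite-dimensional complex representations in which $z\in\mathbb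 Z_k$ acts as $z^q$. Each $\rho_c$ has a well-defined differential $\rho_{c*}:\mathfrak o_c\to\mathrm{End}(v_c)$, and $\mathbf W=(B_c\times v_c)$ with the action of $\check G_c$ through $\rho_c$ is a $\mathbf\Psi^q$-module. Every metric d-connection (in particular $\mathbf D$ and $\widehat{\mathbf D}$) induces a unique $\mathbf\Psi^q$-module d-connection on $\mathbf W$, whose connection form along a local section $s$ of $B_c$ is $\rho_{c*}\theta_s$, with $\theta_s$ the connection form of the d-connection in the frame $s$. Its curvature is $\rho_{c*}$ of the matrix, in the frame $s$, of the curvature $\mathbf R(X,Y)=\mathbf D_X\mathbf D_Y-\mathbf D_Y\mathbf D_X-\mathbf D_{[X,Y]}$ of that d-connection (restricted to $c\mathbf V$). The Chern character computed in this way from the curvature of the canonical d-connection $\widehat{\mathbf D}$ is closed, and its de Rham class is the Chern character class of $\mathbf W$: the character of any $\mathbf\Psi^q$-module d-connection on $\mathbf W$ differs from it by an exact form. -/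

import Mathlib

open scoped Manifold ContDiff Topology

universe u w u₁ u₂

/-! ## Differential forms on a smooth manifold of dimension `d`, in charts -/

section Forms

variable {d : ℕ} {V : Type u} [TopologicalSpace V] [ChartedSpace (EuclideanSpace ℝ (Fin d)) V]
variable {F : Type*} [NormedAddCommGroup F] [NormedSpace ℝ F]

/-- (Rough) differential `k`-forms on `V` with values in `F`. -/
abbrev DForm (d : ℕ) (V : Type u) [TopologicalSpace V]
    [ChartedSpace (EuclideanSpace ℝ (Fin d)) V] (k : ℕ)
    (F : Type*) [NormedAddCommGroup F] [NormedSpace ℝ F] :=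
  ∀ x : V, TangentSpace (𝓡 d) x [⋀^Fin k]→L[ℝ] F

/-- The form `α` read in the preferred chart at `x₀` (pull-back by the inverse of the chart). -/
noncomputable def DForm.inChart {k : ℕ} (α : DForm d V k F) (x₀ : V) :
    EuclideanSpace ℝ (Fin d) → EuclideanSpace ℝ (Fin d) [⋀^Fin k]→L[ℝ] F := fun y =>
  (α ((extChartAt (𝓡 d) x₀).symm y)).compContinuousLinearMap
    (mfderiv 𝓘(ℝ, EuclideanSpace ℝ (Fin d)) (𝓡 d) (extChartAt (𝓡 d) x₀).symm y)

/-- Smoothness of a form on an open subset `U`: its expression in every chart is smooth. -/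
def DForm.SmoothOn {k : ℕ} (α : DForm d V k F) (U : Set V) : Prop :=
  ∀ x₀ : V, ContDiffOn ℝ ∞ (DForm.inChart α x₀)
    ((extChartAt (𝓡 d) x₀).target ∩ (extChartAt (𝓡 d) x₀).symm ⁻¹' U)

/-- The exterior derivative, computed at `x` in the preferred chart at `x`. -/
noncomputable def DForm.extD {k : ℕ} (α : DForm d V k F) : DForm d V (k + 1) F := fun x =>
  (extDeriv (DForm.inChart α x) (extChartAt (𝓡 d) x x)).compContinuousLinearMap
    (mfderiv (𝓡 d) 𝓘(ℝ, EuclideanSpace ℝ (Fin d)) (extChartAt (𝓡 d) x) x)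

/-- `α` is exact: `α = dβ` for a smooth form `β` (a `0`-form is exact only if it vanishes). Two
closed forms have the same de Rham class iff their difference is exact. -/
def DForm.IsExact : {k : ℕ} → DForm d V k F → Prop
  | 0, α => α = 0
  | _ + 1, α => ∃ β : DForm d V _ F, DForm.SmoothOn β Set.univ ∧ DForm.extD β = α

/-- Smooth vector fields on `V`. -/
def SmoothField [IsManifold (𝓡 d) ∞ V] (X : ∀ x : V, TangentSpace (𝓡 d) x) : Prop :=
  ContMDiff (𝓡 d) (𝓡 d).tangent ∞ (T% X)

end Forms

/-! ## N-connections, d-metrics, d-connections -/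

/-- The two parts (horizontal and vertical) of an object adapted to a Whitney sum. A "couple"
of objects, one horizontal and one vertical, is a family indexed by `HV`. -/
inductive HV
  | h
  | v

/-- The dimension of the horizontal and of the vertical part. -/
def HV.dim (n m : ℕ) : HV → ℕ
  | h => n
  | v => m

section NAnholonomic

variable (n m : ℕ) (V : Type u) [TopologicalSpace V]
  [ChartedSpace (EuclideanSpace ℝ (Fin (n + m))) V] [IsManifold (𝓡 (n + m)) ∞ V]

/-- An N-connection on an `(n+m)`-dimensional manifold with a local fibred structure: the vertical
subspaces are locally the kernels of the differential of a submersion to `ℝⁿ`, and the N-connection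
is a smooth morphism `TV → vV` which is the identity on `vV`, i.e. a splitting of
`0 → vV → TV → TV/vV → 0`. -/
structure NConnection where
  vert : ∀ x : V, Submodule ℝ (TangentSpace (𝓡 (n + m)) x)
  fibred : ∀ x₀ : V, ∃ U : Set V, IsOpen U ∧ x₀ ∈ U ∧ ∃ π : V → EuclideanSpace ℝ (Fin n),
    ContMDiffOn (𝓡 (n + m)) (𝓡 n) ∞ π U ∧ ∀ x ∈ U,
      Function.Surjective (mfderiv (𝓡 (n + m)) (𝓡 n) π x) ∧
      ∀ X : TangentSpace (𝓡 (n + m)) x,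
        X ∈ vert x ↔ mfderiv (𝓡 (n + m)) (𝓡 n) π x X = 0
  proj : ∀ x : V, TangentSpace (𝓡 (n + m)) x →L[ℝ] TangentSpace (𝓡 (n + m)) x
  smooth : ContMDiff (𝓡 (n + m)) ((𝓡 (n + m)).prod
      𝓘(ℝ, EuclideanSpace ℝ (Fin (n + m)) →L[ℝ] EuclideanSpace ℝ (Fin (n + m)))) ∞
    (fun x => Bundle.TotalSpace.mk'
      (EuclideanSpace ℝ (Fin (n + m)) →L[ℝ] EuclideanSpace ℝ (Fin (n + m)))
      (E := fun x : V => TangentSpace (𝓡 (n + m)) x →L[ℝ] TangentSpace (𝓡 (n + m)) x)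
      x (proj x))
  proj_mem : ∀ x X, proj x X ∈ vert x
  proj_vert : ∀ x, ∀ X ∈ vert x, proj x X = X

variable {n m V}

/-- The horizontal subspace `hV = ker N` and the vertical subspace `vV`; `TV = hV ⊕ vV`. -/
noncomputable def NConnection.part (N : NConnection n m V) :
    HV → ∀ x : V, Submodule ℝ (TangentSpace (𝓡 (n + m)) x)
  | .h => fun x => LinearMap.ker (N.proj x).toLinearMap
  | .v => fun x => N.vert x

/-- A d-metric: a smooth symmetric bilinear form, for which `hV` and `vV` are orthogonal, and which
is nondegenerate of constant signature on `hV` and on `vV`: at every point each of the two parts has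
an orthonormal basis with the prescribed signs. -/
structure DMetric (N : NConnection n m V) where
  inner : ∀ x : V, TangentSpace (𝓡 (n + m)) x →L[ℝ] TangentSpace (𝓡 (n + m)) x →L[ℝ] ℝ
  smooth : ContMDiff (𝓡 (n + m)) ((𝓡 (n + m)).prod
      𝓘(ℝ, EuclideanSpace ℝ (Fin (n + m)) →L[ℝ] EuclideanSpace ℝ (Fin (n + m)) →L[ℝ] ℝ)) ∞
    (fun x => Bundle.TotalSpace.mk'
      (EuclideanSpace ℝ (Fin (n + m)) →L[ℝ] EuclideanSpace ℝ (Fin (n + m)) →L[ℝ] ℝ)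
      (E := fun x : V => TangentSpace (𝓡 (n + m)) x →L[ℝ] TangentSpace (𝓡 (n + m)) x →L[ℝ] ℝ)
      x (inner x))
  symm : ∀ x X Y, inner x X Y = inner x Y X
  adapted : ∀ x, ∀ X ∈ N.part .h x, ∀ Y ∈ N.part .v x, inner x X Y = 0
  sign : ∀ c : HV, Fin (c.dim n m) → ℤˣ
  signature : ∀ (c : HV) (x : V), ∃ e : Fin (c.dim n m) → TangentSpace (𝓡 (n + m)) x,
    (∀ i, e i ∈ N.part c x) ∧ ∀ i j, inner x (e i) (e j) = if i = j then ((sign c i : ℤ) : ℝ) else 0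

/-- Linear connections on `V`. Caution: Mathlib's `D Y x X` is `(D_X Y)(x)`. -/
abbrev LinConn (d : ℕ) (V : Type u) [TopologicalSpace V]
    [ChartedSpace (EuclideanSpace ℝ (Fin d)) V] [IsManifold (𝓡 d) ∞ V] :=
  CovariantDerivative (𝓡 d) (EuclideanSpace ℝ (Fin d)) (TangentSpace (𝓡 d) : V → Type)

/-- A (smooth) metric d-connection: a linear connection which preserves `hV` and `vV` and
satisfies `D_X g = 0`. -/
structure IsMetricDConnection (N : NConnection n m V) (g : DMetric N) (D : LinConn (n + m) V) :
    Prop where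
  smooth : ContMDiffCovariantDerivativeOn (EuclideanSpace ℝ (Fin (n + m))) ∞ D.toFun Set.univ
  adapted : ∀ c : HV, ∀ Y : (∀ x : V, TangentSpace (𝓡 (n + m)) x), SmoothField Y →
    (∀ x, Y x ∈ N.part c x) → ∀ (x : V) (X : TangentSpace (𝓡 (n + m)) x), D Y x X ∈ N.part c x
  metric : ∀ Y Z : (∀ x : V, TangentSpace (𝓡 (n + m)) x), SmoothField Y → SmoothField Z →
    ∀ (x : V) (X : TangentSpace (𝓡 (n + m)) x),
      mvfderiv (𝓡 (n + m)) (fun y => g.inner y (Y y) (Z y)) x X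
        = g.inner x (D Y x X) (Z x) + g.inner x (Y x) (D Z x X)

/-- The canonical d-connection `D̂` of `(N, g)`: the metric d-connection whose `h(hh)`- and
`v(vv)`-torsions vanish, and whose mixed coefficients (the h-derivatives of vertical fields and the
v-derivatives of horizontal fields) are
`2 g(D̂_X Y, Z) = X g(Y, Z) + g([X, Y], Z) - g([X, Z], Y)`. -/
structure IsCanonical (N : NConnection n m V) (g : DMetric N) (D : LinConn (n + m) V) : Prop where
  isMetricDConnection : IsMetricDConnection N g D
  torsion_hhh : ∀ x, ∀ X ∈ N.part .h x, ∀ Y ∈ N.part .h x, D.torsion x X Y ∈ N.part .v x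
  torsion_vvv : ∀ x, ∀ X ∈ N.part .v x, ∀ Y ∈ N.part .v x, D.torsion x X Y ∈ N.part .h x
  mixed : ∀ c c' : HV, c ≠ c' → ∀ X Y Z : (∀ x : V, TangentSpace (𝓡 (n + m)) x),
    SmoothField X → SmoothField Y → SmoothField Z → (∀ x, X x ∈ N.part c x) →
    (∀ x, Y x ∈ N.part c' x) → (∀ x, Z x ∈ N.part c' x) → ∀ x,
      2 * g.inner x (D Y x (X x)) (Z x)
        = mvfderiv (𝓡 (n + m)) (fun y => g.inner y (Y y) (Z y)) x (X x)
          + g.inner x (VectorField.mlieBracket (𝓡 (n + m)) X Y x) (Z x)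
          - g.inner x (VectorField.mlieBracket (𝓡 (n + m)) X Z x) (Y x)

variable (n m V) in
/-- An N-anholonomic Riemann–Cartan manifold. -/
structure RiemannCartan where
  N : NConnection n m V
  g : DMetric N
  D : LinConn (n + m) V
  isMetricDConnection : IsMetricDConnection N g D

/-- The curvature `R(X, Y) Z = D_X D_Y Z - D_Y D_X Z - D_[X,Y] Z` of a linear connection. -/
noncomputable def LinConn.curv {d : ℕ} {V : Type u} [TopologicalSpace V]
    [ChartedSpace (EuclideanSpace ℝ (Fin d)) V] [IsManifold (𝓡 d) ∞ V] (D : LinConn d V)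
    (X Y Z : ∀ x : V, TangentSpace (𝓡 d) x) (x : V) : TangentSpace (𝓡 d) x :=
  D (fun y => D Z y (Y y)) x (X x) - D (fun y => D Z y (X y)) x (Y x)
    - D Z x (VectorField.mlieBracket (𝓡 d) X Y x)

end NAnholonomic

/-! ## Frame bundles, central extensions, lifting gerbes

The constructions of this section are made for one of the two parts (horizontal or vertical);
d-groups, d-bundles, etc. are couples (families indexed by `HV`) of them. -/

section Gerbes

/-- The pseudo-orthogonal group of the signs `η`. -/
def pseudoOrthogonal {r : ℕ} (η : Fin r → ℤˣ) : Subgroup (Matrix.GeneralLinearGroup (Fin r) ℝ) where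
  carrier := {a | (a : Matrix (Fin r) (Fin r) ℝ).transpose
    * Matrix.diagonal (fun i => ((η i : ℤ) : ℝ)) * a = Matrix.diagonal (fun i => ((η i : ℤ) : ℝ))}
  one_mem' := by simp
  mul_mem' := by
    intro a b ha hb
    simp only [Set.mem_ofPred_eq, Units.val_mul, Matrix.transpose_mul] at *
    calc _ = (b : Matrix (Fin r) (Fin r) ℝ).transpose
            * ((a : Matrix (Fin r) (Fin r) ℝ).transpose
              * Matrix.diagonal (fun i => ((η i : ℤ) : ℝ)) * a) * b := by
            simp only [Matrix.mul_assoc]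
      _ = _ := by rw [ha, hb]
  inv_mem' := by
    intro a ha
    simp only [Set.mem_ofPred_eq] at *
    have h1 : (a : Matrix (Fin r) (Fin r) ℝ) * (a⁻¹ : Matrix.GeneralLinearGroup (Fin r) ℝ) = 1 := by
      rw [← Units.val_mul]; simp
    have h2 : ((a⁻¹ : Matrix.GeneralLinearGroup (Fin r) ℝ) : Matrix (Fin r) (Fin r) ℝ).transpose
        * (a : Matrix (Fin r) (Fin r) ℝ).transpose = 1 := by
      rw [← Matrix.transpose_mul, h1, Matrix.transpose_one]
    conv_lhs => rw [← ha]
    simp only [Matrix.mul_assoc]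
    rw [h1, Matrix.mul_one, ← Matrix.mul_assoc, h2, Matrix.one_mul]

/-- The Lie algebra of the pseudo-orthogonal group: `ξᵀ η + η ξ = 0`. -/
abbrev pseudoOrthogonalLie {r : ℕ} (η : Fin r → ℤˣ) : Submodule ℝ (Matrix (Fin r) (Fin r) ℝ) :=
  skewAdjointMatricesSubmodule (Matrix.diagonal (fun i => ((η i : ℤ) : ℝ)))

/-- The right action of matrices on frames, `(e · a)_j = ∑ᵢ e_i aᵢⱼ`. -/
def frameMul {r : ℕ} {T : Type*} [AddCommGroup T] [Module ℝ T] (e : Fin r → T)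
    (a : Matrix (Fin r) (Fin r) ℝ) : Fin r → T := fun j => ∑ i, a i j • e i

variable {d r : ℕ} {V : Type u} [TopologicalSpace V] [ChartedSpace (EuclideanSpace ℝ (Fin d)) V]
  [IsManifold (𝓡 d) ∞ V]

variable (r) in
/-- A set of `r`-frames of `TV` over each point: `B x` is the fibre over `x`. -/
abbrev FrameFamily (d : ℕ) (V : Type u) [TopologicalSpace V]
    [ChartedSpace (EuclideanSpace ℝ (Fin d)) V] :=
  ∀ x : V, Set (Fin r → TangentSpace (𝓡 d) x)

/-- The smooth local sections of `B` over the open set `U` (the values of `e` outside of `U` are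
irrelevant). -/
structure IsLocalSection (B : FrameFamily r d V) (U : Set V)
    (e : ∀ x : V, Fin r → TangentSpace (𝓡 d) x) : Prop where
  isOpen : IsOpen U
  mem : ∀ x ∈ U, e x ∈ B x
  smooth : ∀ i, ContMDiffOn (𝓡 d) (𝓡 d).tangent ∞ (T% (fun x => e x i)) U

/-- The bundle of all orthonormal frames (with signs `η`) of the distribution `S`. -/
def orthonormalFrames (S : ∀ x : V, Submodule ℝ (TangentSpace (𝓡 d) x))
    (g : ∀ x : V, TangentSpace (𝓡 d) x →L[ℝ] TangentSpace (𝓡 d) x →L[ℝ] ℝ) (η : Fin r → ℤˣ) :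
    FrameFamily r d V := fun x =>
  {e | (∀ i, e i ∈ S x) ∧ ∀ i j, g x (e i) (e j) = if i = j then ((η i : ℤ) : ℝ) else 0}

/-- `B` is a principal `G`-bundle of orthonormal frames of `S`, where `G` is an open subgroup of the
pseudo-orthogonal group (e.g. the whole group, or, for oriented distributions, the special
orthogonal group): `G` acts simply transitively on the fibres (freeness is automatic), and there
are smooth local sections. -/
structure IsFrameBundle (S : ∀ x : V, Submodule ℝ (TangentSpace (𝓡 d) x))
    (g : ∀ x : V, TangentSpace (𝓡 d) x →L[ℝ] TangentSpace (𝓡 d) x →L[ℝ] ℝ) (η : Fin r → ℤˣ)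
    (G : Subgroup (Matrix.GeneralLinearGroup (Fin r) ℝ)) (B : FrameFamily r d V) : Prop where
  le : G ≤ pseudoOrthogonal η
  isOpen : ∀ᶠ a in 𝓝 (1 : Matrix.GeneralLinearGroup (Fin r) ℝ), a ∈ pseudoOrthogonal η → a ∈ G
  orthonormal : ∀ x, B x ⊆ orthonormalFrames S g η x
  act : ∀ x, ∀ e ∈ B x, ∀ a ∈ G, frameMul e a ∈ B x
  transitive : ∀ x, ∀ e ∈ B x, ∀ e' ∈ B x, ∃! a, a ∈ G ∧ e' = frameMul e a
  localSection : ∀ x, ∃ U e, x ∈ U ∧ IsLocalSection B U e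

/-- A central extension `0 → ℤ_k → Ĝ → G → 1` of Lie groups by a finite cyclic group. As `ℤ_k` is
finite, `Ĝ → G` is a covering, and the smooth structure of `Ĝ` is the one pulled back from `G`. -/
structure CentralExtension (k : ℕ) (G : Subgroup (Matrix.GeneralLinearGroup (Fin r) ℝ))
    (Ĝ : Type*) [Group Ĝ] [TopologicalSpace Ĝ] where
  proj : Ĝ →* G
  isOpenQuotientMap : IsOpenQuotientMap proj
  inc : Multiplicative (ZMod k) →* Ĝ
  inc_injective : Function.Injective inc
  exact : inc.range = proj.ker
  central : ∀ z a, inc z * a = a * inc z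

variable {k : ℕ} {G : Subgroup (Matrix.GeneralLinearGroup (Fin r) ℝ)}
  {Ĝ : Type*} [Group Ĝ] [TopologicalSpace Ĝ]

/-- The matrix of the image in `G` of an element of `Ĝ`. -/
def CentralExtension.mat (E : CentralExtension k G Ĝ) (a : Ĝ) : Matrix (Fin r) (Fin r) ℝ :=
  ((E.proj a : Matrix.GeneralLinearGroup (Fin r) ℝ) : Matrix (Fin r) (Fin r) ℝ)

/-- The fibre `Ψ_(e₁,e₂)` over `(e₁, e₂) ∈ B ×_V B` of the lifting bundle gerbe `Ψ = τ^* Ĝ`: the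
lifts to `Ĝ` of the element `τ(e₁, e₂)` of `G` with `e₁ τ(e₁, e₂) = e₂`. -/
def CentralExtension.Psi (E : CentralExtension k G Ĝ) {T : Type*} [AddCommGroup T] [Module ℝ T]
    (e₁ e₂ : Fin r → T) : Set Ĝ :=
  {a | e₂ = frameMul e₁ (E.mat a)}

/-- Continuous local sections of `Ψ` over an open set `O` along two sections of the frame bundle;
as `Ψ` is a covering, they are the smooth ones. -/
structure CentralExtension.IsLift (E : CentralExtension k G Ĝ) (O : Set V)
    (e₁ e₂ : ∀ x : V, Fin r → TangentSpace (𝓡 d) x) (ψ : V → Ĝ) : Prop where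
  isOpen : IsOpen O
  cont : ContinuousOn ψ O
  mem : ∀ x ∈ O, ψ x ∈ E.Psi (e₁ x) (e₂ x)

/-- `Ψ` is a bundle gerbe over `B → V` with band `ℤ_k`: its fibres are `ℤ_k`-torsors, it is locally
trivial, and the product of `Ĝ` restricts to an (associative and `ℤ_k`-bilinear) gerbe product
`Ψ_(e₁,e₂) × Ψ_(e₂,e₃) → Ψ_(e₁,e₃)`. -/
structure IsBundleGerbe (B : FrameFamily r d V) (E : CentralExtension k G Ĝ) : Prop where
  nonempty : ∀ x, ∀ e₁ ∈ B x, ∀ e₂ ∈ B x, (E.Psi e₁ e₂).Nonempty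
  torsor : ∀ x, ∀ e₁ ∈ B x, ∀ e₂ ∈ B x, ∀ ψ ∈ E.Psi e₁ e₂,
    (∀ z, E.inc z * ψ ∈ E.Psi e₁ e₂) ∧ ∀ ψ' ∈ E.Psi e₁ e₂, ∃! z, ψ' = E.inc z * ψ
  product : ∀ x, ∀ e₁ ∈ B x, ∀ e₂ ∈ B x, ∀ e₃ ∈ B x, ∀ ψ ∈ E.Psi e₁ e₂, ∀ ψ' ∈ E.Psi e₂ e₃,
    ψ * ψ' ∈ E.Psi e₁ e₃ ∧
    ∀ z z', (E.inc z * ψ) * (E.inc z' * ψ') = E.inc (z * z') * (ψ * ψ')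
  locallyTrivial : ∀ U₁ e₁ U₂ e₂, IsLocalSection B U₁ e₁ → IsLocalSection B U₂ e₂ →
    ∀ x ∈ U₁ ∩ U₂, ∀ ψ₀ ∈ E.Psi (e₁ x) (e₂ x), ∃ O ψ, x ∈ O ∧ O ⊆ U₁ ∩ U₂ ∧
      E.IsLift O e₁ e₂ ψ ∧ ψ x = ψ₀

/-! ### Gerbe modules -/

/-- The scalar by which `z ∈ ℤ_k ⊂ U(1)` acts with weight `q`. -/
noncomputable def weightScalar (k : ℕ) [NeZero k] (q : ℤ) (z : Multiplicative (ZMod k)) : ℂ :=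
  ((ZMod.toCircle z.toAdd : Circle) : ℂ) ^ q

variable [NeZero k]

/-- A smooth finite-dimensional complex representation `ρ` of `Ĝ` on `v` such that `ℤ_k` acts with
weight `q`. Smoothness: `ρ` takes smooth maps to smooth maps, where a (continuous) map to the
covering `Ĝ` of `G` is smooth iff its composition with `Ĝ → G` is smooth. -/
structure WeightRep (E : CentralExtension k G Ĝ) (q : ℤ) (v : Type*) [NormedAddCommGroup v]
    [NormedSpace ℂ v] where
  ρ : Ĝ →* (v →L[ℂ] v)
  weight : ∀ z, ρ (E.inc z) = weightScalar k q z • (1 : v →L[ℂ] v)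
  smooth : ∀ (l : ℕ) (O : Set (EuclideanSpace ℝ (Fin l))) (f : EuclideanSpace ℝ (Fin l) → Ĝ),
    IsOpen O → ContinuousOn f O → (∀ i j, ContDiffOn ℝ ∞ (fun y => E.mat (f y) i j) O) →
    ContDiffOn ℝ ∞ (fun y => ρ (f y)) O

/-- `L` is the differential at `1` of `ρ`: for every smooth curve `γ` in `Ĝ` through `1` with
velocity `ξ`, the velocity of `ρ ∘ γ` is `L ξ`. -/
def WeightRep.IsDifferential {E : CentralExtension k G Ĝ} {q : ℤ} {v : Type*}
    [NormedAddCommGroup v] [NormedSpace ℂ v] (R : WeightRep E q v) {η : Fin r → ℤˣ}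
    (L : pseudoOrthogonalLie η →ₗ[ℝ] (v →L[ℂ] v)) : Prop :=
  ∀ (ξ : pseudoOrthogonalLie η) (γ : ℝ → Ĝ), Continuous γ → γ 0 = 1 →
    (∀ i j, ContDiff ℝ ∞ (fun t => E.mat (γ t) i j)) →
    (∀ i j, deriv (fun t => E.mat (γ t) i j) 0 = (ξ : Matrix (Fin r) (Fin r) ℝ) i j) →
    HasDerivAt (fun t => R.ρ (γ t)) (L ξ) 0

/-- A `Ψ^q`-module `W → B` (a `Ĝ`-equivariant vector bundle with typical fibre `v` on which `ℤ_k`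
acts with weight `q`) given by its restrictions to local sections of `B`. `W` is trivialized along
the sections `s i : U i → B`, where the `U i` cover `V`; over a point `x`, each
`ψ ∈ Ψ_(s i x, s j x)` gives an isomorphism `φ i j x ψ` from the fibre of `W` at `s j x` to the
fibre at `s i x`. These are compatible with the gerbe product, and depend smoothly on `x` along
local sections `ψ` of `Ψ`. -/
structure PsiModule (B : FrameFamily r d V) (E : CentralExtension k G Ĝ) (q : ℤ)
    (v : Type*) [NormedAddCommGroup v] [NormedSpace ℂ v] where
  ι : Type w
  U : ι → Set V
  s : ι → ∀ x : V, Fin r → TangentSpace (𝓡 d) x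
  isLocalSection : ∀ i, IsLocalSection B (U i) (s i)
  cover : ∀ x, ∃ i, x ∈ U i
  φ : ι → ι → V → Ĝ → (v →L[ℂ] v)
  cocycle : ∀ i j l, ∀ x ∈ U i ∩ U j ∩ U l, ∀ ψ ∈ E.Psi (s i x) (s j x),
    ∀ ψ' ∈ E.Psi (s j x) (s l x), φ i l x (ψ * ψ') = φ i j x ψ * φ j l x ψ'
  weight : ∀ i, ∀ x ∈ U i, ∀ z, φ i i x (E.inc z) = weightScalar k q z • (1 : v →L[ℂ] v)
  smooth : ∀ i j O ψ, O ⊆ U i ∩ U j → E.IsLift O (s i) (s j) ψ →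
    ContMDiffOn (𝓡 d) 𝓘(ℝ, v →L[ℂ] v) ∞ (fun x => φ i j x (ψ x)) O

variable {B : FrameFamily r d V} {E : CentralExtension k G Ĝ} {q : ℤ}
  {v : Type*} [NormedAddCommGroup v] [NormedSpace ℂ v]

/-- `W` is the module `B × v` with the action of `Ĝ` through `ρ`: it is trivialized along all local
sections of `B`, and `Ĝ` acts by `ρ`. -/
structure PsiModule.IsAssociated (W : PsiModule.{u, w} B E q v) (R : WeightRep E q v) : Prop where
  all : ∀ U e, IsLocalSection B U e → ∃ i, W.U i = U ∧ W.s i = e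
  φ_eq : ∀ i j, ∀ x ∈ W.U i ∩ W.U j, ∀ ψ ∈ E.Psi (W.s i x) (W.s j x), W.φ i j x ψ = R.ρ ψ

/-- A `Ψ^q`-module d-connection on `W`, i.e. a `Ĝ`-equivariant connection whose restriction to the
fibres of `B` is the canonical flat one: a family of connection forms `A i` over `U i` (the
covariant derivative is `d + A i` in the trivialization along `s i`) which is compatible with the
isomorphisms of `W`. -/
structure PsiModule.IsConnection (W : PsiModule.{u, w} B E q v)
    (A : W.ι → DForm d V 1 (v →L[ℂ] v)) : Prop where
  smooth : ∀ i, DForm.SmoothOn (A i) (W.U i)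
  equivariant : ∀ i j O ψ, O ⊆ W.U i ∩ W.U j → E.IsLift O (W.s i) (W.s j) ψ →
    ∀ x ∈ O, ∀ X : TangentSpace (𝓡 d) x,
      W.φ i j x (ψ x) * A j x ![X]
        = mvfderiv (𝓡 d) (fun y => W.φ i j y (ψ y)) x X + A i x ![X] * W.φ i j x (ψ x)

/-- The curvature `dA + A ∧ A` of a connection form. -/
noncomputable def formCurv (A : DForm d V 1 (v →L[ℂ] v)) (x : V) (X Y : TangentSpace (𝓡 d) x) :
    v →L[ℂ] v :=
  DForm.extD A x ![X, Y] + (A x ![X] * A x ![Y] - A x ![Y] * A x ![X])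

/-- The curvature of a module connection descends to a `2`-form on `V` with values in the bundle
`End(W)/G`. -/
def PsiModule.CurvDescends (W : PsiModule.{u, w} B E q v)
    (A : W.ι → DForm d V 1 (v →L[ℂ] v)) : Prop :=
  ∀ i j, ∀ x ∈ W.U i ∩ W.U j, ∀ ψ ∈ E.Psi (W.s i x) (W.s j x), ∀ X Y : TangentSpace (𝓡 d) x,
    W.φ i j x ψ * formCurv (A j) x X Y = formCurv (A i) x X Y * W.φ i j x ψ

/-- The part of degree `2p` of `tr exp (R / 2πi)`, i.e. `(1/p!) (1/2πi)^p tr (R ∧ ⋯ ∧ R)`, for a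
`2`-form `R` with values in `End v`, at a point. -/
noncomputable def chernPart {T : Type*} (R : T → T → (v →L[ℂ] v)) (p : ℕ) (X : Fin (2 * p) → T) :
    ℂ :=
  ((p.factorial : ℂ))⁻¹ * (1 / (2 * (Real.pi : ℂ) * Complex.I)) ^ p * (1 / 2) ^ p *
    ∑ σ : Equiv.Perm (Fin (2 * p)), ((Equiv.Perm.sign σ : ℤ) : ℂ) *
      LinearMap.trace ℂ v ((List.ofFn fun a : Fin p =>
        R (X (σ ⟨2 * a, by omega⟩)) (X (σ ⟨2 * a + 1, by omega⟩))).prod : v →L[ℂ] v).toLinearMap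

/-- The connection forms `A` on the module associated with `ρ` are induced by the linear connection
`D`: `A i = ρ_* θ`, where `θ` is the connection form of `D` in the frame `s i`,
`D e_j = ∑ₐ θᵃ_j e_a`. -/
def PsiModule.IsInduced (W : PsiModule.{u, w} B E q v) {η : Fin r → ℤˣ}
    (L : pseudoOrthogonalLie η →ₗ[ℝ] (v →L[ℂ] v)) (D : LinConn d V)
    (A : W.ι → DForm d V 1 (v →L[ℂ] v)) : Prop :=
  ∀ i, ∀ x ∈ W.U i, ∀ X : TangentSpace (𝓡 d) x, ∃ θ : pseudoOrthogonalLie η,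
    (∀ j, D (fun y => W.s i y j) x X = ∑ a, (θ : Matrix (Fin r) (Fin r) ℝ) a j • W.s i x a) ∧
    A i x ![X] = L θ

/-- The curvature of the module connection `A` is induced by the curvature of the linear connection
`D`: it is `ρ_*` of the matrix of `R(X, Y)` in the frame `s i`. -/
def PsiModule.CurvInduced (W : PsiModule.{u, w} B E q v) {η : Fin r → ℤˣ}
    (L : pseudoOrthogonalLie η →ₗ[ℝ] (v →L[ℂ] v)) (D : LinConn d V)
    (A : W.ι → DForm d V 1 (v →L[ℂ] v)) : Prop :=
  ∀ i, ∀ X Y : (∀ x : V, TangentSpace (𝓡 d) x), SmoothField X → SmoothField Y → ∀ x ∈ W.U i,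
    ∃ Ω : pseudoOrthogonalLie η,
      (∀ j, D.curv X Y (fun y => W.s i y j) x
        = ∑ a, (Ω : Matrix (Fin r) (Fin r) ℝ) a j • W.s i x a) ∧
      formCurv (A i) x (X x) (Y x) = L Ω

end Gerbes

/-! ## The Chern character of a couple of modules -/

section Chern

variable {d : ℕ} {dim : HV → ℕ} {V : Type u} [TopologicalSpace V]
  [ChartedSpace (EuclideanSpace ℝ (Fin d)) V] [IsManifold (𝓡 d) ∞ V]
  {k : ℕ} [NeZero k] {B : ∀ c, FrameFamily (dim c) d V}
  {G : ∀ c : HV, Subgroup (Matrix.GeneralLinearGroup (Fin (dim c)) ℝ)}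
  {Ĝ : HV → Type*} [∀ c, Group (Ĝ c)] [∀ c, TopologicalSpace (Ĝ c)]
  {E : ∀ c, CentralExtension k (G c) (Ĝ c)} {q : ℤ}
  {v : HV → Type*} [∀ c, NormedAddCommGroup (v c)] [∀ c, NormedSpace ℂ (v c)]

/-- The smooth forms `ch p` of degree `2p` on `V` are the homogeneous parts of the Chern character
`tr exp (R / 2πi)` of the couple `W = W_h ⊕ W_v` with the connection `A`. -/
structure IsChernCharacter (W : ∀ c, PsiModule.{u, w} (B c) (E c) q (v c))
    (A : ∀ c, (W c).ι → DForm d V 1 (v c →L[ℂ] v c)) (ch : ∀ p : ℕ, DForm d V (2 * p) ℂ) :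
    Prop where
  smooth : ∀ p, DForm.SmoothOn (ch p) Set.univ
  eq : ∀ (p : ℕ) (i : ∀ c, (W c).ι) (x : V), (∀ c, x ∈ (W c).U (i c)) →
    ∀ X : Fin (2 * p) → TangentSpace (𝓡 d) x,
      ch p x X = chernPart (formCurv (A .h (i .h)) x) p X + chernPart (formCurv (A .v (i .v)) x) p X

end Chern

/-! Chern–Weil theory is done on a normed space and then glued over V. In a chart a module
connection is a 1-form A with values in End(v), with curvature F = dA + A ∧ A. The Bianchi identity
(`connCurv_bianchi`) and the cyclicity of the trace make tr F^p closed
(`sum_fderiv_altSum_pairTrace`). Applied on E × ℝ to the connection A₀ + t(A₁ - A₀), the same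
closedness shows that the t-derivative of tr F_t^(p+1) is exact (`hasDerivAt_altSum_pairTrace`).
Since tr F_t^(p+1) is polynomial in t, the usual integral over [0, 1] can be replaced by an exact
quadrature rule (`exists_quadrature`): the primitive is a finite sum, and nothing has to be
differentiated under an integral.

A change of the local section of B conjugates the curvature (`mul_connCurv_of_gauge`) and the
difference of two connections. Two lifts to Ĝ of the same change of section act by isomorphisms that
differ by a scalar, so the twist by ℤ_k is invisible to traces: Chern forms and transgression forms
agree on overlaps and glue to ordinary forms on V (`DForm.exists_glued`).

The orthonormal frames have smooth local sections by a Gram–Schmidt procedure started from a frame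
orthonormal at one point, which is safe in every signature. The canonical d-connection is the given
metric d-connection plus an algebraic expression in its torsion, of Koszul type (`koszulPart`). The
difference of two canonical d-connections is a tensor that vanishes on arguments of different parts,
and on a single part it is symmetric in one pair of arguments and skew in another, hence zero.

As ℤ_k is finite, Ĝ → G is a covering, so the smooth transition matrices between local frames lift
locally to Ĝ; this is the local triviality of Ψ. The smooth structure of Ĝ is visible only through
matrices. The Cayley transform gives a chart at 1, in which the differential of ρ is computed
(`WeightRep.exists_hasDerivAt`). Conjugating curves shows that the differential is equivariant
(`WeightRep.IsDifferential.mul_eq_mul`), and differentiating this equivariance shows that it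
respects brackets (`WeightRep.IsDifferential.map_lie`). The first property turns the gauge law of
the connection matrices θ into the equivariance of ρ_* θ; the second turns the structure equation of
the linear connection into the statement that the curvature of ρ_* θ is ρ_* of the curvature matrix.
-/

set_option linter.unusedSectionVars false

/-! ## Alternating sums and Chern–Weil theory on a normed space -/

section AltSum

variable {n : ℕ} {T F : Type*} [AddCommGroup F]

/-- The alternating sum of the values of `m` at the permutations of `X`. -/
def altSum (m : (Fin n → T) → F) (X : Fin n → T) : F :=
  ∑ σ : Equiv.Perm (Fin n), (Equiv.Perm.sign σ : ℤ) • m (X ∘ σ)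

theorem altSum_comp_perm (m : (Fin n → T) → F) (c : Equiv.Perm (Fin n)) (X : Fin n → T) :
    altSum (fun Y => m (Y ∘ c)) X = (Equiv.Perm.sign c : ℤ) • altSum m X := by
  unfold altSum
  conv_rhs => rw [← Equiv.sum_comp (Equiv.mulRight c), Finset.smul_sum]
  refine Finset.sum_congr rfl fun σ _ => ?_
  rw [Equiv.coe_mulRight, smul_smul, ← Units.val_mul, Equiv.Perm.sign_mul, mul_left_comm,
    Int.units_mul_self, mul_one]
  rfl

/-- An alternating sum vanishes if the summands cancel along the orbits of an even permutation
of order three of the arguments. -/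
theorem altSum_eq_zero_of_cycle [Module ℝ F] (m : (Fin n → T) → F) (c : Equiv.Perm (Fin n))
    (hc : Equiv.Perm.sign c = 1) (h : ∀ Y, m Y + m (Y ∘ c) + m (Y ∘ c ∘ c) = 0)
    (X : Fin n → T) : altSum m X = 0 := by
  have h1 := altSum_comp_perm m c X
  have h2 := altSum_comp_perm m (c * c) X
  have h3 : altSum m X + altSum (fun Y => m (Y ∘ c)) X
      + altSum (fun Y => m (Y ∘ ⇑(c * c))) X = 0 := by
    unfold altSum
    rw [← Finset.sum_add_distrib, ← Finset.sum_add_distrib]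
    refine Finset.sum_eq_zero fun σ _ => ?_
    rw [← smul_add, ← smul_add]
    have := h (X ∘ σ)
    rw [Equiv.Perm.coe_mul, this, smul_zero]
  -- Both `c` and `c * c` are even, so the three sums in `h3` are equal.
  rw [h1, h2] at h3
  simp only [hc, Equiv.Perm.sign_mul, mul_one, Units.val_one, one_smul] at h3
  have h4 : (3 : ℝ) • altSum m X = 0 := by rw [← h3]; module
  simpa using h4

/-- Laplace expansion of an alternating sum along the first argument. -/
theorem sum_altSum_removeNth (m : T → (Fin n → T) → F) (X : Fin (n + 1) → T) :
    ∑ i : Fin (n + 1), (-1 : ℤ) ^ (i : ℕ) • altSum (m (X i)) (i.removeNth X)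
      = altSum (fun Y : Fin (n + 1) → T => m (Y 0) (Fin.tail Y)) X := by
  simp only [altSum, Finset.smul_sum]
  rw [← Fintype.sum_prod_type']
  -- A permutation of n+1 letters amounts to the image i of 0 and a permutation of the other n
  -- letters, moved into place by `i.succAbove`. The inverse of `cycleRange` sends 0 to i and has
  -- sign (-1)^i.
  let e : Fin (n + 1) × Equiv.Perm (Fin n) → Equiv.Perm (Fin (n + 1)) := fun q =>
    q.1.cycleRange.symm * Equiv.Perm.decomposeFin.symm (0, q.2)
  have e0 : ∀ q, e q 0 = q.1 := fun q => by simp [e]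
  have es : ∀ q j, e q (Fin.succ j) = q.1.succAbove (q.2 j) := fun q j => by simp [e]
  have hinj : Function.Injective e := by
    rintro ⟨i, σ⟩ ⟨j, τ⟩ h
    have hi : i = j := (e0 (i, σ)).symm.trans ((congrArg (fun f => f 0) h).trans (e0 (j, τ)))
    subst hi
    refine Prod.ext rfl (Equiv.ext fun a => ?_)
    have := es (i, σ) a
    rw [h, es] at this
    exact (Fin.succAbove_right_injective this).symm
  have hbij : Function.Bijective e := by
    rw [Fintype.bijective_iff_injective_and_card]
    refine ⟨hinj, ?_⟩
    simp [Fintype.card_perm, Nat.factorial_succ]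
  refine Fintype.sum_bijective e hbij _ _ fun q => ?_
  have hs : (Equiv.Perm.sign (e q) : ℤ) = (-1) ^ (q.1 : ℕ) * (Equiv.Perm.sign q.2 : ℤ) := by
    simp [e]
  rw [hs, smul_smul]
  congr 2
  · simp [e0]
  · funext j
    simp [Fin.tail, es, Fin.removeNth]

end AltSum

/-! ### Bianchi identity and closed Chern forms on a normed space -/

section ChernWeil

variable {E : Type*} [NormedAddCommGroup E] [NormedSpace ℝ E]
  {𝔸 : Type*} [NormedRing 𝔸] [NormedAlgebra ℝ 𝔸]

/-- The curvature `dA + A ∧ A` of a connection form `A` on a normed space. -/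
noncomputable def connCurv (A : E → E →L[ℝ] 𝔸) (x : E) (X Y : E) : 𝔸 :=
  fderiv ℝ A x X Y - fderiv ℝ A x Y X + (A x X * A x Y - A x Y * A x X)

/-- The multilinear expression whose alternating sum is the Chern form. -/
noncomputable def pairTrace {T : Type*} (tr : 𝔸 → ℂ) (R : T → T → 𝔸) (p : ℕ)
    (Y : Fin (2 * p) → T) : ℂ :=
  tr (List.ofFn fun a : Fin p => R (Y ⟨2 * a, by omega⟩) (Y ⟨2 * a + 1, by omega⟩)).prod

/-- Commutation with `C` is a derivation. A trace kills the left side, so under a trace the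
derivatives of the factors may be replaced by covariant derivatives. -/
theorem mul_list_prod_sub_list_prod_mul {R : Type*} [Ring R] (C : R) {p : ℕ} (G : Fin p → R) :
    C * (List.ofFn G).prod - (List.ofFn G).prod * C
      = ∑ a, (List.ofFn (Function.update G a (C * G a - G a * C))).prod := by
  induction p with
  | zero => simp
  | succ p ih =>
    have h0 : ∀ z : R, (fun i : Fin p => Function.update G 0 z i.succ) = fun i => G i.succ := by
      intro z; funext i; simp
    have hs : ∀ (a : Fin p) (z : R), (fun i : Fin p => Function.update G a.succ z i.succ)
        = Function.update (fun i => G i.succ) a z := by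
      intro a z; funext i
      by_cases h : i = a
      · subst h; simp
      · rw [Function.update_of_ne h, Function.update_of_ne]
        exact fun h' => h (Fin.succ_injective _ h')
    have hz : ∀ (a : Fin p) (z : R), Function.update G a.succ z 0 = G 0 := by
      intro a z; rw [Function.update_of_ne]; exact (Fin.succ_ne_zero a).symm
    rw [Fin.sum_univ_succ]
    simp only [List.ofFn_succ, List.prod_cons, h0, hs, hz, Function.update_self]
    rw [← Finset.mul_sum, ← ih (fun i => G i.succ)]
    noncomm_ring

/-- The Bianchi identity on constant vector fields, whose brackets vanish. The second derivatives of
`A` cancel by symmetry, for which C² suffices; the rest is noncommutative algebra. -/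
theorem connCurv_bianchi {A : E → E →L[ℝ] 𝔸} {x : E} (hA : ContDiffAt ℝ 2 A x) (u v w : E) :
    ((fderiv ℝ (fun y => connCurv A y v w) x u
        + (A x u * connCurv A x v w - connCurv A x v w * A x u))
      + (fderiv ℝ (fun y => connCurv A y w u) x v
        + (A x v * connCurv A x w u - connCurv A x w u * A x v)))
      + (fderiv ℝ (fun y => connCurv A y u v) x w
        + (A x w * connCurv A x u v - connCurv A x u v * A x w)) = 0 := by
  have hAd : DifferentiableAt ℝ A x := hA.differentiableAt (by simp)
  have hA' : DifferentiableAt ℝ (fderiv ℝ A) x :=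
    (hA.fderiv_right (m := 1) (by norm_num)).differentiableAt (by simp)
  have hsymm : ∀ a b, fderiv ℝ (fderiv ℝ A) x a b = fderiv ℝ (fderiv ℝ A) x b a := fun a b =>
    (hA.isSymmSndFDerivAt (by simp)).eq a b
  have happ : ∀ a : E, HasFDerivAt (fun y => A y a) ((fderiv ℝ A x).flip a) x := fun a => by
    simpa using hAd.hasFDerivAt.clm_apply (hasFDerivAt_const a x)
  have happ2 : ∀ a b : E, HasFDerivAt (fun y => fderiv ℝ A y a b)
      (((ContinuousLinearMap.apply ℝ 𝔸 b).comp (ContinuousLinearMap.apply ℝ (E →L[ℝ] 𝔸) a)).comp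
        (fderiv ℝ (fderiv ℝ A) x)) x := fun a b =>
    ((hA'.hasFDerivAt.clm_apply (hasFDerivAt_const a x)).clm_apply
      (hasFDerivAt_const b x)).congr_fderiv (by ext; simp)
  have hF : ∀ a b c : E, fderiv ℝ (fun y => connCurv A y a b) x c
      = fderiv ℝ (fderiv ℝ A) x c a b - fderiv ℝ (fderiv ℝ A) x c b a
        + ((A x a * fderiv ℝ A x c b + fderiv ℝ A x c a * A x b)
          - (A x b * fderiv ℝ A x c a + fderiv ℝ A x c b * A x a)) := by
    intro a b c
    have := ((happ2 a b).sub (happ2 b a)).add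
      (((happ a).mul' (happ b)).sub ((happ b).mul' (happ a)))
    have h2 : (fun y => connCurv A y a b) = ((fun y => fderiv ℝ A y a b) - fun y => fderiv ℝ A y b a)
      + (((fun y => A y a) * fun y => A y b) - ((fun y => A y b) * fun y => A y a)) := rfl
    rw [h2, this.fderiv]
    simp
  rw [hF, hF, hF, hsymm u w, hsymm u v, hsymm v w]
  unfold connCurv
  noncomm_ring

theorem differentiableAt_connCurv {A : E → E →L[ℝ] 𝔸} {x : E} (hA : ContDiffAt ℝ 2 A x) (v w : E) :
    DifferentiableAt ℝ (fun y => connCurv A y v w) x := by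
  have hAd : DifferentiableAt ℝ A x := hA.differentiableAt (by simp)
  have hA' : DifferentiableAt ℝ (fderiv ℝ A) x :=
    (hA.fderiv_right (m := 1) (by norm_num)).differentiableAt (by simp)
  unfold connCurv
  fun_prop

/-- The Chern forms are closed. -/
theorem sum_fderiv_altSum_pairTrace (tr : 𝔸 →L[ℝ] ℂ) (htr : ∀ a b, tr (a * b) = tr (b * a))
    {A : E → E →L[ℝ] 𝔸} {x : E} (hA : ContDiffAt ℝ 2 A x) (p : ℕ) (X : Fin (2 * p + 1) → E) :
    ∑ i : Fin (2 * p + 1), (-1 : ℤ) ^ (i : ℕ) •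
      fderiv ℝ (fun y => altSum (pairTrace tr (connCurv A y) p) (i.removeNth X)) x (X i) = 0 := by
  let M := ContinuousMultilinearMap.mkPiAlgebraFin ℝ p 𝔸
  -- The covariant derivative of the curvature; `hN` is the Bianchi identity.
  let N : E → E → E → 𝔸 := fun u v w => fderiv ℝ (fun y => connCurv A y v w) x u
    + (A x u * connCurv A x v w - connCurv A x v w * A x u)
  have hN : ∀ u v w, N u v w + N v w u + N w u v = 0 := connCurv_bianchi hA
  let G : (Fin (2 * p) → E) → E → Fin p → 𝔸 := fun Y y a =>
    connCurv A y (Y ⟨2 * a, by omega⟩) (Y ⟨2 * a + 1, by omega⟩)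
  -- The summand in which the factor `a` of the product is replaced by its covariant derivative.
  let m : Fin p → E → (Fin (2 * p) → E) → ℂ := fun a u Y =>
    tr (M (Function.update (G Y x) a (N u (Y ⟨2 * a, by omega⟩) (Y ⟨2 * a + 1, by omega⟩))))
  have hderiv : ∀ (Y : Fin (2 * p) → E) (u : E),
      HasFDerivAt (fun y => pairTrace tr (connCurv A y) p Y)
        (tr.comp (∑ a : Fin p, (M.toContinuousLinearMap (G Y x) a).comp
          (fderiv ℝ (fun y => G Y y a) x))) x ∧
      tr (∑ a : Fin p, M (Function.update (G Y x) a (fderiv ℝ (fun y => G Y y a) x u)))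
        = ∑ a, m a u Y := by
    intro Y u
    constructor
    · have := HasFDerivAt.multilinear_comp M (g := fun a y => G Y y a)
        (g' := fun a => fderiv ℝ (fun y => G Y y a) x) (x := x)
        fun a => (differentiableAt_connCurv hA _ _).hasFDerivAt
      exact tr.hasFDerivAt.comp x this
    · have h1 : ∀ a, m a u Y = tr (M (Function.update (G Y x) a (fderiv ℝ (fun y => G Y y a) x u)))
          + tr (M (Function.update (G Y x) a (A x u * G Y x a - G Y x a * A x u))) := by
        intro a
        rw [← map_add, ← ContinuousMultilinearMap.map_update_add]
      rw [Finset.sum_congr rfl fun a _ => h1 a, Finset.sum_add_distrib, ← map_sum tr, ← map_sum tr]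
      -- The commutator parts add up to the commutator of `A x u` with the whole product, which has
      -- trace zero.
      have h2 := mul_list_prod_sub_list_prod_mul (A x u) (G Y x)
      have h3 : ∀ g, M g = (List.ofFn g).prod := fun g =>
        ContinuousMultilinearMap.mkPiAlgebraFin_apply g
      simp only [h3]
      rw [← h2, map_sub, htr, sub_self, add_zero]
  have hd : ∀ (Y : Fin (2 * p) → E) (u : E),
      fderiv ℝ (fun y => altSum (pairTrace tr (connCurv A y) p) Y) x u
        = altSum (fun Z => ∑ a, m a u Z) Y := by
    intro Y u
    unfold altSum
    have := HasFDerivAt.fun_sum (u := Finset.univ) fun (σ : Equiv.Perm (Fin (2 * p))) _ =>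
      (hderiv (Y ∘ σ) u).1.fun_const_smul (Equiv.Perm.sign σ : ℤ)
    rw [this.fderiv, sum_apply]
    refine Finset.sum_congr rfl fun σ _ => ?_
    change _ = (Equiv.Perm.sign σ : ℤ) • ∑ a, m a u (Y ∘ σ)
    rw [← (hderiv (Y ∘ σ) u).2]
    simp [M]
  simp only [hd]
  rw [sum_altSum_removeNth (fun u Z => ∑ a, m a u Z)]
  have hsum : altSum (fun Y : Fin (2 * p + 1) → E => ∑ a, m a (Y 0) (Fin.tail Y)) X
      = ∑ a, altSum (fun Y : Fin (2 * p + 1) → E => m a (Y 0) (Fin.tail Y)) X := by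
    unfold altSum
    rw [Finset.sum_comm]
    simp only [Finset.smul_sum]
  rw [hsum]
  refine Finset.sum_eq_zero fun a _ => ?_
  -- Slot 0 holds the direction of differentiation; the arguments of the factor `a` sit in slots
  -- 2a+1 and 2a+2, shifted by one because of `Fin.tail`. Rotating these three slots is an even
  -- permutation, and the sum over the rotations vanishes by Bianchi.
  let j : Fin (2 * p + 1) := ⟨2 * a + 1, by omega⟩
  let k : Fin (2 * p + 1) := ⟨2 * a + 2, by omega⟩
  have h0j : (0 : Fin (2 * p + 1)) ≠ j := by simp [j, Fin.ext_iff]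
  have h0k : (0 : Fin (2 * p + 1)) ≠ k := by simp [k, Fin.ext_iff]
  have hjk : j ≠ k := by simp [j, k, Fin.ext_iff]
  let c : Equiv.Perm (Fin (2 * p + 1)) := Equiv.swap 0 j * Equiv.swap j k
  have c0 : c 0 = j := by simp [c, Equiv.swap_apply_of_ne_of_ne h0j h0k]
  have cj : c j = k := by simp [c, Equiv.swap_apply_of_ne_of_ne h0k.symm hjk.symm]
  have ck : c k = 0 := by simp [c]
  have cc : ∀ i, i ≠ 0 → i ≠ j → i ≠ k → c i = i := fun i h1 h2 h3 => by
    simp [c, Equiv.swap_apply_of_ne_of_ne h2 h3, Equiv.swap_apply_of_ne_of_ne h1 h2]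
  refine altSum_eq_zero_of_cycle _ c (by simp [c, h0j, hjk]) (fun Y => ?_) X
  have hG : ∀ z : 𝔸, ∀ Y' : Fin (2 * p + 1) → E, (∀ i, i ≠ 0 → i ≠ j → i ≠ k → Y' i = Y i) →
      Function.update (G (Fin.tail Y') x) a z = Function.update (G (Fin.tail Y) x) a z := by
    intro z Y' h
    funext b
    by_cases hb : b = a
    · subst hb; simp
    · rw [Function.update_of_ne hb, Function.update_of_ne hb]
      have hb' : (b : ℕ) ≠ a := fun h => hb (Fin.ext h)
      simp only [G, Fin.tail, Fin.succ_mk]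
      rw [h ⟨2 * b + 1, by omega⟩ _ _ _, h ⟨2 * b + 1 + 1, by omega⟩ _ _ _] <;>
        simp [j, k, Fin.ext_iff] <;> omega
  have key : ∀ u v w : E,
      tr (M (Function.update (G (Fin.tail Y) x) a (N u v w)))
      + tr (M (Function.update (G (Fin.tail Y) x) a (N v w u)))
      + tr (M (Function.update (G (Fin.tail Y) x) a (N w u v))) = 0 := by
    intro u v w
    rw [← map_add, ← map_add, ← ContinuousMultilinearMap.map_update_add,
      ← ContinuousMultilinearMap.map_update_add, hN, M.map_coord_zero a (Function.update_self ..),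
      map_zero]
  have e1 : ∀ Y' : Fin (2 * p + 1) → E, (Fin.tail Y' ⟨2 * a, by omega⟩) = Y' j := fun Y' => rfl
  have e2 : ∀ Y' : Fin (2 * p + 1) → E, (Fin.tail Y' ⟨2 * a + 1, by omega⟩) = Y' k := fun Y' => rfl
  simp only [m, e1, e2]
  rw [hG _ (Y ∘ c) (fun i h1 h2 h3 => by simp [cc i h1 h2 h3]),
    hG _ (Y ∘ c ∘ c) (fun i h1 h2 h3 => by simp [cc i h1 h2 h3])]
  simp only [Function.comp_apply, c0, cj, ck]
  exact key _ _ _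

end ChernWeil

/-! ### Exact quadrature for polynomial functions of one variable -/

section Quadrature

/-- A quadrature rule computing the increment of a polynomial function from its derivative. -/
theorem exists_quadrature (N : ℕ) : ∃ w : Fin N → ℝ, ∀ k ≤ N,
    (1 : ℝ) - 0 ^ k = ∑ j : Fin N, w j * (k * (j : ℝ) ^ (k - 1)) := by
  -- The nodes are 0, …, N-1, and the moments 1/(i+1) are the integrals of t^i over [0, 1]; the
  -- Vandermonde matrix of distinct nodes is invertible. For k = 0 both sides of the claim vanish:
  -- `0 ^ 0 = 1` on the left, the factor `k` on the right.
  let M := (Matrix.vandermonde fun j : Fin N => (j : ℝ)).transpose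
  have hM : IsUnit M.det := by
    rw [Matrix.det_transpose, isUnit_iff_ne_zero, Matrix.det_vandermonde_ne_zero_iff]
    intro i j h
    exact Fin.ext (Nat.cast_injective (R := ℝ) h)
  let b : Fin N → ℝ := fun i => 1 / ((i : ℝ) + 1)
  obtain ⟨w, h⟩ : ∃ w, M.mulVec w = b :=
    ⟨M⁻¹.mulVec b, by rw [Matrix.mulVec_mulVec, Matrix.mul_nonsing_inv _ hM, Matrix.one_mulVec]⟩
  refine ⟨w, fun k hk => ?_⟩
  rcases k with _ | k
  · simp
  have h1 := congrFun h ⟨k, hk⟩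
  simp only [Matrix.mulVec, dotProduct, M, Matrix.transpose_apply, Matrix.vandermonde_apply, b]
    at h1
  have h2 : ((k : ℝ) + 1) ≠ 0 := by positivity
  calc (1 : ℝ) - 0 ^ (k + 1) = (1 / ((k : ℝ) + 1)) * (k + 1) := by field_simp; simp
    _ = _ := by
      rw [← h1, Finset.sum_mul]
      refine Finset.sum_congr rfl fun j _ => ?_
      push_cast
      ring

/-- The polynomial functions of degree at most `N` on the line, with values in `F`. -/
def polyFun (N : ℕ) (F : Type*) [NormedAddCommGroup F] [NormedSpace ℝ F] :
    Submodule ℝ (ℝ → F) :=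
  Submodule.span ℝ {f | ∃ k ≤ N, ∃ c : F, f = fun t => t ^ k • c}

variable {F : Type*} [NormedAddCommGroup F] [NormedSpace ℝ F]

theorem pow_smul_mem_polyFun {N k : ℕ} (hk : k ≤ N) (c : F) :
    (fun t : ℝ => t ^ k • c) ∈ polyFun N F :=
  Submodule.subset_span ⟨k, hk, c, rfl⟩

theorem mul_mem_polyFun {𝔸 : Type*} [NormedRing 𝔸] [NormedAlgebra ℝ 𝔸] {N M : ℕ} {f g : ℝ → 𝔸}
    (hf : f ∈ polyFun N 𝔸) (hg : g ∈ polyFun M 𝔸) : f * g ∈ polyFun (N + M) 𝔸 := by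
  induction hf using Submodule.span_induction with
  | mem f hf =>
    obtain ⟨k, hk, c, rfl⟩ := hf
    induction hg using Submodule.span_induction with
    | mem g hg =>
      obtain ⟨l, hl, e, rfl⟩ := hg
      convert pow_smul_mem_polyFun (add_le_add hk hl) (c * e) using 1
      funext t
      simp [pow_add, smul_smul, mul_comm]
    | zero => rw [mul_zero]; exact Submodule.zero_mem _
    | add g g' _ _ h h' => rw [mul_add]; exact Submodule.add_mem _ h h'
    | smul a g _ h => rw [mul_smul_comm]; exact Submodule.smul_mem _ _ h
  | zero => rw [zero_mul]; exact Submodule.zero_mem _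
  | add f f' _ _ h h' => rw [add_mul]; exact Submodule.add_mem _ h h'
  | smul a f _ h => rw [smul_mul_assoc]; exact Submodule.smul_mem _ _ h

theorem list_prod_mem_polyFun {𝔸 : Type*} [NormedRing 𝔸] [NormedAlgebra ℝ 𝔸] {N p : ℕ}
    {f : Fin p → ℝ → 𝔸} (hf : ∀ a, f a ∈ polyFun N 𝔸) :
    (fun t => (List.ofFn fun a => f a t).prod) ∈ polyFun (N * p) 𝔸 := by
  induction p with
  | zero => simpa using pow_smul_mem_polyFun (Nat.zero_le _) (1 : 𝔸)
  | succ p ih =>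
    have := mul_mem_polyFun (hf 0) (ih fun a => hf a.succ)
    rw [Nat.mul_succ, add_comm]
    convert this using 1
    funext t
    simp [List.ofFn_succ]

theorem clm_comp_mem_polyFun {G : Type*} [NormedAddCommGroup G] [NormedSpace ℝ G] {N : ℕ}
    {f : ℝ → F} (L : F →L[ℝ] G) (hf : f ∈ polyFun N F) : (fun t => L (f t)) ∈ polyFun N G := by
  induction hf using Submodule.span_induction with
  | mem f hf =>
    obtain ⟨k, hk, c, rfl⟩ := hf
    simpa using pow_smul_mem_polyFun hk (L c)
  | zero =>
    convert Submodule.zero_mem (polyFun N G) using 1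
    funext t
    simp
  | add g g' _ _ h h' => simpa using! Submodule.add_mem _ h h'
  | smul a g _ h => simpa using! Submodule.smul_mem _ a h

/-- Both sides are linear in `f`, and on monomials the equality is the defining property of the
weights. This takes the place of the fundamental theorem of calculus. -/
theorem quadrature_polyFun {N : ℕ} {w : Fin N → ℝ}
    (hw : ∀ k ≤ N, (1 : ℝ) - 0 ^ k = ∑ j : Fin N, w j * (k * (j : ℝ) ^ (k - 1))) {f f' : ℝ → F}
    (hf : f ∈ polyFun N F) (hf' : ∀ t, HasDerivAt f (f' t) t) :
    f 1 - f 0 = ∑ j : Fin N, w j • f' j := by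
  -- `f'` is traded for `deriv f`, which makes sense for every element of the span;
  -- differentiability is carried along because the additivity of `deriv` needs it.
  suffices h : Differentiable ℝ f ∧ f 1 - f 0 = ∑ j : Fin N, w j • deriv f j by
    rw [h.2]; exact Finset.sum_congr rfl fun j _ => by rw [(hf' _).deriv]
  clear hf' f'
  induction hf using Submodule.span_induction with
  | mem f hf =>
    obtain ⟨k, hk, c, rfl⟩ := hf
    have hd : ∀ t : ℝ, HasDerivAt (fun t : ℝ => t ^ k • c) ((k * t ^ (k - 1)) • c) t := fun t =>
      (hasDerivAt_pow k t).smul_const c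
    refine ⟨fun t => (hd t).differentiableAt, ?_⟩
    simp only [fun t => (hd t).deriv, smul_smul]
    rw [← Finset.sum_smul, ← hw k hk]
    simp [sub_smul]
  | zero => exact ⟨differentiable_const 0, by simp⟩
  | add f g _ _ hf hg =>
    refine ⟨hf.1.add hg.1, ?_⟩
    have : ∀ t, deriv (f + g) t = deriv f t + deriv g t := fun t => deriv_add (hf.1 t) (hg.1 t)
    simp only [this, smul_add, Finset.sum_add_distrib, ← hf.2, ← hg.2, Pi.add_apply]
    abel
  | smul a f _ hf =>
    refine ⟨hf.1.const_smul a, ?_⟩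
    have : ∀ t, deriv (a • f) t = a • deriv f t := fun t => deriv_const_smul a (hf.1 t)
    simp only [this, smul_comm _ a, ← Finset.smul_sum, ← hf.2, Pi.smul_apply, smul_sub]

end Quadrature

/-! ### Gauge transformations and invariance of the trace -/

section Gauge

variable {E : Type*} [NormedAddCommGroup E] [NormedSpace ℝ E]
  {𝔸 : Type*} [NormedRing 𝔸] [NormedAlgebra ℝ 𝔸]

/-- Curvature is conjugated by gauge transformations. -/
theorem mul_connCurv_of_gauge {A₁ A₂ : E → E →L[ℝ] 𝔸} {Φ : E → 𝔸} {x : E}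
    (h₁ : DifferentiableAt ℝ A₁ x) (h₂ : DifferentiableAt ℝ A₂ x) (hΦ : ContDiffAt ℝ 2 Φ x)
    (h : ∀ᶠ y in 𝓝 x, ∀ v, Φ y * A₂ y v = fderiv ℝ Φ y v + A₁ y v * Φ y) (v w : E) :
    Φ x * connCurv A₂ x v w = connCurv A₁ x v w * Φ x := by
  have hΦd : DifferentiableAt ℝ Φ x := hΦ.differentiableAt (by simp)
  have hΦ' : DifferentiableAt ℝ (fderiv ℝ Φ) x :=
    (hΦ.fderiv_right (m := 1) (by norm_num)).differentiableAt (by simp)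
  have hsymm : ∀ a b, fderiv ℝ (fderiv ℝ Φ) x a b = fderiv ℝ (fderiv ℝ Φ) x b a := fun a b =>
    (hΦ.isSymmSndFDerivAt (by simp)).eq a b
  have happ : ∀ {G : Type _} [NormedAddCommGroup G] [NormedSpace ℝ G] {A : E → E →L[ℝ] G},
      DifferentiableAt ℝ A x → ∀ a : E, HasFDerivAt (fun y => A y a) ((fderiv ℝ A x).flip a) x :=
    fun hA a => by simpa using hA.hasFDerivAt.clm_apply (hasFDerivAt_const a x)
  -- The derivative of the gauge relation in direction `a`, evaluated on `b`. Antisymmetrization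
  -- will remove the second derivative of Φ, and `h0` its first derivatives.
  have key : ∀ a b : E, Φ x * fderiv ℝ A₂ x a b + fderiv ℝ Φ x a * A₂ x b
      = fderiv ℝ (fderiv ℝ Φ) x a b + (A₁ x b * fderiv ℝ Φ x a + fderiv ℝ A₁ x a b * Φ x) := by
    intro a b
    have e : (fun y => Φ y * A₂ y b) =ᶠ[𝓝 x] fun y => fderiv ℝ Φ y b + A₁ y b * Φ y :=
      h.mono fun y hy => hy b
    have h3 := (hΦd.hasFDerivAt.mul' (happ h₂ b)).congr_of_eventuallyEq e.symm
    have h4 := (happ hΦ' b).fun_add ((happ h₁ b).mul' hΦd.hasFDerivAt)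
    simpa using congrArg (fun L => L a) (h3.unique h4)
  have h0 : ∀ a, fderiv ℝ Φ x a = Φ x * A₂ x a - A₁ x a * Φ x := fun a => by
    rw [h.self_of_nhds a]; abel
  have k1 := key v w
  have k2 := key w v
  have k3 : Φ x * (fderiv ℝ A₂ x v w - fderiv ℝ A₂ x w v)
      = (A₁ x w * fderiv ℝ Φ x v + fderiv ℝ A₁ x v w * Φ x) - fderiv ℝ Φ x v * A₂ x w
        - ((A₁ x v * fderiv ℝ Φ x w + fderiv ℝ A₁ x w v * Φ x) - fderiv ℝ Φ x w * A₂ x v) := by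
    rw [mul_sub, eq_sub_of_add_eq k1, eq_sub_of_add_eq k2, hsymm w v]
    abel
  unfold connCurv
  rw [mul_add, k3, h0 v, h0 w]
  noncomm_ring

theorem mul_list_prod_of_conj {R : Type*} [Ring R] {Φ : R} {p : ℕ} {G₁ G₂ : Fin p → R}
    (h : ∀ a, Φ * G₂ a = G₁ a * Φ) : Φ * (List.ofFn G₂).prod = (List.ofFn G₁).prod * Φ := by
  induction p with
  | zero => simp
  | succ p ih =>
    rw [List.ofFn_succ, List.ofFn_succ, List.prod_cons, List.prod_cons, ← mul_assoc, h 0,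
      mul_assoc, ih fun a => h a.succ, mul_assoc]

/-- The products of curvatures are conjugate by Φ, and a trace does not see conjugation. -/
theorem pairTrace_eq_of_conj {𝔸 : Type*} [NormedRing 𝔸] {T : Type*} {tr : 𝔸 → ℂ} (htr : ∀ a b, tr (a * b) = tr (b * a))
    {Φ Ψ : 𝔸} (h1 : Ψ * Φ = 1) (h2 : Φ * Ψ = 1) {R₁ R₂ : T → T → 𝔸}
    (h : ∀ X Y, Φ * R₂ X Y = R₁ X Y * Φ) (p : ℕ) (X : Fin (2 * p) → T) :
    pairTrace tr R₂ p X = pairTrace tr R₁ p X := by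
  unfold pairTrace
  set P₁ := (List.ofFn fun a : Fin p => R₁ (X ⟨2 * a, by omega⟩) (X ⟨2 * a + 1, by omega⟩)).prod
  set P₂ := (List.ofFn fun a : Fin p => R₂ (X ⟨2 * a, by omega⟩) (X ⟨2 * a + 1, by omega⟩)).prod
  have : Φ * P₂ = P₁ * Φ := mul_list_prod_of_conj fun a => h _ _
  calc tr P₂ = tr (Ψ * (Φ * P₂)) := by rw [← mul_assoc, h1, one_mul]
    _ = tr P₁ := by rw [this, htr, mul_assoc, h2, mul_one]

theorem contDiffOn_pairTrace {T : Type*} (tr : 𝔸 →L[ℝ] ℂ) {R : E → T → T → 𝔸} {s : Set E}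
    {n : ℕ∞ω} (hR : ∀ X Y, ContDiffOn ℝ n (fun y => R y X Y) s) (p : ℕ) (X : Fin (2 * p) → T) :
    ContDiffOn ℝ n (fun y => pairTrace tr (R y) p X) s := by
  have h : ∀ (p : ℕ) (G : Fin p → E → 𝔸), (∀ a, ContDiffOn ℝ n (G a) s) →
      ContDiffOn ℝ n (fun y => (List.ofFn fun a => G a y).prod) s := by
    intro p
    induction p with
    | zero => intro G _; simpa using contDiffOn_const
    | succ p ih =>
      intro G hG
      simp only [List.ofFn_succ, List.prod_cons]
      exact (hG 0).mul (ih _ fun a => hG a.succ)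
  exact tr.contDiff.comp_contDiffOn (h p _ fun a => hR _ _)

theorem contDiffOn_altSum {T F : Type*} [NormedAddCommGroup F] [NormedSpace ℝ F] {k : ℕ}
    {m : E → (Fin k → T) → F} {s : Set E} {n : ℕ∞ω} (hm : ∀ X, ContDiffOn ℝ n (fun y => m y X) s)
    (X : Fin k → T) : ContDiffOn ℝ n (fun y => altSum (m y) X) s := by
  unfold altSum
  exact ContDiffOn.sum fun σ _ => (hm _).const_smul _

theorem differentiableAt_altSum_pairTrace {T : Type*} (tr : 𝔸 →L[ℝ] ℂ) {R : E → T → T → 𝔸} {x : E}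
    (hR : ∀ X Y, DifferentiableAt ℝ (fun y => R y X Y) x) (p : ℕ) (X : Fin (2 * p) → T) :
    DifferentiableAt ℝ (fun y => altSum (pairTrace tr (R y) p) X) x := by
  unfold altSum
  refine DifferentiableAt.fun_sum fun σ _ => DifferentiableAt.const_smul ?_ _
  have h : ∀ (p : ℕ) (G : Fin p → E → 𝔸), (∀ a, DifferentiableAt ℝ (G a) x) →
      DifferentiableAt ℝ (fun y => (List.ofFn fun a => G a y).prod) x := by
    intro p
    induction p with
    | zero => intro G _; simp
    | succ p ih =>
      intro G hG
      simp only [List.ofFn_succ, List.prod_cons]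
      exact (hG 0).mul (ih _ fun a => hG a.succ)
  exact tr.differentiableAt.comp x (h p _ fun a => hR _ _)

end Gauge

/-! ### Transgression between two connections -/

section Transgression

variable {E : Type*} [NormedAddCommGroup E] [NormedSpace ℝ E]
  {𝔸 : Type*} [NormedRing 𝔸] [NormedAlgebra ℝ 𝔸]

/-- The curvature of the connection `A₀ + t (A₁ - A₀)` on `E × ℝ`, from the curvature `R` for fixed
`t` and the difference `a = A₁ - A₀`. -/
def cylCurv {T : Type*} (R : T → T → 𝔸) (a : T → 𝔸) (X Y : T × ℝ) : 𝔸 :=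
  R X.1 Y.1 + (X.2 • a Y.1 - Y.2 • a X.1)

/-- The arguments of the transgression form: `∂/∂t` and the vectors `X`. -/
def cylArgs {T : Type*} [Zero T] {k : ℕ} (X : Fin k → T) : Fin (k + 1) → T × ℝ :=
  Fin.cons (0, 1) fun i => (X i, 0)

/-- The curvature of the affine path is quadratic in `t`; this is what makes a quadrature rule with
finitely many nodes exact. -/
theorem connCurv_line {A₀ A₁ : E → E →L[ℝ] 𝔸} {x : E} (h₀ : DifferentiableAt ℝ A₀ x)
    (h₁ : DifferentiableAt ℝ A₁ x) (t : ℝ) (X Y : E) :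
    connCurv (fun y => A₀ y + t • (A₁ y - A₀ y)) x X Y = connCurv A₀ x X Y
      + t • ((fderiv ℝ (fun y => A₁ y - A₀ y) x X Y - fderiv ℝ (fun y => A₁ y - A₀ y) x Y X)
        + ((A₁ x - A₀ x) X * A₀ x Y - (A₁ x - A₀ x) Y * A₀ x X
          + (A₀ x X * (A₁ x - A₀ x) Y - A₀ x Y * (A₁ x - A₀ x) X)))
      + t ^ 2 • ((A₁ x - A₀ x) X * (A₁ x - A₀ x) Y - (A₁ x - A₀ x) Y * (A₁ x - A₀ x) X) := by
  have := h₀.hasFDerivAt.fun_add ((h₁.fun_sub h₀).hasFDerivAt.fun_const_smul t)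
  unfold connCurv
  rw [this.fderiv]
  beta_reduce
  generalize fderiv ℝ (fun y => A₁ y - A₀ y) x = D
  generalize A₁ x - A₀ x = a
  simp only [add_apply, smul_apply, add_mul, mul_add,
    smul_mul_assoc, mul_smul_comm, pow_two]
  module

/-- The connection form on E × ℝ has no dt-component. Besides the curvature at fixed `t`, only the
term dt ∧ (A₁ - A₀) appears. -/
theorem connCurv_cyl {A₀ A₁ : E → E →L[ℝ] 𝔸} {x : E} (h₀ : DifferentiableAt ℝ A₀ x)
    (h₁ : DifferentiableAt ℝ A₁ x) (t : ℝ) (X Y : E × ℝ) :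
    connCurv (fun z : E × ℝ => (A₀ z.1 + z.2 • (A₁ z.1 - A₀ z.1)).comp
        (ContinuousLinearMap.fst ℝ E ℝ)) (x, t) X Y
      = cylCurv (connCurv (fun y => A₀ y + t • (A₁ y - A₀ y)) x) (A₁ x - A₀ x) X Y := by
  have hd₀ : HasFDerivAt (fun z : E × ℝ => A₀ z.1)
      ((fderiv ℝ A₀ x).comp (ContinuousLinearMap.fst ℝ E ℝ)) (x, t) :=
    HasFDerivAt.comp (x, t) (f := Prod.fst) h₀.hasFDerivAt hasFDerivAt_fst
  have hda : HasFDerivAt (fun z : E × ℝ => A₁ z.1 - A₀ z.1)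
      ((fderiv ℝ (fun y => A₁ y - A₀ y) x).comp (ContinuousLinearMap.fst ℝ E ℝ)) (x, t) :=
    HasFDerivAt.comp (x, t) (g := fun y => A₁ y - A₀ y) (f := Prod.fst)
      (h₁.fun_sub h₀).hasFDerivAt hasFDerivAt_fst
  have h := (hd₀.fun_add (HasFDerivAt.fun_smul (hasFDerivAt_snd (𝕜 := ℝ) (p := (x, t)))
    hda)).clm_comp (hasFDerivAt_const (ContinuousLinearMap.fst ℝ E ℝ) (x, t))
  have h' := h₀.hasFDerivAt.fun_add ((h₁.fun_sub h₀).hasFDerivAt.fun_const_smul t)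
  unfold cylCurv connCurv
  rw [h.fderiv, h'.fderiv]
  simp
  abel

theorem removeNth_succ_cons {T : Type*} {k : ℕ} (a : T) (X : Fin (k + 1) → T) (i : Fin (k + 1)) :
    i.succ.removeNth (Fin.cons a X : Fin (k + 2) → T) = Fin.cons a (i.removeNth X) := by
  funext j
  refine Fin.cases ?_ (fun j => ?_) j
  · simp [Fin.removeNth]
  · simp [Fin.removeNth, Fin.succ_succAbove_succ]

/-- Transgression: the derivative in `t` of the Chern form of `A₀ + t (A₁ - A₀)` is an exterior
derivative. -/
theorem hasDerivAt_altSum_pairTrace (tr : 𝔸 →L[ℝ] ℂ) (htr : ∀ a b, tr (a * b) = tr (b * a))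
    {A₀ A₁ : E → E →L[ℝ] 𝔸} {x : E} (h₀ : ContDiffAt ℝ 2 A₀ x) (h₁ : ContDiffAt ℝ 2 A₁ x)
    (p : ℕ) (X : Fin (2 * p + 2) → E) (t : ℝ) :
    HasDerivAt (fun t : ℝ =>
        altSum (pairTrace tr (connCurv (fun y => A₀ y + t • (A₁ y - A₀ y)) x) (p + 1)) X)
      (∑ i : Fin (2 * p + 2), (-1 : ℤ) ^ (i : ℕ) • fderiv ℝ (fun y =>
        altSum (pairTrace tr (cylCurv (connCurv (fun y => A₀ y + t • (A₁ y - A₀ y)) y)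
          (A₁ y - A₀ y)) (p + 1)) (cylArgs (i.removeNth X))) x (X i)) t := by
  -- The Chern form of `Ã` on E × ℝ is closed. Evaluated on ∂/∂t and the vectors `X`, this
  -- closedness splits into the t-derivative (index 0) and an exterior derivative along E.
  let Ã : E × ℝ → E × ℝ →L[ℝ] 𝔸 := fun z => (A₀ z.1 + z.2 • (A₁ z.1 - A₀ z.1)).comp
        (ContinuousLinearMap.fst ℝ E ℝ)
  have hÃ : ContDiffAt ℝ 2 Ã (x, t) := by
    have e₀ : ContDiffAt ℝ 2 (fun z : E × ℝ => A₀ z.1) (x, t) :=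
      ContDiffAt.comp (g := A₀) (f := Prod.fst) (x, t) h₀ contDiffAt_fst
    have e₁ : ContDiffAt ℝ 2 (fun z : E × ℝ => A₁ z.1) (x, t) :=
      ContDiffAt.comp (g := A₁) (f := Prod.fst) (x, t) h₁ contDiffAt_fst
    exact (e₀.add (contDiffAt_snd.smul (e₁.sub e₀))).clm_comp contDiffAt_const
  have hdiff : ∀ Y, DifferentiableAt ℝ (fun z => altSum (pairTrace tr (connCurv Ã z) (p + 1)) Y)
      (x, t) := fun Y =>
    differentiableAt_altSum_pairTrace tr (fun _ _ => differentiableAt_connCurv hÃ _ _) (p + 1) Y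
  let X' : Fin (2 * (p + 1) + 1) → E × ℝ := Fin.cons (0, 1) fun i => (X i, 0)
  have hclosed := sum_fderiv_altSum_pairTrace tr htr hÃ (p + 1) X'
  rw [Fin.sum_univ_succ] at hclosed
  have e₀ : ∀ᶠ y in 𝓝 x, DifferentiableAt ℝ A₀ y :=
    (h₀.eventually (by simp)).mono fun y hy => hy.differentiableAt (by simp)
  have e₁ : ∀ᶠ y in 𝓝 x, DifferentiableAt ℝ A₁ y :=
    (h₁.eventually (by simp)).mono fun y hy => hy.differentiableAt (by simp)
  have hrem0 : (0 : Fin (2 * (p + 1) + 1)).removeNth X' = fun i => (X i, 0) := by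
    funext i; simp [X', Fin.removeNth]
  have hT : HasDerivAt (fun s : ℝ =>
      altSum (pairTrace tr (connCurv (fun y => A₀ y + s • (A₁ y - A₀ y)) x) (p + 1)) X)
      (fderiv ℝ (fun z => altSum (pairTrace tr (connCurv Ã z) (p + 1)) fun i => (X i, 0))
        (x, t) (0, 1)) t := by
    have hc : HasDerivAt (fun s : ℝ => (x, s)) ((0 : E), (1 : ℝ)) t :=
      (hasDerivAt_const t x).prodMk (hasDerivAt_id t)
    have := (hdiff fun i => (X i, 0)).hasFDerivAt.comp_hasDerivAt t hc
    have hfun : (fun s : ℝ =>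
        altSum (pairTrace tr (connCurv (fun y => A₀ y + s • (A₁ y - A₀ y)) x) (p + 1)) X)
        = (fun z => altSum (pairTrace tr (connCurv Ã z) (p + 1)) fun i => (X i, 0))
          ∘ Prod.mk x := by
      funext s
      simp only [Function.comp_apply, altSum, pairTrace]
      simp only [Ã, connCurv_cyl e₀.self_of_nhds e₁.self_of_nhds, cylCurv, zero_smul, sub_self,
        add_zero]
    rw [hfun]
    exact this
  convert hT using 1
  rw [hrem0] at hclosed
  simp only [Fin.val_zero, pow_zero, one_smul, Fin.val_succ, pow_succ, mul_neg, mul_one, neg_smul,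
    Finset.sum_neg_distrib] at hclosed
  have hX0 : X' 0 = (0, 1) := rfl
  rw [hX0] at hclosed
  refine Eq.trans ?_ (sub_eq_zero.mp (by rw [sub_eq_add_neg]; exact hclosed)).symm
  refine Finset.sum_congr rfl fun i _ => ?_
  congr 1
  have hX1 : X' i.succ = (X i, 0) := rfl
  have hcX : i.succ.removeNth X' = cylArgs (i.removeNth X) := by
    refine (removeNth_succ_cons _ _ _).trans ?_
    rfl
  rw [hX1, hcX]
  have hc : HasFDerivAt (fun y : E => (y, t)) (ContinuousLinearMap.inl ℝ E ℝ) x :=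
    (hasFDerivAt_id x).prodMk (hasFDerivAt_const t x)
  have h2 := HasFDerivAt.comp x (g := fun z => altSum (pairTrace tr (connCurv Ã z) (p + 1))
    (cylArgs (i.removeNth X))) (hdiff _).hasFDerivAt hc
  -- `connCurv_cyl` needs both forms to be differentiable at the point, so the two functions are
  -- compared as germs at `x`.
  have h3 : (fun y => altSum (pairTrace tr (cylCurv (connCurv (fun y => A₀ y + t • (A₁ y - A₀ y)) y)
          (A₁ y - A₀ y)) (p + 1)) (cylArgs (i.removeNth X))) =ᶠ[𝓝 x]
      ((fun z => altSum (pairTrace tr (connCurv Ã z) (p + 1)) (cylArgs (i.removeNth X)))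
        ∘ fun y => (y, t)) := by
    filter_upwards [e₀, e₁] with y hy₀ hy₁
    simp only [Function.comp_apply, altSum, pairTrace, Ã, connCurv_cyl hy₀ hy₁]
  rw [h3.fderiv_eq, h2.fderiv]
  rfl

/-- Each of the `p` factors has degree at most 2 in `t`. -/
theorem altSum_pairTrace_line_mem_polyFun (tr : 𝔸 →L[ℝ] ℂ) {A₀ A₁ : E → E →L[ℝ] 𝔸} {x : E}
    (h₀ : DifferentiableAt ℝ A₀ x) (h₁ : DifferentiableAt ℝ A₁ x) (p : ℕ) (X : Fin (2 * p) → E) :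
    (fun t : ℝ => altSum (pairTrace tr (connCurv (fun y => A₀ y + t • (A₁ y - A₀ y)) x) p) X)
      ∈ polyFun (2 * p) ℂ := by
  have : (fun t : ℝ => altSum (pairTrace tr (connCurv (fun y => A₀ y + t • (A₁ y - A₀ y)) x) p) X)
    = ∑ σ : Equiv.Perm (Fin (2 * p)), (Equiv.Perm.sign σ : ℤ) • fun t : ℝ =>
      pairTrace tr (connCurv (fun y => A₀ y + t • (A₁ y - A₀ y)) x) p (X ∘ σ) := by
    funext t
    simp [altSum]
  rw [this]
  refine Submodule.sum_mem _ fun σ _ => zsmul_mem ?_ _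
  refine clm_comp_mem_polyFun tr (list_prod_mem_polyFun fun a => ?_)
  simp only [connCurv_line h₀ h₁]
  refine Submodule.add_mem _ (Submodule.add_mem _ ?_ ?_) ?_
  · exact (fun c : 𝔸 => by
      simpa using pow_smul_mem_polyFun (N := 2) (k := 0) (by norm_num) c :
      ∀ c : 𝔸, (fun _ : ℝ => c) ∈ polyFun 2 𝔸) _
  · exact (fun c : 𝔸 => by
      simpa using pow_smul_mem_polyFun (N := 2) (k := 1) (by norm_num) c :
      ∀ c : 𝔸, (fun t : ℝ => t • c) ∈ polyFun 2 𝔸) _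
  · exact pow_smul_mem_polyFun (N := 2) (k := 2) (by norm_num) (_ : 𝔸)

end Transgression

/-! ### Smoothness of families of alternating maps, tested on vectors -/

section Evaluation

/-- Alternating maps on a finite-dimensional space depend smoothly on a parameter if all their
values do. -/
theorem contDiffOn_alternating_of_apply {E E' F : Type*} [NormedAddCommGroup E] [NormedSpace ℝ E]
    [FiniteDimensional ℝ E] [NormedAddCommGroup E'] [NormedSpace ℝ E'] [NormedAddCommGroup F]
    [NormedSpace ℝ F] [FiniteDimensional ℝ F] {k : ℕ} {n : ℕ∞ω} {β : E' → E [⋀^Fin k]→L[ℝ] F}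
    {s : Set E'} (h : ∀ X : Fin k → E, ContDiffOn ℝ n (fun y => β y X) s) : ContDiffOn ℝ n β s := by
  let b := Module.finBasis ℝ E
  -- Evaluation on tuples of basis vectors is injective. A linear left inverse is continuous, its
  -- source being finite-dimensional, and rebuilds `β` from its smooth values.
  let ev : (E [⋀^Fin k]→L[ℝ] F) →ₗ[ℝ] ((Fin k → Fin (Module.finrank ℝ E)) → F) :=
    { toFun := fun α c => α fun i => b (c i)
      map_add' := fun _ _ => rfl
      map_smul' := fun _ _ => rfl }
  have hev : LinearMap.ker ev = ⊥ := by
    rw [LinearMap.ker_eq_bot']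
    intro α hα
    have h1 : α.toAlternatingMap.toMultilinearMap = 0 :=
      Module.Basis.ext_multilinear (fun _ => b) fun c => congrFun hα c
    ext X
    exact congrArg (fun m : MultilinearMap ℝ (fun _ : Fin k => E) F => m X) h1
  obtain ⟨L, hL⟩ := LinearMap.exists_leftInverse_of_injective ev hev
  let Lc : ((Fin k → Fin (Module.finrank ℝ E)) → F) →L[ℝ] (E [⋀^Fin k]→L[ℝ] F) :=
    ⟨L, L.continuous_of_finiteDimensional⟩
  have h1 : ContDiffOn ℝ n (fun y => ev (β y)) s := contDiffOn_pi.2 fun c => h _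
  have h2 : β = fun y => Lc (ev (β y)) := by
    funext y
    exact (congrArg (fun f : _ →ₗ[ℝ] _ => f (β y)) hL).symm
  rw [h2]
  exact Lc.contDiff.comp_contDiffOn h1

end Evaluation

/-! ### Forms and exterior derivatives in charts -/

section Charts

/-- Linear maps as alternating maps of one variable. -/
noncomputable abbrev oneFormLIE (E F : Type*) [NormedAddCommGroup E] [NormedSpace ℝ E]
    [NormedAddCommGroup F] [NormedSpace ℝ F] : (E →L[ℝ] F) ≃ₗᵢ[ℝ] (E [⋀^Fin 1]→L[ℝ] F) :=
  ContinuousAlternatingMap.ofSubsingletonLIE (0 : Fin 1)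

variable {d : ℕ} {V : Type u} [TopologicalSpace V] [ChartedSpace (EuclideanSpace ℝ (Fin d)) V]
variable {F : Type*} [NormedAddCommGroup F] [NormedSpace ℝ F]

/-- The differential of the preferred chart at `x₀`. -/
noncomputable def chartD (x₀ x : V) : TangentSpace (𝓡 d) x →L[ℝ] EuclideanSpace ℝ (Fin d) :=
  mfderiv (𝓡 d) 𝓘(ℝ, EuclideanSpace ℝ (Fin d)) (extChartAt (𝓡 d) x₀) x

/-- The differential of the inverse of the preferred chart at `x₀`. -/
noncomputable def chartDSymm (x₀ : V) (y : EuclideanSpace ℝ (Fin d)) :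
    EuclideanSpace ℝ (Fin d) →L[ℝ] TangentSpace (𝓡 d) ((extChartAt (𝓡 d) x₀).symm y) :=
  mfderiv 𝓘(ℝ, EuclideanSpace ℝ (Fin d)) (𝓡 d) (extChartAt (𝓡 d) x₀).symm y

theorem exists_chart_point (x : V) :
    ∃ (x₀ : V) (y : EuclideanSpace ℝ (Fin d)), y ∈ (extChartAt (𝓡 d) x₀).target ∧
      (extChartAt (𝓡 d) x₀).symm y = x :=
  ⟨x, extChartAt (𝓡 d) x x, mem_extChartAt_target x, extChartAt_to_inv x⟩

theorem chart_target_inter_preimage_isOpen (x₀ : V) {U : Set V} (hU : IsOpen U) :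
    IsOpen ((extChartAt (𝓡 d) x₀).target ∩ (extChartAt (𝓡 d) x₀).symm ⁻¹' U) :=
  (continuousOn_extChartAt_symm x₀).isOpen_inter_preimage (isOpen_extChartAt_target x₀) hU

theorem DForm.inChart_apply {k : ℕ} (α : DForm d V k F) (x₀ : V) (y : EuclideanSpace ℝ (Fin d))
    (X : Fin k → EuclideanSpace ℝ (Fin d)) :
    DForm.inChart α x₀ y X = α ((extChartAt (𝓡 d) x₀).symm y) fun i => chartDSymm x₀ y (X i) :=
  rfl

theorem DForm.smoothOn_of_apply [FiniteDimensional ℝ F] {k : ℕ} {α : DForm d V k F} {U : Set V}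
    (h : ∀ (x₀ : V) (X : Fin k → EuclideanSpace ℝ (Fin d)),
      ContDiffOn ℝ ∞ (fun y => α ((extChartAt (𝓡 d) x₀).symm y) fun i => chartDSymm x₀ y (X i))
        ((extChartAt (𝓡 d) x₀).target ∩ (extChartAt (𝓡 d) x₀).symm ⁻¹' U)) :
    DForm.SmoothOn α U := fun x₀ =>
  contDiffOn_alternating_of_apply fun X => h x₀ X

theorem DForm.smoothOn_univ_of_local {k : ℕ} {α : DForm d V k F}
    (h : ∀ x, ∃ U, IsOpen U ∧ x ∈ U ∧ DForm.SmoothOn α U) : DForm.SmoothOn α Set.univ := by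
  intro x₀ y hy
  obtain ⟨U, hU, hx, hα⟩ := h ((extChartAt (𝓡 d) x₀).symm y)
  exact (((hα x₀).contDiffAt ((chart_target_inter_preimage_isOpen x₀ hU).mem_nhds
    ⟨hy.1, hx⟩))).contDiffWithinAt

theorem DForm.SmoothOn.contDiffAt {k : ℕ} {α : DForm d V k F} {U : Set V}
    (h : DForm.SmoothOn α U) (hU : IsOpen U) {x₀ : V} {y : EuclideanSpace ℝ (Fin d)}
    (hy : y ∈ (extChartAt (𝓡 d) x₀).target) (hyU : (extChartAt (𝓡 d) x₀).symm y ∈ U) :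
    ContDiffAt ℝ ∞ (DForm.inChart α x₀) y :=
  (h x₀).contDiffAt ((chart_target_inter_preimage_isOpen x₀ hU).mem_nhds ⟨hy, hyU⟩)

/-- A `1`-form with its expression in a chart seen as a function with linear values. -/
noncomputable def DForm.oneChart (α : DForm d V 1 F) (x₀ : V) (y : EuclideanSpace ℝ (Fin d)) :
    EuclideanSpace ℝ (Fin d) →L[ℝ] F :=
  (oneFormLIE (EuclideanSpace ℝ (Fin d)) F).symm (DForm.inChart α x₀ y)

theorem DForm.oneChart_apply (α : DForm d V 1 F) (x₀ : V) (y X : EuclideanSpace ℝ (Fin d)) :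
    DForm.oneChart α x₀ y X = α ((extChartAt (𝓡 d) x₀).symm y) ![chartDSymm x₀ y X] := by
  have : (fun _ : Fin 1 => chartDSymm x₀ y X) = ![chartDSymm x₀ y X] := by
    funext i
    fin_cases i
    rfl
  rw [← this]
  rfl

theorem DForm.SmoothOn.contDiffAt_oneChart {α : DForm d V 1 F} {U : Set V}
    (h : DForm.SmoothOn α U) (hU : IsOpen U) {x₀ : V} {y : EuclideanSpace ℝ (Fin d)}
    (hy : y ∈ (extChartAt (𝓡 d) x₀).target) (hyU : (extChartAt (𝓡 d) x₀).symm y ∈ U) :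
    ContDiffAt ℝ ∞ (DForm.oneChart α x₀) y :=
  (oneFormLIE (EuclideanSpace ℝ (Fin d)) F).symm.contDiff.contDiffAt.comp y
    (h.contDiffAt hU hy hyU)

variable [IsManifold (𝓡 d) ∞ V]

theorem isManifold_one (d : ℕ) (V : Type u) [TopologicalSpace V]
    [ChartedSpace (EuclideanSpace ℝ (Fin d)) V] [IsManifold (𝓡 d) ∞ V] : IsManifold (𝓡 d) 1 V :=
  IsManifold.of_le (n := ∞) (by simp)

theorem mdifferentiableAt_chart_symm {x₀ : V} {y : EuclideanSpace ℝ (Fin d)}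
    (hy : y ∈ (extChartAt (𝓡 d) x₀).target) :
    MDifferentiableAt 𝓘(ℝ, EuclideanSpace ℝ (Fin d)) (𝓡 d) (extChartAt (𝓡 d) x₀).symm y := by
  have := isManifold_one d V
  exact ((contMDiffOn_extChartAt_symm x₀).contMDiffAt
    ((isOpen_extChartAt_target x₀).mem_nhds hy)).mdifferentiableAt one_ne_zero

theorem mdifferentiableAt_chart {x₀ x : V} (hx : x ∈ (extChartAt (𝓡 d) x₀).source) :
    MDifferentiableAt (𝓡 d) 𝓘(ℝ, EuclideanSpace ℝ (Fin d)) (extChartAt (𝓡 d) x₀) x := by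
  have := isManifold_one d V
  exact mdifferentiableAt_extChartAt (by rwa [extChartAt_source] at hx)

theorem chartD_chartDSymm {x₀ : V} {y : EuclideanSpace ℝ (Fin d)}
    (hy : y ∈ (extChartAt (𝓡 d) x₀).target) (u : EuclideanSpace ℝ (Fin d)) :
    chartD x₀ _ (chartDSymm x₀ y u) = u := by
  have := isManifold_one d V
  have h := mfderiv_extChartAt_comp_mfderivWithin_extChartAt_symm hy
  rw [ModelWithCorners.Boundaryless.range_eq_univ, mfderivWithin_univ] at h
  exact congrArg (fun L => L u) h

theorem chartDSymm_chartD {x₀ : V} {y : EuclideanSpace ℝ (Fin d)}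
    (hy : y ∈ (extChartAt (𝓡 d) x₀).target)
    (X : TangentSpace (𝓡 d) ((extChartAt (𝓡 d) x₀).symm y)) :
    chartDSymm x₀ y (chartD x₀ _ X) = X := by
  have := isManifold_one d V
  have h := mfderivWithin_extChartAt_symm_comp_mfderiv_extChartAt hy
  rw [ModelWithCorners.Boundaryless.range_eq_univ, mfderivWithin_univ] at h
  exact congrArg (fun L => L X) h

theorem DForm.eq_of_inChart_eq {k : ℕ} {α β : DForm d V k F} {x₀ : V}
    {y : EuclideanSpace ℝ (Fin d)} (hy : y ∈ (extChartAt (𝓡 d) x₀).target)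
    (h : ∀ X, DForm.inChart α x₀ y X = DForm.inChart β x₀ y X) :
    α ((extChartAt (𝓡 d) x₀).symm y) = β ((extChartAt (𝓡 d) x₀).symm y) := by
  ext X
  have := h fun i => chartD x₀ _ (X i)
  simpa only [DForm.inChart_apply, chartDSymm_chartD hy] using this

theorem hasFDerivAt_chart_transition {x₀ x₁ : V} {y : EuclideanSpace ℝ (Fin d)}
    (hy : y ∈ (extChartAt (𝓡 d) x₀).target)
    (hy₁ : (extChartAt (𝓡 d) x₀).symm y ∈ (extChartAt (𝓡 d) x₁).source) :
    HasFDerivAt (fun z => extChartAt (𝓡 d) x₁ ((extChartAt (𝓡 d) x₀).symm z))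
      ((chartD x₁ _).comp (chartDSymm x₀ y)) y :=
  ((mdifferentiableAt_chart hy₁).hasMFDerivAt.comp y
    (mdifferentiableAt_chart_symm hy).hasMFDerivAt).hasFDerivAt

theorem contDiffAt_chart_transition {x₀ x₁ : V} {y : EuclideanSpace ℝ (Fin d)}
    (hy : y ∈ (extChartAt (𝓡 d) x₀).target)
    (hy₁ : (extChartAt (𝓡 d) x₀).symm y ∈ (extChartAt (𝓡 d) x₁).source) :
    ContDiffAt ℝ ∞ (fun z => extChartAt (𝓡 d) x₁ ((extChartAt (𝓡 d) x₀).symm z)) y := by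
  rw [← contMDiffAt_iff_contDiffAt]
  exact (contMDiffAt_extChartAt' (by rwa [extChartAt_source] at hy₁)).comp y
    ((contMDiffOn_extChartAt_symm x₀).contMDiffAt ((isOpen_extChartAt_target x₀).mem_nhds hy))

theorem chartDSymm_chart {x₁ x : V} (hx : x ∈ (extChartAt (𝓡 d) x₁).source) {k : ℕ}
    (α : DForm d V k F) (X : Fin k → TangentSpace (𝓡 d) x) :
    DForm.inChart α x₁ (extChartAt (𝓡 d) x₁ x) (fun i => chartD x₁ x (X i)) = α x X := by
  obtain ⟨y, hy, rfl⟩ : ∃ y ∈ (extChartAt (𝓡 d) x₁).target, (extChartAt (𝓡 d) x₁).symm y = x :=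
    ⟨_, (extChartAt (𝓡 d) x₁).map_source hx, (extChartAt (𝓡 d) x₁).left_inv hx⟩
  rw [(extChartAt (𝓡 d) x₁).right_inv hy, DForm.inChart_apply]
  simp only [chartDSymm_chartD hy]

/-- The exterior derivative can be computed in every chart. -/
theorem DForm.inChart_extD {k : ℕ} {α : DForm d V k F} {U : Set V} (hU : IsOpen U)
    (hα : DForm.SmoothOn α U) {x₀ : V} {y : EuclideanSpace ℝ (Fin d)}
    (hy : y ∈ (extChartAt (𝓡 d) x₀).target) (hyU : (extChartAt (𝓡 d) x₀).symm y ∈ U) :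
    DForm.inChart (DForm.extD α) x₀ y = extDeriv (DForm.inChart α x₀) y := by
  set x := (extChartAt (𝓡 d) x₀).symm y with hx
  let g : EuclideanSpace ℝ (Fin d) → EuclideanSpace ℝ (Fin d) := fun z =>
    extChartAt (𝓡 d) x ((extChartAt (𝓡 d) x₀).symm z)
  have hxs : x ∈ (extChartAt (𝓡 d) x).source := mem_extChartAt_source x
  -- Near `y` the expression in the chart at `x₀` is the pull-back, by the transition map `g`, of
  -- the expression in the preferred chart at `x`, which defines `DForm.extD` at `x`. The exterior
  -- derivative commutes with pull-backs.
  have hev : DForm.inChart α x₀ =ᶠ[𝓝 y] fun z =>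
      (DForm.inChart α x (g z)).compContinuousLinearMap (fderiv ℝ g z) := by
    have hopen := chart_target_inter_preimage_isOpen (d := d) x₀
      (isOpen_extChartAt_source (I := 𝓡 d) x)
    filter_upwards [hopen.mem_nhds ⟨hy, hxs⟩] with z hz
    rw [(hasFDerivAt_chart_transition hz.1 hz.2).fderiv]
    ext X
    exact (chartDSymm_chart hz.2 α fun i => chartDSymm x₀ z (X i)).symm
  have hgx : g y = extChartAt (𝓡 d) x x := rfl
  have hd : DifferentiableAt ℝ (DForm.inChart α x) (g y) :=
    (hα.contDiffAt hU (mem_extChartAt_target x) (by rwa [extChartAt_to_inv])).differentiableAt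
      (by simp)
  rw [hev.extDeriv_eq, extDeriv_pullback hd (contDiffAt_chart_transition hy hxs) (r := ∞)
    (by rw [minSmoothness_of_isRCLikeNormedField]; exact WithTop.coe_le_coe.2 (le_top (a := (2 : ℕ∞))))]
  rw [(hasFDerivAt_chart_transition hy hxs).fderiv]
  rfl

theorem extDeriv_one_apply {E : Type*} [NormedAddCommGroup E] [NormedSpace ℝ E]
    {β : E → E [⋀^Fin 1]→L[ℝ] F} {y : E} (h : DifferentiableAt ℝ β y) (X Y : E) :
    extDeriv β y ![X, Y]
      = fderiv ℝ (fun z => (oneFormLIE E F).symm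
          (β z)) y X Y
        - fderiv ℝ (fun z => (oneFormLIE E F).symm
          (β z)) y Y X := by
  have hd : DifferentiableAt ℝ (fun z =>
      (oneFormLIE E F).symm (β z)) y :=
    (oneFormLIE E F).symm.differentiableAt.comp y h
  have h1 : ∀ (Z : Fin 1 → E) (W : E), fderiv ℝ (fun z => β z Z) y W
      = fderiv ℝ (fun z => (oneFormLIE E F).symm
          (β z)) y W (Z 0) := by
    intro Z W
    have e : (fun z => β z Z) = fun z =>
        (oneFormLIE E F).symm (β z) (Z 0) := by
      funext z
      have : Z = fun _ => Z 0 := by funext i; fin_cases i; rfl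
      rw [this]
      rfl
    rw [e, (hd.hasFDerivAt.clm_apply (hasFDerivAt_const (Z 0) y)).fderiv]
    simp
  rw [extDeriv_apply h, Fin.sum_univ_two, h1, h1]
  simp [Fin.removeNth, sub_eq_add_neg]

theorem DForm.extD_apply_chartDSymm {α : DForm d V 1 F} {U : Set V} (hU : IsOpen U)
    (hα : DForm.SmoothOn α U) {x₀ : V} {y : EuclideanSpace ℝ (Fin d)}
    (hy : y ∈ (extChartAt (𝓡 d) x₀).target) (hyU : (extChartAt (𝓡 d) x₀).symm y ∈ U)
    (X Y : EuclideanSpace ℝ (Fin d)) :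
    DForm.extD α ((extChartAt (𝓡 d) x₀).symm y) ![chartDSymm x₀ y X, chartDSymm x₀ y Y]
      = fderiv ℝ (DForm.oneChart α x₀) y X Y - fderiv ℝ (DForm.oneChart α x₀) y Y X := by
  have h1 := congrArg (fun β => β ![X, Y]) (DForm.inChart_extD hU hα hy hyU)
  have h2 := extDeriv_one_apply ((hα.contDiffAt hU hy hyU).differentiableAt (by simp)) X Y
  refine Eq.trans ?_ (h1.trans h2)
  rw [DForm.inChart_apply]
  congr 1
  funext i
  fin_cases i <;> rfl

theorem formCurv_chartDSymm {v : Type*} [NormedAddCommGroup v] [NormedSpace ℂ v]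
    {A : DForm d V 1 (v →L[ℂ] v)} {U : Set V} (hU : IsOpen U)
    (hA : DForm.SmoothOn A U) {x₀ : V} {y : EuclideanSpace ℝ (Fin d)}
    (hy : y ∈ (extChartAt (𝓡 d) x₀).target) (hyU : (extChartAt (𝓡 d) x₀).symm y ∈ U)
    (X Y : EuclideanSpace ℝ (Fin d)) :
    formCurv A ((extChartAt (𝓡 d) x₀).symm y) (chartDSymm x₀ y X) (chartDSymm x₀ y Y)
      = connCurv (DForm.oneChart A x₀) y X Y := by
  unfold formCurv connCurv
  rw [DForm.extD_apply_chartDSymm hU hA hy hyU]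
  simp only [DForm.oneChart_apply]

theorem fderiv_comp_chart_symm {f : V → F} {x₀ : V} {y : EuclideanSpace ℝ (Fin d)}
    (hy : y ∈ (extChartAt (𝓡 d) x₀).target)
    (hf : MDifferentiableAt (𝓡 d) 𝓘(ℝ, F) f ((extChartAt (𝓡 d) x₀).symm y))
    (X : EuclideanSpace ℝ (Fin d)) :
    fderiv ℝ (fun z => f ((extChartAt (𝓡 d) x₀).symm z)) y X
      = mvfderiv (𝓡 d) f ((extChartAt (𝓡 d) x₀).symm y) (chartDSymm x₀ y X) := by
  have h := (hf.hasMFDerivAt.comp y (mdifferentiableAt_chart_symm hy).hasMFDerivAt).hasFDerivAt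
  have h2 : HasFDerivAt (fun z => f ((extChartAt (𝓡 d) x₀).symm z))
      ((mvfderiv (𝓡 d) f ((extChartAt (𝓡 d) x₀).symm y)).comp (chartDSymm x₀ y)) y := h
  rw [h2.fderiv]
  rfl

theorem contDiffOn_comp_chart_symm {f : V → F} {U : Set V} {n : ℕ∞ω} (hn : n ≤ ∞)
    (hf : ContMDiffOn (𝓡 d) 𝓘(ℝ, F) n f U) (x₀ : V) :
    ContDiffOn ℝ n (fun z => f ((extChartAt (𝓡 d) x₀).symm z))
      ((extChartAt (𝓡 d) x₀).target ∩ (extChartAt (𝓡 d) x₀).symm ⁻¹' U) := by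
  rw [← contMDiffOn_iff_contDiffOn]
  exact hf.comp (((contMDiffOn_extChartAt_symm (n := ∞) x₀).of_le hn).mono Set.inter_subset_left)
    fun y hy => hy.2

end Charts

/-! ### Chern and transgression expressions as alternating maps -/

section AlternatingForms

/-- Expanding the arguments in a basis gives a finite sum of products of coordinates with constant
coefficients. -/
theorem MultilinearMap.continuous_of_finiteDimensional_real {E F : Type*} [NormedAddCommGroup E]
    [NormedSpace ℝ E] [FiniteDimensional ℝ E] [NormedAddCommGroup F] [NormedSpace ℝ F] {k : ℕ}
    (f : MultilinearMap ℝ (fun _ : Fin k => E) F) : Continuous f := by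
  let b := Module.finBasis ℝ E
  have h : ⇑f = fun X : Fin k → E => ∑ c : Fin k → Fin (Module.finrank ℝ E),
      (∏ i, b.coord (c i) (X i)) • f fun i => b (c i) := by
    funext X
    have hX : X = fun i => ∑ j, b.coord j (X i) • b j := by
      funext i
      exact (b.sum_repr (X i)).symm
    conv_lhs => rw [hX]
    rw [MultilinearMap.map_sum]
    refine Finset.sum_congr rfl fun c _ => ?_
    rw [MultilinearMap.map_smul_univ]
  rw [h]
  refine continuous_finsetSum _ fun c _ => (continuous_finsetProd _ fun i _ => ?_).smul
    continuous_const
  exact (b.coord (c i)).continuous_of_finiteDimensional.comp (continuous_apply i)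

variable {T 𝔸 : Type*} [AddCommGroup T] [Module ℝ T] [NormedRing 𝔸] [NormedAlgebra ℝ 𝔸]

/-- The slots 2a and 2a+1 enter the factor `a` only, so multilinearity in the 2p arguments reduces
to that of a product of `p` factors. -/
theorem update_pair_fst {R : T → T → 𝔸} {p : ℕ} (X : Fin (2 * p) → T) (a : Fin p) (x : T) :
    (fun b : Fin p => R (Function.update X ⟨2 * a, by omega⟩ x ⟨2 * b, by omega⟩)
        (Function.update X ⟨2 * a, by omega⟩ x ⟨2 * b + 1, by omega⟩))
      = Function.update (fun b : Fin p => R (X ⟨2 * b, by omega⟩) (X ⟨2 * b + 1, by omega⟩)) a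
        (R x (X ⟨2 * a + 1, by omega⟩)) := by
  funext b
  by_cases h : b = a
  · subst h
    rw [Function.update_self, Function.update_self, Function.update_of_ne]
    simp
  · have h' : (b : ℕ) ≠ a := fun h' => h (Fin.ext h')
    rw [Function.update_of_ne h, Function.update_of_ne, Function.update_of_ne] <;>
      simp [Fin.ext_iff] <;> omega

theorem update_pair_snd {R : T → T → 𝔸} {p : ℕ} (X : Fin (2 * p) → T) (a : Fin p) (x : T) :
    (fun b : Fin p => R (Function.update X ⟨2 * a + 1, by omega⟩ x ⟨2 * b, by omega⟩)
        (Function.update X ⟨2 * a + 1, by omega⟩ x ⟨2 * b + 1, by omega⟩))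
      = Function.update (fun b : Fin p => R (X ⟨2 * b, by omega⟩) (X ⟨2 * b + 1, by omega⟩)) a
        (R (X ⟨2 * a, by omega⟩) x) := by
  funext b
  by_cases h : b = a
  · subst h
    rw [Function.update_self, Function.update_self, Function.update_of_ne]
    simp
  · have h' : (b : ℕ) ≠ a := fun h' => h (Fin.ext h')
    rw [Function.update_of_ne h, Function.update_of_ne, Function.update_of_ne] <;>
      simp [Fin.ext_iff] <;> omega

theorem exists_eq_two_mul {p : ℕ} (i : Fin (2 * p)) :
    ∃ a : Fin p, i = ⟨2 * a, by omega⟩ ∨ i = ⟨2 * a + 1, by omega⟩ := by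
  refine ⟨⟨i / 2, by omega⟩, ?_⟩
  simp only [Fin.ext_iff]
  omega

/-- `pairTrace` of a bilinear map as a multilinear map. -/
noncomputable def pairTraceMultilinear (tr : 𝔸 →L[ℝ] ℂ) {R : T → T → 𝔸} (hR : IsBilinearMap ℝ R)
    (p : ℕ) : MultilinearMap ℝ (fun _ : Fin (2 * p) => T) ℂ where
  toFun := pairTrace tr R p
  map_update_add' := by
    intro inst X i x y
    -- The field quantifies over all decidability instances on the index type; the instance is made
    -- the canonical one, for which `update_pair_fst` and `update_pair_snd` are stated.
    cases Subsingleton.elim inst (instDecidableEqFin _)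
    have hM : ∀ g : Fin p → 𝔸, (List.ofFn g).prod
        = ContinuousMultilinearMap.mkPiAlgebraFin ℝ p 𝔸 g := fun g =>
      (ContinuousMultilinearMap.mkPiAlgebraFin_apply g).symm
    obtain ⟨a, rfl | rfl⟩ := exists_eq_two_mul i
    · simp only [pairTrace, update_pair_fst, hM, hR.add_left, ContinuousMultilinearMap.map_update_add,
        map_add]
    · simp only [pairTrace, update_pair_snd, hM, hR.add_right,
        ContinuousMultilinearMap.map_update_add, map_add]
  map_update_smul' := by
    intro inst X i c x
    cases Subsingleton.elim inst (instDecidableEqFin _)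
    have hM : ∀ g : Fin p → 𝔸, (List.ofFn g).prod
        = ContinuousMultilinearMap.mkPiAlgebraFin ℝ p 𝔸 g := fun g =>
      (ContinuousMultilinearMap.mkPiAlgebraFin_apply g).symm
    obtain ⟨a, rfl | rfl⟩ := exists_eq_two_mul i
    · simp only [pairTrace, update_pair_fst, hM, hR.smul_left,
        ContinuousMultilinearMap.map_update_smul, map_smul]
    · simp only [pairTrace, update_pair_snd, hM, hR.smul_right,
        ContinuousMultilinearMap.map_update_smul, map_smul]

theorem exists_alternating_altSum {k : ℕ} (m : MultilinearMap ℝ (fun _ : Fin k => T) ℂ) :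
    ∃ α : T [⋀^Fin k]→ₗ[ℝ] ℂ, ∀ X, α X = altSum m X := by
  refine ⟨MultilinearMap.alternatization m, fun X => ?_⟩
  rw [MultilinearMap.alternatization_apply]
  rfl

theorem isBilinearMap_cylCurv {R : T → T → 𝔸} (hR : IsBilinearMap ℝ R) (a : T →ₗ[ℝ] 𝔸) :
    IsBilinearMap ℝ (cylCurv R a) where
  add_left X Y Z := by
    simp only [cylCurv, Prod.fst_add, Prod.snd_add, hR.add_left, map_add, add_smul, smul_add]; abel
  smul_left c X Y := by
    simp only [cylCurv, Prod.smul_fst, Prod.smul_snd, hR.smul_left, map_smul, smul_eq_mul]; module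
  add_right X Y Z := by
    simp only [cylCurv, Prod.fst_add, Prod.snd_add, hR.add_right, map_add, add_smul, smul_add]; abel
  smul_right c X Y := by
    simp only [cylCurv, Prod.smul_fst, Prod.smul_snd, hR.smul_right, map_smul, smul_eq_mul]; module

end AlternatingForms

section AlternatingFormsContinuous

variable {E 𝔸 : Type*} [NormedAddCommGroup E] [NormedSpace ℝ E] [FiniteDimensional ℝ E]
  [NormedRing 𝔸] [NormedAlgebra ℝ 𝔸]

theorem exists_continuousAlternating_pairTrace (tr : 𝔸 →L[ℝ] ℂ) {R : E → E → 𝔸}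
    (hR : IsBilinearMap ℝ R) (p : ℕ) :
    ∃ α : E [⋀^Fin (2 * p)]→L[ℝ] ℂ, ∀ X, α X = altSum (pairTrace tr R p) X := by
  obtain ⟨α, hα⟩ := exists_alternating_altSum (pairTraceMultilinear tr hR p)
  exact ⟨{ α with cont := α.toMultilinearMap.continuous_of_finiteDimensional_real }, hα⟩

/-- Contract the alternating form on E × ℝ with ∂/∂t and restrict it to vectors tangent to E. -/
theorem exists_continuousAlternating_cyl (tr : 𝔸 →L[ℝ] ℂ) {R : E → E → 𝔸}
    (hR : IsBilinearMap ℝ R) (a : E →ₗ[ℝ] 𝔸) (p : ℕ) :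
    ∃ α : E [⋀^Fin (2 * p + 1)]→L[ℝ] ℂ,
      ∀ X, α X = altSum (pairTrace tr (cylCurv R a) (p + 1)) (cylArgs X) := by
  obtain ⟨α, hα⟩ := exists_alternating_altSum
    (pairTraceMultilinear tr (isBilinearMap_cylCurv hR a) (p + 1))
  let β : E [⋀^Fin (2 * p + 1)]→ₗ[ℝ] ℂ :=
    (AlternatingMap.curryLeft (n := 2 * p + 1) α (0, 1)).compLinearMap (LinearMap.inl ℝ E ℝ)
  refine ⟨{ β with cont := β.toMultilinearMap.continuous_of_finiteDimensional_real }, fun X => ?_⟩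
  exact hα _

end AlternatingFormsContinuous

/-! ### Trace, normalization, and bilinearity of the curvature -/

section ChernForm

variable {v : Type*} [NormedAddCommGroup v] [NormedSpace ℂ v] [FiniteDimensional ℂ v]

variable (v) in
/-- The trace of endomorphisms, as a continuous real-linear map. -/
noncomputable def traceCLM : (v →L[ℂ] v) →L[ℝ] ℂ :=
  (LinearMap.toContinuousLinearMap
    ((LinearMap.trace ℂ v).comp (ContinuousLinearMap.coeLM ℂ))).restrictScalars ℝ

theorem traceCLM_apply (f : v →L[ℂ] v) : traceCLM v f = LinearMap.trace ℂ v f.toLinearMap := rfl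

theorem traceCLM_mul_comm (f g : v →L[ℂ] v) : traceCLM v (f * g) = traceCLM v (g * f) := by
  rw [traceCLM_apply, traceCLM_apply]
  exact LinearMap.trace_mul_comm ℂ f.toLinearMap g.toLinearMap

/-- The normalizing constant of the part of degree `2p` of the Chern character. -/
noncomputable def chernConst (p : ℕ) : ℂ :=
  ((p.factorial : ℂ))⁻¹ * (1 / (2 * (Real.pi : ℂ) * Complex.I)) ^ p * (1 / 2) ^ p

theorem chernPart_eq {T : Type*} (R : T → T → (v →L[ℂ] v)) (p : ℕ) (X : Fin (2 * p) → T) :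
    chernPart R p X = chernConst p * altSum (pairTrace (traceCLM v) R p) X := by
  unfold chernPart chernConst altSum
  congr 1
  refine Finset.sum_congr rfl fun σ _ => ?_
  rw [zsmul_eq_mul]
  rfl

end ChernForm

section FormCurv

variable {d : ℕ} {V : Type u} [TopologicalSpace V] [ChartedSpace (EuclideanSpace ℝ (Fin d)) V]
  {v : Type*} [NormedAddCommGroup v] [NormedSpace ℂ v]

theorem DForm.map_add_one {F : Type*} [NormedAddCommGroup F] [NormedSpace ℝ F]
    (A : DForm d V 1 F) (x : V) (X Y : TangentSpace (𝓡 d) x) :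
    A x ![X + Y] = A x ![X] + A x ![Y] := by
  have h := (A x).map_update_add ![X] 0 X Y
  have e : ∀ Z, Function.update ![X] 0 Z = ![Z] := fun Z => by
    funext i; fin_cases i; simp
  simpa only [e] using h

theorem DForm.map_smul_one {F : Type*} [NormedAddCommGroup F] [NormedSpace ℝ F]
    (A : DForm d V 1 F) (x : V) (c : ℝ) (X : TangentSpace (𝓡 d) x) :
    A x ![c • X] = c • A x ![X] := by
  have h := (A x).map_update_smul ![X] 0 c X
  have e : ∀ Z, Function.update ![X] 0 Z = ![Z] := fun Z => by
    funext i; fin_cases i; simp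
  simpa only [e] using h

theorem isBilinearMap_formCurv (A : DForm d V 1 (v →L[ℂ] v)) (x : V) :
    IsBilinearMap ℝ (formCurv A x) := by
  have e0 : ∀ X Y Z : TangentSpace (𝓡 d) x, Function.update ![X, Y] 0 Z = ![Z, Y] :=
    fun X Y Z => by funext i; fin_cases i <;> simp
  have e1 : ∀ X Y Z : TangentSpace (𝓡 d) x, Function.update ![X, Y] 1 Z = ![X, Z] :=
    fun X Y Z => by funext i; fin_cases i <;> simp
  constructor
  · intro X Y Z
    have h := (DForm.extD A x).map_update_add ![X, Z] 0 X Y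
    simp only [e0] at h
    simp only [formCurv, DForm.map_add_one, add_mul, mul_add]
    rw [h]; abel
  · intro c X Z
    have h := (DForm.extD A x).map_update_smul ![X, Z] 0 c X
    simp only [e0] at h
    simp only [formCurv, DForm.map_smul_one, smul_mul_assoc, mul_smul_comm]
    rw [h]; module
  · intro X Y Z
    have h := (DForm.extD A x).map_update_add ![X, Z] 1 Y Z
    simp only [e1] at h
    simp only [formCurv, DForm.map_add_one, add_mul, mul_add]
    rw [h]; abel
  · intro c X Z
    have h := (DForm.extD A x).map_update_smul ![X, Z] 1 c Z
    simp only [e1] at h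
    simp only [formCurv, DForm.map_smul_one, smul_mul_assoc, mul_smul_comm]
    rw [h]; module

end FormCurv

/-! ### Gluing local expressions of forms -/

section Gluing

variable {d : ℕ} {V : Type u} [TopologicalSpace V] [ChartedSpace (EuclideanSpace ℝ (Fin d)) V]
variable {F : Type*} [NormedAddCommGroup F] [NormedSpace ℝ F]

/-- Local expressions of a form which agree on the overlaps define a smooth form. -/
theorem DForm.exists_glued [FiniteDimensional ℝ F] {k : ℕ} {ι : Type*} {U : ι → Set V}
    (hU : ∀ i, IsOpen (U i)) (cover : ∀ x, ∃ i, x ∈ U i)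
    {f : ι → ∀ x : V, (Fin k → TangentSpace (𝓡 d) x) → F}
    (halt : ∀ i x, x ∈ U i → ∃ α : TangentSpace (𝓡 d) x [⋀^Fin k]→L[ℝ] F, ∀ X, α X = f i x X)
    (hagree : ∀ i j x, x ∈ U i → x ∈ U j → ∀ X, f i x X = f j x X)
    (hsmooth : ∀ i (x₀ : V) (X : Fin k → EuclideanSpace ℝ (Fin d)),
      ContDiffOn ℝ ∞ (fun y => f i ((extChartAt (𝓡 d) x₀).symm y) fun l => chartDSymm x₀ y (X l))
        ((extChartAt (𝓡 d) x₀).target ∩ (extChartAt (𝓡 d) x₀).symm ⁻¹' U i)) :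
    ∃ α : DForm d V k F, DForm.SmoothOn α Set.univ ∧ ∀ i, ∀ x ∈ U i, ∀ X, α x X = f i x X := by
  -- The index is chosen point by point, without any continuity. Smoothness is recovered on each
  -- open set of the cover, where the agreement of the expressions identifies the form with a single
  -- one of them.
  choose i hi using cover
  choose α hα using fun x => halt (i x) x (hi x)
  have key : ∀ j, ∀ x ∈ U j, ∀ X, α x X = f j x X := fun j x hx X => by
    rw [hα, hagree (i x) j x (hi x) hx]
  refine ⟨α, DForm.smoothOn_univ_of_local fun x => ⟨U (i x), hU _, hi x, ?_⟩, key⟩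
  refine DForm.smoothOn_of_apply fun x₀ X => (hsmooth (i x) x₀ X).congr fun y hy => ?_
  exact key _ _ hy.2 _

theorem DForm.extD_add {k : ℕ} {α β : DForm d V k F} (hα : DForm.SmoothOn α Set.univ)
    (hβ : DForm.SmoothOn β Set.univ) :
    DForm.extD (α + β) = DForm.extD α + DForm.extD β := by
  funext x
  have h1 := (hα.contDiffAt isOpen_univ (mem_extChartAt_target x) (Set.mem_univ _)).differentiableAt
    (by simp)
  have h2 := (hβ.contDiffAt isOpen_univ (mem_extChartAt_target x) (Set.mem_univ _)).differentiableAt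
    (by simp)
  have : DForm.inChart (α + β) x = DForm.inChart α x + DForm.inChart β x := rfl
  unfold DForm.extD
  rw [this, extDeriv_add h1 h2]
  rfl

theorem DForm.SmoothOn.add {k : ℕ} {α β : DForm d V k F} {U : Set V} (hα : DForm.SmoothOn α U)
    (hβ : DForm.SmoothOn β U) : DForm.SmoothOn (α + β) U := fun x₀ =>
  (hα x₀).add (hβ x₀)

variable [IsManifold (𝓡 d) ∞ V]

/-- The exterior derivative of a form in a chart. -/
theorem DForm.extD_apply_chart {k : ℕ} {α : DForm d V k F} (hα : DForm.SmoothOn α Set.univ)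
    {x₀ : V} {y : EuclideanSpace ℝ (Fin d)} (hy : y ∈ (extChartAt (𝓡 d) x₀).target)
    (X : Fin (k + 1) → EuclideanSpace ℝ (Fin d)) :
    DForm.inChart (DForm.extD α) x₀ y X
      = ∑ i : Fin (k + 1), (-1 : ℤ) ^ (i : ℕ) •
        fderiv ℝ (fun z => DForm.inChart α x₀ z (i.removeNth X)) y (X i) := by
  rw [DForm.inChart_extD isOpen_univ hα hy (Set.mem_univ _), extDeriv_apply
    ((hα.contDiffAt isOpen_univ hy (Set.mem_univ _)).differentiableAt (by simp))]

end Gluing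

/-! ### Chern and transgression forms of local connection forms -/

section LocalChern

theorem altSum_pairTrace_map {𝔸 T T' : Type*} [NormedRing 𝔸] (tr : 𝔸 → ℂ) {R : T → T → 𝔸}
    {R' : T' → T' → 𝔸} {f : T → T'} (h : ∀ X Y, R' (f X) (f Y) = R X Y) (p : ℕ)
    (X : Fin (2 * p) → T) :
    altSum (pairTrace tr R' p) (fun i => f (X i)) = altSum (pairTrace tr R p) X := by
  unfold altSum pairTrace
  simp only [Function.comp_apply, h]

theorem cylArgs_map {T T' : Type*} [Zero T] [Zero T'] {f : T → T'} (h0 : f 0 = 0) {k : ℕ}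
    (X : Fin k → T) :
    cylArgs (fun i => f (X i)) = fun j => Prod.map f id (cylArgs X j) := by
  funext j
  refine Fin.cases ?_ (fun j => ?_) j <;> simp [cylArgs, h0]

theorem contDiffOn_connCurv {E 𝔸 : Type*} [NormedAddCommGroup E] [NormedSpace ℝ E] [NormedRing 𝔸]
    [NormedAlgebra ℝ 𝔸] {A : E → E →L[ℝ] 𝔸} {s : Set E} (hs : IsOpen s) (hA : ContDiffOn ℝ ∞ A s)
    (X Y : E) : ContDiffOn ℝ ∞ (fun y => connCurv A y X Y) s := by
  have h1 : ContDiffOn ℝ ∞ (fun y => fderiv ℝ A y) s := hA.fderiv_of_isOpen hs (by simp)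
  have h2 : ∀ Z, ContDiffOn ℝ ∞ (fun y => A y Z) s := fun Z => hA.clm_apply contDiffOn_const
  have h3 : ∀ Z W, ContDiffOn ℝ ∞ (fun y => fderiv ℝ A y Z W) s := fun Z W =>
    (h1.clm_apply contDiffOn_const).clm_apply contDiffOn_const
  unfold connCurv
  exact ((h3 _ _).sub (h3 _ _)).add (((h2 _).mul (h2 _)).sub ((h2 _).mul (h2 _)))

variable {d : ℕ} {V : Type u} [TopologicalSpace V] [ChartedSpace (EuclideanSpace ℝ (Fin d)) V]
  [IsManifold (𝓡 d) ∞ V] {v : Type*} [NormedAddCommGroup v] [NormedSpace ℂ v]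

theorem DForm.SmoothOn.contDiffOn_oneChart {A : DForm d V 1 (v →L[ℂ] v)} {U : Set V}
    (hA : DForm.SmoothOn A U) (x₀ : V) : ContDiffOn ℝ ∞ (DForm.oneChart A x₀)
      ((extChartAt (𝓡 d) x₀).target ∩ (extChartAt (𝓡 d) x₀).symm ⁻¹' U) :=
  (oneFormLIE (EuclideanSpace ℝ (Fin d)) (v →L[ℂ] v)).symm.contDiff.comp_contDiffOn (hA x₀)

/-- The affine path of connection forms from `A₀` to `A₁`. -/
noncomputable def DForm.line (A₀ A₁ : DForm d V 1 (v →L[ℂ] v)) (t : ℝ) : DForm d V 1 (v →L[ℂ] v) :=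
  fun x => A₀ x + t • (A₁ x - A₀ x)

theorem DForm.line_apply (A₀ A₁ : DForm d V 1 (v →L[ℂ] v)) (t : ℝ) (x : V)
    (X : Fin 1 → TangentSpace (𝓡 d) x) :
    DForm.line A₀ A₁ t x X = A₀ x X + t • (A₁ x X - A₀ x X) := rfl

theorem DForm.oneChart_line (A₀ A₁ : DForm d V 1 (v →L[ℂ] v)) (t : ℝ) (x₀ : V) :
    DForm.oneChart (DForm.line A₀ A₁ t) x₀ = fun y =>
      DForm.oneChart A₀ x₀ y + t • (DForm.oneChart A₁ x₀ y - DForm.oneChart A₀ x₀ y) := by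
  funext y
  ext1 X
  simp only [DForm.oneChart_apply, add_apply, smul_apply, sub_apply]
  rfl

theorem DForm.SmoothOn.line {A₀ A₁ : DForm d V 1 (v →L[ℂ] v)} {U : Set V}
    (h₀ : DForm.SmoothOn A₀ U) (h₁ : DForm.SmoothOn A₁ U) (t : ℝ) :
    DForm.SmoothOn (DForm.line A₀ A₁ t) U := fun x₀ =>
  (h₀ x₀).add (((h₁ x₀).sub (h₀ x₀)).const_smul t)

variable [FiniteDimensional ℂ v]

/-- This reduces assertions about Chern forms on V to the theory on a normed space. -/
theorem chernPart_chartDSymm {A : DForm d V 1 (v →L[ℂ] v)} {U : Set V} (hU : IsOpen U)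
    (hA : DForm.SmoothOn A U) {x₀ : V} {y : EuclideanSpace ℝ (Fin d)}
    (hy : y ∈ (extChartAt (𝓡 d) x₀).target) (hyU : (extChartAt (𝓡 d) x₀).symm y ∈ U) (p : ℕ)
    (X : Fin (2 * p) → EuclideanSpace ℝ (Fin d)) :
    chernPart (formCurv A ((extChartAt (𝓡 d) x₀).symm y)) p (fun i => chartDSymm x₀ y (X i))
      = chernConst p * altSum (pairTrace (traceCLM v) (connCurv (DForm.oneChart A x₀) y) p) X := by
  rw [chernPart_eq, altSum_pairTrace_map (f := chartDSymm x₀ y) _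
    (fun X Y => formCurv_chartDSymm hU hA hy hyU X Y)]

/-- The local transgression form of degree `2p+1` between two connection forms, with the integral
over `[0, 1]` replaced by a quadrature with weights `c` at the nodes `0, 1, 2, …`. -/
noncomputable def transgression (A₀ A₁ : DForm d V 1 (v →L[ℂ] v)) {N : ℕ} (c : Fin N → ℝ) (p : ℕ)
    (x : V) (X : Fin (2 * p + 1) → TangentSpace (𝓡 d) x) : ℂ :=
  chernConst (p + 1) * ∑ j : Fin N, c j • altSum (pairTrace (traceCLM v)
    (cylCurv (formCurv (DForm.line A₀ A₁ j) x) (fun X => A₁ x ![X] - A₀ x ![X])) (p + 1)) (cylArgs X)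

theorem transgression_chartDSymm {A₀ A₁ : DForm d V 1 (v →L[ℂ] v)} {U : Set V} (hU : IsOpen U)
    (h₀ : DForm.SmoothOn A₀ U) (h₁ : DForm.SmoothOn A₁ U) {x₀ : V} {y : EuclideanSpace ℝ (Fin d)}
    (hy : y ∈ (extChartAt (𝓡 d) x₀).target) (hyU : (extChartAt (𝓡 d) x₀).symm y ∈ U)
    {N : ℕ} (c : Fin N → ℝ) (p : ℕ) (X : Fin (2 * p + 1) → EuclideanSpace ℝ (Fin d)) :
    transgression A₀ A₁ c p ((extChartAt (𝓡 d) x₀).symm y) (fun i => chartDSymm x₀ y (X i))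
      = chernConst (p + 1) * ∑ j : Fin N, c j • altSum (pairTrace (traceCLM v)
        (cylCurv (connCurv (fun z => DForm.oneChart A₀ x₀ z
          + (j : ℝ) • (DForm.oneChart A₁ x₀ z - DForm.oneChart A₀ x₀ z)) y)
          (DForm.oneChart A₁ x₀ y - DForm.oneChart A₀ x₀ y)) (p + 1)) (cylArgs X) := by
  unfold transgression
  congr 1
  refine Finset.sum_congr rfl fun j _ => ?_
  congr 1
  refine (congrArg _ (cylArgs_map (f := chartDSymm x₀ y) (map_zero _) X)).trans
    (altSum_pairTrace_map _ (fun X Y => ?_) (p + 1) (cylArgs X))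
  simp only [cylCurv, Prod.map_fst, Prod.map_snd, id, Pi.sub_apply, DForm.oneChart_apply, formCurv_chartDSymm hU (h₀.line h₁ j) hy hyU, DForm.oneChart_line]

theorem exists_alternating_chernPart (A : DForm d V 1 (v →L[ℂ] v)) (p : ℕ) (x : V) :
    ∃ α : TangentSpace (𝓡 d) x [⋀^Fin (2 * p)]→L[ℝ] ℂ, ∀ X, α X = chernPart (formCurv A x) p X := by
  obtain ⟨α, hα⟩ : ∃ α : TangentSpace (𝓡 d) x [⋀^Fin (2 * p)]→L[ℝ] ℂ,
      ∀ X, α X = altSum (pairTrace (traceCLM v) (formCurv A x) p) X :=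
    exists_continuousAlternating_pairTrace (E := EuclideanSpace ℝ (Fin d))
    (traceCLM v) (isBilinearMap_formCurv A x) p
  exact ⟨chernConst p • α, fun X => by rw [chernPart_eq, ← hα]; rfl⟩

theorem exists_alternating_transgression (A₀ A₁ : DForm d V 1 (v →L[ℂ] v)) {N : ℕ} (c : Fin N → ℝ)
    (p : ℕ) (x : V) : ∃ α : TangentSpace (𝓡 d) x [⋀^Fin (2 * p + 1)]→L[ℝ] ℂ,
      ∀ X, α X = transgression A₀ A₁ c p x X := by
  let a : TangentSpace (𝓡 d) x →ₗ[ℝ] (v →L[ℂ] v) :=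
    { toFun := fun X => A₁ x ![X] - A₀ x ![X]
      map_add' := fun X Y => by rw [DForm.map_add_one, DForm.map_add_one]; abel
      map_smul' := fun c X => by
        rw [DForm.map_smul_one, DForm.map_smul_one, RingHom.id_apply, smul_sub] }
  have h : ∀ j : Fin N, ∃ α : TangentSpace (𝓡 d) x [⋀^Fin (2 * p + 1)]→L[ℝ] ℂ,
      ∀ X, α X = altSum (pairTrace (traceCLM v)
        (cylCurv (formCurv (DForm.line A₀ A₁ j) x) a) (p + 1)) (cylArgs X) := fun j =>
    exists_continuousAlternating_cyl
    (E := EuclideanSpace ℝ (Fin d)) (traceCLM v)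
    (isBilinearMap_formCurv (DForm.line A₀ A₁ j) x) a p
  choose α hα using h
  refine ⟨chernConst (p + 1) • ∑ j, c j • α j, fun X => ?_⟩
  change chernConst (p + 1) * (∑ j, c j • α j) X = _
  rw [ContinuousAlternatingMap.sum_apply]
  unfold transgression
  congr 1
  refine Finset.sum_congr rfl fun j _ => ?_
  change c j • α j X = _
  rw [hα]
  rfl

theorem contDiffOn_chernPart_chart {A : DForm d V 1 (v →L[ℂ] v)} {U : Set V} (hU : IsOpen U)
    (hA : DForm.SmoothOn A U) (x₀ : V) (p : ℕ) (X : Fin (2 * p) → EuclideanSpace ℝ (Fin d)) :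
    ContDiffOn ℝ ∞ (fun y => chernPart (formCurv A ((extChartAt (𝓡 d) x₀).symm y)) p
        fun i => chartDSymm x₀ y (X i))
      ((extChartAt (𝓡 d) x₀).target ∩ (extChartAt (𝓡 d) x₀).symm ⁻¹' U) := by
  refine ContDiffOn.congr (f := fun y => chernConst p *
      altSum (pairTrace (traceCLM v) (connCurv (DForm.oneChart A x₀) y) p) X) ?_ fun y hy =>
    chernPart_chartDSymm hU hA hy.1 hy.2 p X
  exact contDiffOn_const.mul (contDiffOn_altSum (contDiffOn_pairTrace _ (contDiffOn_connCurv
    (chart_target_inter_preimage_isOpen x₀ hU) (hA.contDiffOn_oneChart x₀)) p) X)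

theorem contDiffOn_transgression_chart {A₀ A₁ : DForm d V 1 (v →L[ℂ] v)} {U : Set V}
    (hU : IsOpen U) (h₀ : DForm.SmoothOn A₀ U) (h₁ : DForm.SmoothOn A₁ U) {N : ℕ} (c : Fin N → ℝ)
    (x₀ : V) (p : ℕ) (X : Fin (2 * p + 1) → EuclideanSpace ℝ (Fin d)) :
    ContDiffOn ℝ ∞ (fun y => transgression A₀ A₁ c p ((extChartAt (𝓡 d) x₀).symm y)
        fun i => chartDSymm x₀ y (X i))
      ((extChartAt (𝓡 d) x₀).target ∩ (extChartAt (𝓡 d) x₀).symm ⁻¹' U) := by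
  have hs := chart_target_inter_preimage_isOpen (d := d) x₀ hU
  have c₀ := h₀.contDiffOn_oneChart x₀
  have c₁ := h₁.contDiffOn_oneChart x₀
  refine ContDiffOn.congr ?_ fun y hy => transgression_chartDSymm hU h₀ h₁ hy.1 hy.2 c p X
  refine contDiffOn_const.mul (ContDiffOn.sum fun j _ => ContDiffOn.const_smul (c j)
    (contDiffOn_altSum (contDiffOn_pairTrace _ (fun X Y => ?_) _) _))
  unfold cylCurv
  have h : ∀ Z, ContDiffOn ℝ ∞ (fun y => (⇑(DForm.oneChart A₁ x₀ y) - ⇑(DForm.oneChart A₀ x₀ y)) Z)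
      ((extChartAt (𝓡 d) x₀).target ∩ (extChartAt (𝓡 d) x₀).symm ⁻¹' U) := fun Z =>
    (c₁.clm_apply contDiffOn_const).sub (c₀.clm_apply contDiffOn_const)
  exact (contDiffOn_connCurv hs (c₀.add ((c₁.sub c₀).const_smul _)) _ _).add
    (((h _).const_smul _).sub ((h _).const_smul _))

/-- A form which is locally the Chern form of connection forms is closed. -/
theorem sum_fderiv_chernPart_chart {A : DForm d V 1 (v →L[ℂ] v)} {U : Set V} (hU : IsOpen U)
    (hA : DForm.SmoothOn A U) {x₀ : V} {y : EuclideanSpace ℝ (Fin d)}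
    (hy : y ∈ (extChartAt (𝓡 d) x₀).target) (hyU : (extChartAt (𝓡 d) x₀).symm y ∈ U) (p : ℕ)
    {α : DForm d V (2 * p) ℂ} (hα : ∀ x ∈ U, ∀ X, α x X = chernPart (formCurv A x) p X)
    (hαs : DForm.SmoothOn α Set.univ) (X : Fin (2 * p + 1) → EuclideanSpace ℝ (Fin d)) :
    DForm.inChart (DForm.extD α) x₀ y X = 0 := by
  rw [DForm.extD_apply_chart hαs hy]
  have hs := (chart_target_inter_preimage_isOpen x₀ hU).mem_nhds ⟨hy, hyU⟩
  have h := sum_fderiv_altSum_pairTrace (traceCLM v) traceCLM_mul_comm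
    (A := DForm.oneChart A x₀) (x := y) ((hA.contDiffAt_oneChart hU hy hyU).of_le
      (WithTop.coe_le_coe.2 (le_top (a := (2 : ℕ∞))))) p X
  have hf : ∀ i : Fin (2 * p + 1), fderiv ℝ (fun z => DForm.inChart α x₀ z (i.removeNth X)) y
      = chernConst p • fderiv ℝ (fun z => altSum (pairTrace (traceCLM v)
        (connCurv (DForm.oneChart A x₀) z) p) (i.removeNth X)) y := fun i => by
    rw [← fderiv_fun_const_smul (differentiableAt_altSum_pairTrace _ (fun X Y => ?_) _ _)]
    · refine Filter.EventuallyEq.fderiv_eq ?_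
      filter_upwards [hs] with z hz
      rw [DForm.inChart_apply, hα _ hz.2, chernPart_chartDSymm hU hA hz.1 hz.2]
      rfl
    · exact ((contDiffOn_connCurv (chart_target_inter_preimage_isOpen x₀ hU)
        (hA.contDiffOn_oneChart x₀) X Y).contDiffAt hs).differentiableAt (by simp)
  simp only [hf, smul_apply]
  simp only [smul_comm _ (chernConst p), ← Finset.smul_sum]
  rw [h, smul_zero]

/-- The transgression form, globally defined, is a primitive of the difference of Chern forms. -/
theorem extD_transgression_chart {A₀ A₁ : DForm d V 1 (v →L[ℂ] v)} {U : Set V} (hU : IsOpen U)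
    (h₀ : DForm.SmoothOn A₀ U) (h₁ : DForm.SmoothOn A₁ U) {x₀ : V} {y : EuclideanSpace ℝ (Fin d)}
    (hy : y ∈ (extChartAt (𝓡 d) x₀).target) (hyU : (extChartAt (𝓡 d) x₀).symm y ∈ U) (p : ℕ)
    {c : Fin (2 * (p + 1)) → ℝ} (hc : ∀ k ≤ 2 * (p + 1), (1 : ℝ) - 0 ^ k
      = ∑ j : Fin (2 * (p + 1)), c j * (k * (j : ℝ) ^ (k - 1)))
    {β : DForm d V (2 * p + 1) ℂ} (hβ : ∀ x ∈ U, ∀ X, β x X = transgression A₀ A₁ c p x X)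
    (hβs : DForm.SmoothOn β Set.univ) (X : Fin (2 * (p + 1)) → EuclideanSpace ℝ (Fin d)) :
    DForm.inChart (DForm.extD β) x₀ y X
      = chernPart (formCurv A₁ ((extChartAt (𝓡 d) x₀).symm y)) (p + 1)
          (fun i => chartDSymm x₀ y (X i))
        - chernPart (formCurv A₀ ((extChartAt (𝓡 d) x₀).symm y)) (p + 1)
          (fun i => chartDSymm x₀ y (X i)) := by
  have hs := (chart_target_inter_preimage_isOpen x₀ hU).mem_nhds ⟨hy, hyU⟩
  have c₀ := (h₀.contDiffAt_oneChart hU hy hyU)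
  have c₁ := (h₁.contDiffAt_oneChart hU hy hyU)
  have two_le : (2 : ℕ∞ω) ≤ ∞ := WithTop.coe_le_coe.2 (le_top (a := (2 : ℕ∞)))
  have hd := fun t => hasDerivAt_altSum_pairTrace (traceCLM v) traceCLM_mul_comm
    (c₀.of_le two_le) (c₁.of_le two_le) p X t
  -- The Chern form along the path has degree at most 2(p+1) in `t`, so the rule with 2(p+1) nodes
  -- computes its increment from t = 0 to t = 1 exactly.
  have hq := quadrature_polyFun hc (altSum_pairTrace_line_mem_polyFun (traceCLM v)
    (c₀.differentiableAt (by simp)) (c₁.differentiableAt (by simp)) (p + 1) X) hd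
  simp only [one_smul, zero_smul, add_zero, add_sub_cancel] at hq
  rw [DForm.extD_apply_chart hβs hy, chernPart_chartDSymm hU h₀ hy hyU,
    chernPart_chartDSymm hU h₁ hy hyU, ← mul_sub, hq]
  have hf : ∀ i : Fin (2 * p + 2), fderiv ℝ (fun z => DForm.inChart β x₀ z (i.removeNth X)) y
      = chernConst (p + 1) • ∑ j : Fin (2 * (p + 1)), c j • fderiv ℝ (fun z =>
        altSum (pairTrace (traceCLM v) (cylCurv (connCurv (fun z => DForm.oneChart A₀ x₀ z
          + (j : ℝ) • (DForm.oneChart A₁ x₀ z - DForm.oneChart A₀ x₀ z)) z)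
          (DForm.oneChart A₁ x₀ z - DForm.oneChart A₀ x₀ z)) (p + 1))
          (cylArgs (i.removeNth X))) y := fun i => by
    have hdj : ∀ j : Fin (2 * (p + 1)), DifferentiableAt ℝ (fun z =>
        altSum (pairTrace (traceCLM v) (cylCurv (connCurv (fun z => DForm.oneChart A₀ x₀ z
          + (j : ℝ) • (DForm.oneChart A₁ x₀ z - DForm.oneChart A₀ x₀ z)) z)
          (DForm.oneChart A₁ x₀ z - DForm.oneChart A₀ x₀ z)) (p + 1))
          (cylArgs (i.removeNth X))) y := fun j => by
      refine differentiableAt_altSum_pairTrace _ (fun X Y => ?_) _ _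
      have k₀ := h₀.contDiffOn_oneChart x₀
      have k₁ := h₁.contDiffOn_oneChart x₀
      have h : ∀ Z, DifferentiableAt ℝ
          (fun y => (⇑(DForm.oneChart A₁ x₀ y) - ⇑(DForm.oneChart A₀ x₀ y)) Z) y := fun Z =>
        ((c₁.clm_apply contDiffAt_const).sub (c₀.clm_apply contDiffAt_const)).differentiableAt
          (by simp)
      have h' := ((contDiffOn_connCurv (chart_target_inter_preimage_isOpen x₀ hU)
        (k₀.add ((k₁.sub k₀).const_smul (j : ℝ))) X.1 Y.1).contDiffAt hs).differentiableAt (by simp)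
      unfold cylCurv
      exact h'.add (((h _).const_smul _).sub ((h _).const_smul _))
    have hsum := HasFDerivAt.fun_const_smul (HasFDerivAt.fun_sum (u := Finset.univ) fun j _ =>
      (hdj j).hasFDerivAt.fun_const_smul (c j)) (chernConst (p + 1))
    rw [← hsum.fderiv]
    refine Filter.EventuallyEq.fderiv_eq ?_
    filter_upwards [hs] with z hz
    rw [DForm.inChart_apply, hβ _ hz.2, transgression_chartDSymm hU h₀ h₁ hz.1 hz.2]
    rfl
  simp only [hf, smul_apply, sum_apply]
  simp only [zsmul_eq_mul, smul_eq_mul, Complex.real_smul, Finset.mul_sum]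
  rw [Finset.sum_comm]
  exact Finset.sum_congr rfl fun j _ => Finset.sum_congr rfl fun i _ => by ring

end LocalChern

/-! ### Action of matrices on frames and the gerbe product -/

section FrameMul

variable {r : ℕ} {T : Type*} [AddCommGroup T] [Module ℝ T]

theorem frameMul_one (e : Fin r → T) : frameMul e 1 = e := by
  funext j
  simp [frameMul, Matrix.one_apply]

theorem frameMul_mul (e : Fin r → T) (a b : Matrix (Fin r) (Fin r) ℝ) :
    frameMul e (a * b) = frameMul (frameMul e a) b := by
  funext j
  simp only [frameMul, Matrix.mul_apply, Finset.sum_smul, Finset.smul_sum, smul_smul]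
  rw [Finset.sum_comm]
  refine Finset.sum_congr rfl fun i _ => Finset.sum_congr rfl fun l _ => by rw [mul_comm]

variable {k : ℕ} {G : Subgroup (Matrix.GeneralLinearGroup (Fin r) ℝ)}
  {Ĝ : Type*} [Group Ĝ] [TopologicalSpace Ĝ]

theorem CentralExtension.mat_mul (E : CentralExtension k G Ĝ) (a b : Ĝ) :
    E.mat (a * b) = E.mat a * E.mat b := by
  simp [CentralExtension.mat]

theorem CentralExtension.mat_one (E : CentralExtension k G Ĝ) : E.mat 1 = 1 := by
  simp [CentralExtension.mat]

theorem CentralExtension.mul_mem_Psi (E : CentralExtension k G Ĝ) {e₁ e₂ e₃ : Fin r → T} {a b : Ĝ}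
    (ha : a ∈ E.Psi e₁ e₂) (hb : b ∈ E.Psi e₂ e₃) : a * b ∈ E.Psi e₁ e₃ := by
  change e₃ = _
  rw [E.mat_mul, frameMul_mul, ← show e₂ = _ from ha]
  exact hb

theorem CentralExtension.inv_mem_Psi (E : CentralExtension k G Ĝ) {e₁ e₂ : Fin r → T} {a : Ĝ}
    (ha : a ∈ E.Psi e₁ e₂) : a⁻¹ ∈ E.Psi e₂ e₁ := by
  change e₁ = _
  rw [show e₂ = _ from ha, ← frameMul_mul, ← E.mat_mul, mul_inv_cancel, E.mat_one, frameMul_one]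

end FrameMul

theorem weightScalar_one (k : ℕ) [NeZero k] (q : ℤ) : weightScalar k q 1 = 1 := by
  simp [weightScalar]

/-- The curvature and the difference of connections are conjugated by the same Φ, hence so is the
curvature on the cylinder. This is why transgression forms descend to V. -/
theorem mul_cylCurv_of_conj {𝔸 T : Type*} [NormedRing 𝔸] [NormedAlgebra ℝ 𝔸] {Φ : 𝔸}
    {R₁ R₂ : T → T → 𝔸} {a₁ a₂ : T → 𝔸} (hR : ∀ X Y, Φ * R₂ X Y = R₁ X Y * Φ)
    (ha : ∀ X, Φ * a₂ X = a₁ X * Φ) (X Y : T × ℝ) :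
    Φ * cylCurv R₂ a₂ X Y = cylCurv R₁ a₁ X Y * Φ := by
  simp only [cylCurv, mul_add, mul_sub, add_mul, sub_mul, mul_smul_comm, smul_mul_assoc, hR, ha]

/-! ### Module connections and their global Chern forms -/

section Modules

variable {d r : ℕ} {V : Type u} [TopologicalSpace V] [ChartedSpace (EuclideanSpace ℝ (Fin d)) V]
  [IsManifold (𝓡 d) ∞ V]
  {k : ℕ} {G : Subgroup (Matrix.GeneralLinearGroup (Fin r) ℝ)}
  {Ĝ : Type*} [Group Ĝ] [TopologicalSpace Ĝ] [NeZero k]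
  {B : FrameFamily r d V} {E : CentralExtension k G Ĝ} {q : ℤ}
  {v : Type*} [NormedAddCommGroup v] [NormedSpace ℂ v] {W : PsiModule.{u, w} B E q v}

/-- The cocycle condition for the indices i, j, i, combined with the weight condition at the neutral
element of ℤ_k. -/
theorem PsiModule.φ_mul_φ_inv {i j : W.ι} {x : V} (hi : x ∈ W.U i) (hj : x ∈ W.U j) {ψ : Ĝ}
    (hψ : ψ ∈ E.Psi (W.s i x) (W.s j x)) : W.φ i j x ψ * W.φ j i x ψ⁻¹ = 1 := by
  rw [← W.cocycle i j i x ⟨⟨hi, hj⟩, hi⟩ ψ hψ _ (E.inv_mem_Psi hψ), mul_inv_cancel,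
    ← map_one E.inc, W.weight i x hi, weightScalar_one, one_smul]

theorem PsiModule.φ_inv_mul_φ {i j : W.ι} {x : V} (hi : x ∈ W.U i) (hj : x ∈ W.U j) {ψ : Ĝ}
    (hψ : ψ ∈ E.Psi (W.s i x) (W.s j x)) : W.φ j i x ψ⁻¹ * W.φ i j x ψ = 1 := by
  have := W.φ_mul_φ_inv hj hi (E.inv_mem_Psi hψ)
  rwa [inv_inv] at this

/-- An element of Ψ extends to a local section, as Ψ is locally trivial. Read in a chart, the
equivariance of the connection along this section is the gauge relation of `mul_connCurv_of_gauge`.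
-/
theorem PsiModule.IsConnection.curvDescends {A : W.ι → DForm d V 1 (v →L[ℂ] v)}
    (hA : W.IsConnection A) (hB : IsBundleGerbe B E) : W.CurvDescends A := by
  intro i j x hx ψ₀ hψ₀ X Y
  obtain ⟨O, ψ, hxO, hO, hψ, hψx⟩ := hB.locallyTrivial _ _ _ _ (W.isLocalSection i)
    (W.isLocalSection j) x hx ψ₀ hψ₀
  obtain ⟨x₀, y, hy, rfl⟩ := exists_chart_point (d := d) x
  have hOy := (chart_target_inter_preimage_isOpen x₀ hψ.isOpen).mem_nhds ⟨hy, hxO⟩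
  have hsm := W.smooth i j O ψ hO hψ
  have hΦ := contDiffOn_comp_chart_symm le_rfl hsm x₀
  have two_le : (2 : ℕ∞ω) ≤ ∞ := WithTop.coe_le_coe.2 (le_top (a := (2 : ℕ∞)))
  have key := mul_connCurv_of_gauge (A₁ := DForm.oneChart (A i) x₀) (A₂ := DForm.oneChart (A j) x₀)
    (((hA.smooth i).contDiffAt_oneChart (W.isLocalSection i).isOpen hy hx.1).differentiableAt
      (by simp))
    (((hA.smooth j).contDiffAt_oneChart (W.isLocalSection j).isOpen hy hx.2).differentiableAt
      (by simp)) ((hΦ.contDiffAt hOy).of_le two_le) (by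
      filter_upwards [hOy] with z hz Z
      have hd := fderiv_comp_chart_symm hz.1
        ((hsm.contMDiffAt (hψ.isOpen.mem_nhds hz.2)).mdifferentiableAt (by simp)) Z
      rw [hd, DForm.oneChart_apply, DForm.oneChart_apply]
      exact hA.equivariant i j O ψ hO hψ _ hz.2 _) (chartD x₀ _ X) (chartD x₀ _ Y)
  rw [← formCurv_chartDSymm (W.isLocalSection i).isOpen (hA.smooth i) hy hx.1,
    ← formCurv_chartDSymm (W.isLocalSection j).isOpen (hA.smooth j) hy hx.2,
    chartDSymm_chartD hy, chartDSymm_chartD hy] at key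
  rw [← hψx]
  exact key

/-- Module connections form an affine space: the inhomogeneous term of the equivariance enters with
total weight (1 - t) + t = 1. -/
theorem PsiModule.IsConnection.line {A₀ A₁ : W.ι → DForm d V 1 (v →L[ℂ] v)}
    (h₀ : W.IsConnection A₀) (h₁ : W.IsConnection A₁) (t : ℝ) :
    W.IsConnection fun i => DForm.line (A₀ i) (A₁ i) t where
  smooth i := (h₀.smooth i).line (h₁.smooth i) t
  equivariant i j O ψ hO hψ x hx X := by
    have e₀ := h₀.equivariant i j O ψ hO hψ x hx X
    have e₁ := h₁.equivariant i j O ψ hO hψ x hx X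
    simp only [DForm.line_apply, mul_add, add_mul, mul_smul_comm, smul_mul_assoc, mul_sub, sub_mul,
      e₀, e₁]
    module

/-- The inhomogeneous term cancels in the difference of two connections, which therefore changes by
conjugation. -/
theorem PsiModule.IsConnection.mul_sub {A₀ A₁ : W.ι → DForm d V 1 (v →L[ℂ] v)}
    (hB : IsBundleGerbe B E) (h₀ : W.IsConnection A₀) (h₁ : W.IsConnection A₁) {i j : W.ι} {x : V}
    (hx : x ∈ W.U i ∩ W.U j) {ψ₀ : Ĝ} (hψ₀ : ψ₀ ∈ E.Psi (W.s i x) (W.s j x))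
    (X : TangentSpace (𝓡 d) x) :
    W.φ i j x ψ₀ * (A₁ j x ![X] - A₀ j x ![X]) = (A₁ i x ![X] - A₀ i x ![X]) * W.φ i j x ψ₀ := by
  obtain ⟨O, ψ, hxO, hO, hψ, hψx⟩ := hB.locallyTrivial _ _ _ _ (W.isLocalSection i)
    (W.isLocalSection j) x hx ψ₀ hψ₀
  have e₀ := h₀.equivariant i j O ψ hO hψ x hxO X
  have e₁ := h₁.equivariant i j O ψ hO hψ x hxO X
  rw [hψx] at e₀ e₁
  rw [_root_.mul_sub, e₀, e₁, sub_mul]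
  abel

variable [FiniteDimensional ℂ v]

theorem PsiModule.chernPart_eq_of_connection {A : W.ι → DForm d V 1 (v →L[ℂ] v)}
    (hB : IsBundleGerbe B E) (hA : W.IsConnection A) {i j : W.ι} {x : V} (hi : x ∈ W.U i)
    (hj : x ∈ W.U j) (p : ℕ) (X : Fin (2 * p) → TangentSpace (𝓡 d) x) :
    chernPart (formCurv (A i) x) p X = chernPart (formCurv (A j) x) p X := by
  obtain ⟨ψ, hψ⟩ := hB.nonempty x _ ((W.isLocalSection i).mem x hi) _ ((W.isLocalSection j).mem x hj)
  rw [chernPart_eq, chernPart_eq]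
  congr 1
  unfold altSum
  refine Finset.sum_congr rfl fun σ _ => ?_
  rw [pairTrace_eq_of_conj traceCLM_mul_comm (W.φ_inv_mul_φ hi hj hψ) (W.φ_mul_φ_inv hi hj hψ)
    (hA.curvDescends hB i j x ⟨hi, hj⟩ ψ hψ)]

theorem PsiModule.transgression_eq {A₀ A₁ : W.ι → DForm d V 1 (v →L[ℂ] v)}
    (hB : IsBundleGerbe B E) (h₀ : W.IsConnection A₀) (h₁ : W.IsConnection A₁) {N : ℕ}
    (c : Fin N → ℝ) {i j : W.ι} {x : V} (hi : x ∈ W.U i) (hj : x ∈ W.U j) (p : ℕ)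
    (X : Fin (2 * p + 1) → TangentSpace (𝓡 d) x) :
    transgression (A₀ i) (A₁ i) c p x X = transgression (A₀ j) (A₁ j) c p x X := by
  obtain ⟨ψ, hψ⟩ := hB.nonempty x _ ((W.isLocalSection i).mem x hi) _ ((W.isLocalSection j).mem x hj)
  refine congrArg (chernConst (p + 1) * ·) (Finset.sum_congr rfl fun l _ =>
    congrArg (c l • ·) (Finset.sum_congr rfl fun σ _ => ?_))
  exact (congrArg _ (pairTrace_eq_of_conj traceCLM_mul_comm (W.φ_inv_mul_φ hi hj hψ)
    (W.φ_mul_φ_inv hi hj hψ) (mul_cylCurv_of_conj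
      ((h₀.line h₁ (l : ℝ)).curvDescends hB i j x ⟨hi, hj⟩ ψ hψ)
      (h₀.mul_sub hB h₁ ⟨hi, hj⟩ hψ)) (p + 1) (cylArgs X ∘ σ))).symm

/-- The Chern forms of a module connection. -/
theorem PsiModule.IsConnection.exists_chern {A : W.ι → DForm d V 1 (v →L[ℂ] v)}
    (hB : IsBundleGerbe B E) (hA : W.IsConnection A) (p : ℕ) :
    ∃ α : DForm d V (2 * p) ℂ, DForm.SmoothOn α Set.univ ∧ DForm.extD α = 0 ∧
      ∀ i, ∀ x ∈ W.U i, ∀ X, α x X = chernPart (formCurv (A i) x) p X := by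
  obtain ⟨α, hα, hαi⟩ := DForm.exists_glued (fun i => (W.isLocalSection i).isOpen) W.cover
    (f := fun i x X => chernPart (formCurv (A i) x) p X)
    (fun i x _ => exists_alternating_chernPart (A i) p x)
    (fun i j x hi hj => W.chernPart_eq_of_connection hB hA hi hj p)
    (fun i x₀ => contDiffOn_chernPart_chart (W.isLocalSection i).isOpen (hA.smooth i) x₀ p)
  refine ⟨α, hα, ?_, hαi⟩
  funext x
  obtain ⟨x₀, y, hy, rfl⟩ := exists_chart_point (d := d) x
  obtain ⟨i, hi⟩ := W.cover ((extChartAt (𝓡 d) x₀).symm y)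
  refine DForm.eq_of_inChart_eq hy fun X => ?_
  exact sum_fderiv_chernPart_chart (W.isLocalSection i).isOpen (hA.smooth i) hy hi p (hαi i) hα X

/-- The transgression form between two module connections. -/
theorem PsiModule.IsConnection.exists_transgression {A₀ A₁ : W.ι → DForm d V 1 (v →L[ℂ] v)}
    (hB : IsBundleGerbe B E) (h₀ : W.IsConnection A₀) (h₁ : W.IsConnection A₁) (p : ℕ) :
    ∃ β : DForm d V (2 * p + 1) ℂ, DForm.SmoothOn β Set.univ ∧
      ∀ i, ∀ x ∈ W.U i, ∀ X : Fin (2 * (p + 1)) → TangentSpace (𝓡 d) x, DForm.extD β x X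
        = chernPart (formCurv (A₁ i) x) (p + 1) X - chernPart (formCurv (A₀ i) x) (p + 1) X := by
  obtain ⟨c, hc⟩ := exists_quadrature (2 * (p + 1))
  obtain ⟨β, hβ, hβi⟩ := DForm.exists_glued (fun i => (W.isLocalSection i).isOpen) W.cover
    (f := fun i x X => transgression (A₀ i) (A₁ i) c p x X)
    (fun i x _ => exists_alternating_transgression (A₀ i) (A₁ i) c p x)
    (fun i j x hi hj => W.transgression_eq hB h₀ h₁ c hi hj p)
    (fun i x₀ => contDiffOn_transgression_chart (W.isLocalSection i).isOpen (h₀.smooth i)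
      (h₁.smooth i) c x₀ p)
  refine ⟨β, hβ, fun i x hi X => ?_⟩
  obtain ⟨x₀, y, hy, rfl⟩ := exists_chart_point (d := d) x
  have := extD_transgression_chart (W.isLocalSection i).isOpen (h₀.smooth i) (h₁.smooth i) hy hi p
    hc (hβi i) hβ fun l => chartD x₀ _ (X l)
  simp only [DForm.inChart_apply, chartDSymm_chartD hy] at this
  exact this

end Modules

/-! ### The Chern character of a couple -/

section Couples

variable {d : ℕ} {dim : HV → ℕ} {V : Type u} [TopologicalSpace V]
  [ChartedSpace (EuclideanSpace ℝ (Fin d)) V] [IsManifold (𝓡 d) ∞ V]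
  {k : ℕ} [NeZero k] {B : ∀ c, FrameFamily (dim c) d V}
  {G : ∀ c : HV, Subgroup (Matrix.GeneralLinearGroup (Fin (dim c)) ℝ)}
  {Ĝ : HV → Type*} [∀ c, Group (Ĝ c)] [∀ c, TopologicalSpace (Ĝ c)]
  {E : ∀ c, CentralExtension k (G c) (Ĝ c)} {q : ℤ}
  {v : HV → Type*} [∀ c, NormedAddCommGroup (v c)] [∀ c, NormedSpace ℂ (v c)]
  {W : ∀ c, PsiModule.{u, w} (B c) (E c) q (v c)}

theorem PsiModule.exists_index_couple (W : ∀ c, PsiModule.{u, w} (B c) (E c) q (v c)) (x : V) :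
    ∃ i : ∀ c, (W c).ι, ∀ c, x ∈ (W c).U (i c) :=
  ⟨fun c => ((W c).cover x).choose, fun c => ((W c).cover x).choose_spec⟩

theorem IsChernCharacter.unique {A : ∀ c, (W c).ι → DForm d V 1 (v c →L[ℂ] v c)}
    {ch ch' : ∀ p : ℕ, DForm d V (2 * p) ℂ} (h : IsChernCharacter W A ch)
    (h' : IsChernCharacter W A ch') : ch = ch' := by
  funext p x
  obtain ⟨i, hi⟩ := PsiModule.exists_index_couple W x
  ext X
  rw [h.eq p i x hi, h'.eq p i x hi]

variable [∀ c, FiniteDimensional ℂ (v c)]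

theorem exists_isChernCharacter {A : ∀ c, (W c).ι → DForm d V 1 (v c →L[ℂ] v c)}
    (hB : ∀ c, IsBundleGerbe (B c) (E c)) (hA : ∀ c, (W c).IsConnection (A c)) :
    ∃ ch, IsChernCharacter W A ch ∧ ∀ p, DForm.extD (ch p) = 0 := by
  choose α hα hd he using fun c => (hA c).exists_chern (hB c)
  refine ⟨fun p => α .h p + α .v p, ⟨fun p => (hα .h p).add (hα .v p), fun p i x hx X => ?_⟩,
    fun p => ?_⟩
  · rw [← he .h p _ x (hx .h), ← he .v p _ x (hx .v)]
    rfl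
  · rw [DForm.extD_add (hα .h p) (hα .v p), hd, hd, add_zero]

theorem IsChernCharacter.isExact_sub {A A' : ∀ c, (W c).ι → DForm d V 1 (v c →L[ℂ] v c)}
    (hB : ∀ c, IsBundleGerbe (B c) (E c)) (hA : ∀ c, (W c).IsConnection (A c))
    (hA' : ∀ c, (W c).IsConnection (A' c)) {ch ch' : ∀ p : ℕ, DForm d V (2 * p) ℂ}
    (h : IsChernCharacter W A ch) (h' : IsChernCharacter W A' ch') (p : ℕ) :
    DForm.IsExact (ch p - ch' p) := by
  -- In degree zero the character is the total complex rank, whatever the curvature. In positive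
  -- degree the transgression from `A'` to `A` is a primitive of the difference.
  cases p with
  | zero =>
    change ch 0 - ch' 0 = 0
    rw [sub_eq_zero]
    funext x
    obtain ⟨i, hi⟩ := PsiModule.exists_index_couple W x
    ext X
    rw [h.eq 0 i x hi, h'.eq 0 i x hi]
    simp [chernPart]
  | succ p =>
    choose β hβ hd using fun c => (hA' c).exists_transgression (hB c) (hA c) p
    refine ⟨β .h + β .v, (hβ .h).add (hβ .v), ?_⟩
    rw [DForm.extD_add (hβ .h) (hβ .v)]
    funext x
    obtain ⟨i, hi⟩ := PsiModule.exists_index_couple W x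
    refine ContinuousAlternatingMap.ext fun X => ?_
    change DForm.extD (β .h) x X + DForm.extD (β .v) x X = ch (p + 1) x X - ch' (p + 1) x X
    rw [h.eq (p + 1) i x hi, h'.eq (p + 1) i x hi, hd .h _ x (hi .h), hd .v _ x (hi .v)]
    ring

end Couples

/-! ### Global vector fields by cut-off -/

section Fields

variable {d : ℕ} {V : Type u} [TopologicalSpace V] [ChartedSpace (EuclideanSpace ℝ (Fin d)) V]
  [IsManifold (𝓡 d) ∞ V]

/-- A local vector field extends to a global one, after shrinking its domain, by multiplication with
a bump function. -/
theorem exists_smoothField_eventuallyEq [T2Space V] {U : Set V} (hU : IsOpen U)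
    {X : ∀ x : V, TangentSpace (𝓡 d) x} (hX : ContMDiffOn (𝓡 d) (𝓡 d).tangent ∞ (T% X) U) {x : V}
    (hx : x ∈ U) : ∃ f : V → ℝ, SmoothField (f • X) ∧ (f • X) =ᶠ[𝓝 x] X ∧ ∀ y ∉ U, f y = 0 := by
  obtain ⟨f, -, hf⟩ := (SmoothBumpFunction.nhds_basis_tsupport (I := 𝓡 d) x).mem_iff.1
    (hU.mem_nhds hx)
  refine ⟨f, ContMDiffOn.smul_section_of_tsupport f.contMDiff.contMDiffOn hU hf hX, ?_, ?_⟩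
  · filter_upwards [f.eventuallyEq_one] with y hy
    change f y • X y = X y
    rw [hy]; simp
  · intro y hy
    exact image_eq_zero_of_notMem_tsupport fun h => hy (hf h)

theorem exists_smoothField_apply [T2Space V] {x : V} (X₀ : TangentSpace (𝓡 d) x) :
    ∃ X, SmoothField (d := d) X ∧ X x = X₀ := by
  obtain ⟨s, hs, hX⟩ := FiberBundle.exists_contMDiffOn_extend (k := ∞) (𝓡 d)
    (EuclideanSpace ℝ (Fin d)) (V := (TangentSpace (𝓡 d) : V → Type)) X₀
  obtain ⟨U, hUs, hU, hx⟩ := mem_nhds_iff.1 hs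
  obtain ⟨f, hf, he, -⟩ := exists_smoothField_eventuallyEq hU (hX.mono hUs) hx
  exact ⟨_, hf, by rw [he.self_of_nhds]; simp⟩

theorem SmoothField.mdifferentiableAt {X : ∀ x : V, TangentSpace (𝓡 d) x} (hX : SmoothField X)
    (x : V) : MDifferentiableAt (𝓡 d) (𝓡 d).tangent (T% X) x :=
  hX.contMDiffAt.mdifferentiableAt (by simp)

/-- A field of endomorphisms of the tangent spaces is smooth if it is smooth on vector fields. -/
theorem contMDiff_hom_of_apply [T2Space V]
    {φ : ∀ x : V, TangentSpace (𝓡 d) x →L[ℝ] TangentSpace (𝓡 d) x}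
    (h : ∀ X, SmoothField (d := d) X → SmoothField fun x => φ x (X x)) :
    ContMDiff (𝓡 d) ((𝓡 d).prod
        𝓘(ℝ, EuclideanSpace ℝ (Fin d) →L[ℝ] EuclideanSpace ℝ (Fin d))) ∞
      (fun x => Bundle.TotalSpace.mk' (EuclideanSpace ℝ (Fin d) →L[ℝ] EuclideanSpace ℝ (Fin d))
        (E := fun x : V => TangentSpace (𝓡 d) x →L[ℝ] TangentSpace (𝓡 d) x) x (φ x)) := by
  intro x₀
  rw [contMDiffAt_hom_bundle]
  refine ⟨contMDiffAt_id, ?_⟩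
  let b := Module.finBasis ℝ (EuclideanSpace ℝ (Fin d))
  set t := trivializationAt (EuclideanSpace ℝ (Fin d)) (TangentSpace (𝓡 d) : V → Type) x₀ with ht
  have hb := t.open_baseSet.mem_nhds (FiberBundle.mem_baseSet_trivializationAt' x₀)
  -- φ is applied to a global field whose coordinates near `x₀` are constantly `u`. Letting `u` run
  -- through a basis, the linear map `L` below rebuilds φ in coordinates.
  have key : ∀ u : EuclideanSpace ℝ (Fin d), ContMDiffAt (𝓡 d) 𝓘(ℝ, EuclideanSpace ℝ (Fin d)) ∞
      (fun x => ContinuousLinearMap.inCoordinates (EuclideanSpace ℝ (Fin d))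
        (TangentSpace (𝓡 d) : V → Type) (EuclideanSpace ℝ (Fin d)) (TangentSpace (𝓡 d) : V → Type)
        x₀ x x₀ x (φ x) u) x₀ := fun u => by
    obtain ⟨s, hs, hsX⟩ := FiberBundle.exists_contMDiffOn_extend (k := ∞) (𝓡 d)
      (EuclideanSpace ℝ (Fin d)) (V := (TangentSpace (𝓡 d) : V → Type)) (t.symm x₀ u)
    obtain ⟨U, hUs, hU, hx⟩ := mem_nhds_iff.1 hs
    obtain ⟨f, hf, he, -⟩ := exists_smoothField_eventuallyEq hU (hsX.mono hUs) hx
    have hs := (Bundle.contMDiffAt_section (E := (TangentSpace (𝓡 d) : V → Type)) _).1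
      ((h _ hf).contMDiffAt (x := x₀))
    refine hs.congr_of_eventuallyEq ?_
    filter_upwards [he, hb] with x hx hxb
    have hu : (t ⟨x₀, t.symm x₀ u⟩).2 = u := by
      rw [t.apply_mk_symm (FiberBundle.mem_baseSet_trivializationAt' x₀)]
    rw [hx]
    change t.continuousLinearMapAt ℝ x (φ x (t.symmL ℝ x u))
      = (t ⟨x, φ x (t.symm x (t ⟨x₀, t.symm x₀ u⟩).2)⟩).2
    rw [t.continuousLinearMapAt_apply_of_mem ℝ hxb, t.symmL_apply hxb, hu]
  let L : (Fin (Module.finrank ℝ (EuclideanSpace ℝ (Fin d))) → EuclideanSpace ℝ (Fin d)) →L[ℝ]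
      (EuclideanSpace ℝ (Fin d) →L[ℝ] EuclideanSpace ℝ (Fin d)) :=
    LinearMap.toContinuousLinearMap
      (LinearMap.toContinuousLinearMap.toLinearMap ∘ₗ (b.constr ℝ).toLinearMap)
  have hL : ∀ f : EuclideanSpace ℝ (Fin d) →L[ℝ] EuclideanSpace ℝ (Fin d),
      f = L fun i => f (b i) := fun f => by
    ext1 u
    exact congrArg (fun g => g u) (b.ext fun i => by simp [L] :
      f.toLinearMap = (L fun i => f (b i)).toLinearMap)
  have := L.contMDiff.contMDiffAt.comp x₀ (contMDiffAt_pi_space.2 fun i => key (b i))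
  refine this.congr_of_eventuallyEq (Filter.Eventually.of_forall fun x => ?_)
  exact hL _

end Fields

/-! ### Horizontal and vertical projections -/

section Parts

variable {n m : ℕ} {V : Type u} [TopologicalSpace V]
  [ChartedSpace (EuclideanSpace ℝ (Fin (n + m))) V] [IsManifold (𝓡 (n + m)) ∞ V]

/-- The projection onto the horizontal or vertical part. -/
noncomputable def NConnection.toPart (N : NConnection n m V) :
    HV → ∀ x : V, TangentSpace (𝓡 (n + m)) x →L[ℝ] TangentSpace (𝓡 (n + m)) x
  | .h => fun x => ContinuousLinearMap.id ℝ _ - N.proj x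
  | .v => fun x => N.proj x

variable (N : NConnection n m V)

theorem NConnection.mem_part_h {x : V} {X : TangentSpace (𝓡 (n + m)) x} :
    X ∈ N.part .h x ↔ N.proj x X = 0 := Iff.rfl

theorem NConnection.toPart_mem (c : HV) (x : V) (X : TangentSpace (𝓡 (n + m)) x) :
    N.toPart c x X ∈ N.part c x := by
  cases c with
  | h =>
    rw [N.mem_part_h]
    change N.proj x (X - N.proj x X) = 0
    rw [map_sub, N.proj_vert x _ (N.proj_mem x X), sub_self]
  | v => exact N.proj_mem x X

theorem NConnection.toPart_of_mem {c : HV} {x : V} {X : TangentSpace (𝓡 (n + m)) x}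
    (hX : X ∈ N.part c x) : N.toPart c x X = X := by
  cases c with
  | h =>
    change X - N.proj x X = X
    rw [N.mem_part_h.1 hX, sub_zero]
  | v => exact N.proj_vert x X hX

theorem NConnection.toPart_add (x : V) (X : TangentSpace (𝓡 (n + m)) x) :
    N.toPart .h x X + N.toPart .v x X = X :=
  sub_add_cancel X (N.proj x X)

theorem NConnection.isCompl_part (x : V) : IsCompl (N.part .h x) (N.part .v x) := by
  refine IsCompl.of_le ?_ ?_
  · rintro X ⟨h, h'⟩
    rw [Submodule.mem_bot, ← N.toPart_of_mem (c := .v) h']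
    exact N.mem_part_h.1 h
  · intro X _
    rw [← N.toPart_add x X]
    exact Submodule.add_mem_sup (N.toPart_mem .h x X) (N.toPart_mem .v x X)

theorem NConnection.toPart_of_mem_ne {c c' : HV} (h : c ≠ c') {x : V}
    {X : TangentSpace (𝓡 (n + m)) x} (hX : X ∈ N.part c x) : N.toPart c' x X = 0 := by
  have := N.toPart_add x X
  cases c <;> cases c' <;> first | exact absurd rfl h | skip
  · rw [N.toPart_of_mem hX] at this; simpa using this
  · rw [N.toPart_of_mem hX] at this; simpa using this

theorem NConnection.contMDiffOn_toPart {U : Set V} (c : HV)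
    {X : ∀ x : V, TangentSpace (𝓡 (n + m)) x}
    (hX : ContMDiffOn (𝓡 (n + m)) (𝓡 (n + m)).tangent ∞ (T% X) U) :
    ContMDiffOn (𝓡 (n + m)) (𝓡 (n + m)).tangent ∞ (T% fun x => N.toPart c x (X x)) U := by
  have h : ContMDiffOn (𝓡 (n + m)) (𝓡 (n + m)).tangent ∞ (T% fun x => N.proj x (X x)) U :=
    N.smooth.contMDiffOn.clm_bundle_apply hX
  cases c with
  | h => exact hX.sub_section h
  | v => exact h

theorem NConnection.smoothField_toPart (c : HV) {X : ∀ x : V, TangentSpace (𝓡 (n + m)) x}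
    (hX : SmoothField X) : SmoothField fun x => N.toPart c x (X x) :=
  contMDiffOn_univ.1 (N.contMDiffOn_toPart c hX.contMDiffOn)

theorem NConnection.exists_smoothField_part [T2Space V] {c : HV} {x : V}
    {X₀ : TangentSpace (𝓡 (n + m)) x} (hX₀ : X₀ ∈ N.part c x) :
    ∃ X, SmoothField (d := n + m) X ∧ (∀ y, X y ∈ N.part c y) ∧ X x = X₀ := by
  obtain ⟨X, hX, h⟩ := exists_smoothField_apply X₀
  exact ⟨_, N.smoothField_toPart c hX, fun y => N.toPart_mem c y _, by
    rw [h, N.toPart_of_mem hX₀]⟩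

end Parts

/-! ### The d-metric and its orthonormal frames -/

section Metric

variable {n m : ℕ} {V : Type u} [TopologicalSpace V]
  [ChartedSpace (EuclideanSpace ℝ (Fin (n + m))) V] [IsManifold (𝓡 (n + m)) ∞ V]
  {N : NConnection n m V} (g : DMetric N)

theorem DMetric.contMDiffOn_inner {U : Set V} {X Y : ∀ x : V, TangentSpace (𝓡 (n + m)) x}
    (hX : ContMDiffOn (𝓡 (n + m)) (𝓡 (n + m)).tangent ∞ (T% X) U)
    (hY : ContMDiffOn (𝓡 (n + m)) (𝓡 (n + m)).tangent ∞ (T% Y) U) :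
    ContMDiffOn (𝓡 (n + m)) 𝓘(ℝ, ℝ) ∞ (fun x => g.inner x (X x) (Y x)) U := by
  have : ContMDiffOn (𝓡 (n + m)) ((𝓡 (n + m)).prod 𝓘(ℝ)) ∞
      (fun x => Bundle.TotalSpace.mk' ℝ (E := Bundle.Trivial V ℝ) x (g.inner x (X x) (Y x))) U :=
    ContMDiffOn.clm_bundle_apply₂ (F₁ := EuclideanSpace ℝ (Fin (n + m)))
      (F₂ := EuclideanSpace ℝ (Fin (n + m))) g.smooth.contMDiffOn hX hY
  intro x hx
  have := this x hx
  simp only [Bundle.contMDiffWithinAt_totalSpace] at this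
  exact this.2

end Metric

theorem units_sign_mul_self (s : ℤˣ) : ((s : ℤ) : ℝ) * ((s : ℤ) : ℝ) = 1 := by
  have := Int.units_coe_mul_self s
  exact_mod_cast this

/-- The orthonormality of a frame, as a product. -/
theorem mem_pseudoOrthogonal_iff {r : ℕ} {η : Fin r → ℤˣ} {a : Matrix.GeneralLinearGroup (Fin r) ℝ} :
    a ∈ pseudoOrthogonal η ↔ (a : Matrix (Fin r) (Fin r) ℝ).transpose
      * Matrix.diagonal (fun i => ((η i : ℤ) : ℝ)) * a
        = Matrix.diagonal (fun i => ((η i : ℤ) : ℝ)) := Iff.rfl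

/-- With `D` the diagonal matrix of signs, D² = 1, so the relation exhibits D aᵀ D as a left inverse
of `a`; for square matrices this is an inverse. -/
theorem exists_pseudoOrthogonal_of_eq {r : ℕ} {η : Fin r → ℤˣ} {a : Matrix (Fin r) (Fin r) ℝ}
    (h : a.transpose * Matrix.diagonal (fun i => ((η i : ℤ) : ℝ)) * a
        = Matrix.diagonal (fun i => ((η i : ℤ) : ℝ))) :
    ∃ b ∈ pseudoOrthogonal η, (b : Matrix (Fin r) (Fin r) ℝ) = a := by
  set D := Matrix.diagonal (fun i => ((η i : ℤ) : ℝ)) with hD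
  have hDD : D * D = 1 := by
    rw [hD, Matrix.diagonal_mul_diagonal]
    simp only [units_sign_mul_self, Matrix.diagonal_one]
  have h1 : D * a.transpose * D * a = 1 := by
    rw [Matrix.mul_assoc, Matrix.mul_assoc, ← Matrix.mul_assoc a.transpose, h, hDD]
  exact ⟨⟨a, D * a.transpose * D, mul_eq_one_comm.1 h1, h1⟩, h, rfl⟩

instance tangentSpace_finiteDimensional {d : ℕ} {V : Type u} [TopologicalSpace V]
    [ChartedSpace (EuclideanSpace ℝ (Fin d)) V] (x : V) :
    FiniteDimensional ℝ (TangentSpace (𝓡 d) x) :=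
  inferInstanceAs (FiniteDimensional ℝ (EuclideanSpace ℝ (Fin d)))

section Orthonormal

variable {n m : ℕ} {V : Type u} [TopologicalSpace V]
  [ChartedSpace (EuclideanSpace ℝ (Fin (n + m))) V] [IsManifold (𝓡 (n + m)) ∞ V]
  {N : NConnection n m V} (g : DMetric N)

/-- The bundle of orthonormal frames of the part `c`. -/
abbrev DMetric.frames (c : HV) : FrameFamily (c.dim n m) (n + m) V :=
  orthonormalFrames (N.part c) g.inner (g.sign c)

variable {g}
variable {c : HV} {x : V} {e e' : Fin (c.dim n m) → TangentSpace (𝓡 (n + m)) x}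

theorem DMetric.inner_sum_left (he : e ∈ g.frames c x) (a : Fin (c.dim n m) → ℝ)
    (j : Fin (c.dim n m)) : g.inner x (e j) (∑ i, a i • e i) = g.sign c j * a j := by
  simp [he.2, mul_comm]

/-- Pairing with `e i` recovers the coefficient of index `i` up to a sign, also for an indefinite
form. -/
theorem DMetric.linearIndependent (he : e ∈ g.frames c x) : LinearIndependent ℝ e := by
  rw [Fintype.linearIndependent_iff]
  intro a ha i
  have h := DMetric.inner_sum_left he a i
  rw [ha, map_zero] at h
  have := congrArg (fun t => ((g.sign c i : ℤ) : ℝ) * t) h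
  simpa [← mul_assoc, units_sign_mul_self] using this.symm

/-- The orthonormal bases of `signature` are independent, which bounds the two ranks below by n and
m; as the ranks add up to n + m, both bounds are attained. -/
theorem DMetric.finrank_part (g : DMetric N) (c : HV) (x : V) : Module.finrank ℝ (N.part c x) = c.dim n m := by
  have h1 : ∀ c : HV, c.dim n m ≤ Module.finrank ℝ (N.part c x) := fun c => by
    obtain ⟨e, he⟩ := g.signature c x
    have hli : LinearIndependent ℝ (fun i => (⟨e i, he.1 i⟩ : N.part c x)) :=
      LinearIndependent.of_comp (N.part c x).subtype (DMetric.linearIndependent (g := g) he)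
    simpa using hli.fintype_card_le_finrank
  have h2 : Module.finrank ℝ (N.part .h x) + Module.finrank ℝ (N.part .v x) = n + m := by
    rw [Submodule.finrank_add_eq_of_isCompl (N.isCompl_part x)]
    exact finrank_euclideanSpace_fin
  have h3 := h1 .h
  have h4 := h1 .v
  simp only [HV.dim] at h3 h4
  cases c <;> simp only [HV.dim] <;> omega

theorem DMetric.span_eq_part (he : e ∈ g.frames c x) :
    Submodule.span ℝ (Set.range e) = N.part c x := by
  apply Submodule.eq_of_le_of_finrank_eq
  · rw [Submodule.span_le]
    rintro _ ⟨i, rfl⟩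
    exact he.1 i
  · rw [finrank_span_eq_card (DMetric.linearIndependent he), g.finrank_part, Fintype.card_fin]

/-- The expansion of a vector in an orthonormal frame. -/
theorem DMetric.eq_sum (he : e ∈ g.frames c x) {X : TangentSpace (𝓡 (n + m)) x}
    (hX : X ∈ N.part c x) : X = ∑ i, (g.sign c i * g.inner x (e i) X) • e i := by
  rw [← DMetric.span_eq_part he, Submodule.mem_span_range_iff_exists_fun] at hX
  obtain ⟨a, rfl⟩ := hX
  refine Finset.sum_congr rfl fun i _ => ?_
  rw [DMetric.inner_sum_left he, ← mul_assoc, units_sign_mul_self, one_mul]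

variable (g) in
theorem DMetric.eq_zero_of_inner {X : TangentSpace (𝓡 (n + m)) x} (hX : X ∈ N.part c x)
    (h : ∀ Z ∈ N.part c x, g.inner x X Z = 0) : X = 0 := by
  obtain ⟨e, he⟩ := g.signature c x
  rw [DMetric.eq_sum (g := g) he hX]
  refine Finset.sum_eq_zero fun i _ => ?_
  rw [g.symm, h _ (he.1 i), mul_zero, zero_smul]

variable (g) in
theorem DMetric.inner_of_ne {c c' : HV} (hc : c ≠ c') {X Y : TangentSpace (𝓡 (n + m)) x}
    (hX : X ∈ N.part c x) (hY : Y ∈ N.part c' x) : g.inner x X Y = 0 := by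
  cases c <;> cases c' <;> first | exact absurd rfl hc | skip
  · exact g.adapted x X hX Y hY
  · rw [g.symm]; exact g.adapted x Y hY X hX

variable (g) in
theorem DMetric.inner_toPart_right {X : TangentSpace (𝓡 (n + m)) x} (hX : X ∈ N.part c x)
    (Y : TangentSpace (𝓡 (n + m)) x) : g.inner x X (N.toPart c x Y) = g.inner x X Y := by
  conv_rhs => rw [← N.toPart_add x Y, map_add]
  cases c with
  | h => rw [g.inner_of_ne (c' := .v) (by simp) hX (N.toPart_mem _ _ _), add_zero]
  | v => rw [g.inner_of_ne (c' := .h) (by simp) hX (N.toPart_mem _ _ _), zero_add]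

theorem DMetric.inner_frameMul (he : e ∈ g.frames c x)
    (a : Matrix (Fin (c.dim n m)) (Fin (c.dim n m)) ℝ) (j l : Fin (c.dim n m)) :
    g.inner x (frameMul e a j) (frameMul e a l)
      = (a.transpose * Matrix.diagonal (fun i => ((g.sign c i : ℤ) : ℝ)) * a) j l := by
  simp only [frameMul, map_sum, map_smul, FunLike.coe_sum, Finset.sum_apply, FunLike.coe_smul,
    Pi.smul_apply, he.2, smul_eq_mul, Matrix.mul_apply, Matrix.transpose_apply,
    Matrix.diagonal_apply, mul_ite, mul_zero, Finset.mem_univ, if_true,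
    Finset.sum_ite_eq']
  exact Finset.sum_congr rfl fun i _ => by ring

theorem DMetric.frameMul_mem_part (he : e ∈ g.frames c x)
    (a : Matrix (Fin (c.dim n m)) (Fin (c.dim n m)) ℝ) (j : Fin (c.dim n m)) :
    frameMul e a j ∈ N.part c x :=
  Submodule.sum_mem _ fun i _ => Submodule.smul_mem _ _ (he.1 i)

theorem DMetric.frameMul_mem_frames_iff (he : e ∈ g.frames c x)
    (a : Matrix (Fin (c.dim n m)) (Fin (c.dim n m)) ℝ) :
    frameMul e a ∈ g.frames c x ↔
      a.transpose * Matrix.diagonal (fun i => ((g.sign c i : ℤ) : ℝ)) * a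
        = Matrix.diagonal (fun i => ((g.sign c i : ℤ) : ℝ)) := by
  refine ⟨fun h => ?_, fun h => ⟨DMetric.frameMul_mem_part he a, fun i j => ?_⟩⟩
  · ext i j
    rw [← DMetric.inner_frameMul he, h.2, Matrix.diagonal_apply]
  · rw [DMetric.inner_frameMul he, h, Matrix.diagonal_apply]

variable (g e e') in
/-- The transition matrix between two frames of which the first is orthonormal. -/
noncomputable def DMetric.transition : Matrix (Fin (c.dim n m)) (Fin (c.dim n m)) ℝ :=
  fun i j => g.sign c i * g.inner x (e i) (e' j)

theorem DMetric.frameMul_transition (he : e ∈ g.frames c x) (he' : ∀ i, e' i ∈ N.part c x) :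
    e' = frameMul e (g.transition e e') := by
  funext j
  exact DMetric.eq_sum he (he' j)

/-- This gives the freeness of the action on frames, and reads off matrices from identities between
frames. -/
theorem DMetric.transition_frameMul (he : e ∈ g.frames c x)
    (a : Matrix (Fin (c.dim n m)) (Fin (c.dim n m)) ℝ) : g.transition e (frameMul e a) = a := by
  ext i j
  unfold DMetric.transition frameMul
  rw [DMetric.inner_sum_left he, ← mul_assoc, units_sign_mul_self, one_mul]

end Orthonormal

/-! ### Gram–Schmidt in any signature, and the frame bundles -/

section GramSchmidt

variable {n m : ℕ} {V : Type u} [TopologicalSpace V]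
  [ChartedSpace (EuclideanSpace ℝ (Fin (n + m))) V] [IsManifold (𝓡 (n + m)) ∞ V]
  {N : NConnection n m V} (g : DMetric N)

/-- In indefinite signature the procedure could meet null vectors. Here the frame is already
orthonormal at `x₀`; each step leaves it unchanged there, so that the normalizing factors are
positive near `x₀`. The induction enlarges the set `s` of vectors that are orthonormal on a whole
neighbourhood. -/
theorem DMetric.exists_gramSchmidt (c : HV) {x₀ : V} (s : Finset (Fin (c.dim n m)))
    {e : ∀ x : V, Fin (c.dim n m) → TangentSpace (𝓡 (n + m)) x} {U : Set V} (hU : IsOpen U)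
    (hx₀ : x₀ ∈ U) (hsm : ∀ i, ContMDiffOn (𝓡 (n + m)) (𝓡 (n + m)).tangent ∞ (T% fun x => e x i) U)
    (hmem : ∀ x ∈ U, ∀ i, e x i ∈ N.part c x) (he₀ : e x₀ ∈ g.frames c x₀) :
    ∃ (U' : Set V) (e' : ∀ x : V, Fin (c.dim n m) → TangentSpace (𝓡 (n + m)) x),
      IsOpen U' ∧ x₀ ∈ U' ∧
      (∀ i, ContMDiffOn (𝓡 (n + m)) (𝓡 (n + m)).tangent ∞ (T% fun x => e' x i) U') ∧
      (∀ x ∈ U', ∀ i, e' x i ∈ N.part c x) ∧ e' x₀ ∈ g.frames c x₀ ∧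
      ∀ x ∈ U', ∀ i ∈ s, ∀ j ∈ s, g.inner x (e' x i) (e' x j)
        = if i = j then ((g.sign c i : ℤ) : ℝ) else 0 := by
  induction s using Finset.induction_on with
  | empty => exact ⟨U, e, hU, hx₀, hsm, hmem, he₀, by simp⟩
  | insert a s ha ih =>
    obtain ⟨U', e, hU', hx₀, hsm, hmem, he₀, hort⟩ := ih
    let f : ∀ x : V, TangentSpace (𝓡 (n + m)) x := fun x =>
      e x a - ∑ i ∈ s, (g.sign c i * g.inner x (e x i) (e x a)) • e x i
    have hf : ContMDiffOn (𝓡 (n + m)) (𝓡 (n + m)).tangent ∞ (T% f) U' := by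
      refine (hsm a).sub_section (ContMDiffOn.sum_section fun i _ => ?_)
      exact ContMDiffOn.smul_section (f := fun x => g.sign c i * g.inner x (e x i) (e x a))
        (contMDiffOn_const.mul (g.contMDiffOn_inner (hsm i) (hsm a))) (hsm i)
    have hfmem : ∀ x ∈ U', f x ∈ N.part c x := fun x hx =>
      Submodule.sub_mem _ (hmem x hx a) (Submodule.sum_mem _ fun i _ =>
        Submodule.smul_mem _ _ (hmem x hx i))
    have hfx₀ : f x₀ = e x₀ a := by
      refine sub_eq_self.2 (Finset.sum_eq_zero fun i hi => ?_)
      rw [he₀.2, if_neg (by rintro rfl; exact ha hi), mul_zero, zero_smul]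
    have hfort : ∀ x ∈ U', ∀ i ∈ s, g.inner x (e x i) (f x) = 0 := fun x hx i hi => by
      simp only [f, map_sub, map_sum, map_smul, smul_eq_mul]
      rw [Finset.sum_eq_single i, hort x hx i hi i hi, if_pos rfl]
      · rw [mul_right_comm, units_sign_mul_self, one_mul, sub_self]
      · intro j hj hji
        rw [hort x hx i hi j hj, if_neg hji.symm, mul_zero]
      · exact fun h => absurd hi h
    -- Because of the sign factor, `q` equals 1 at `x₀` even in a negative direction. It is positive
    -- on the smaller neighbourhood `U''`, where its square root is smooth.
    let q : V → ℝ := fun x => g.sign c a * g.inner x (f x) (f x)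
    have hq : ContMDiffOn (𝓡 (n + m)) 𝓘(ℝ, ℝ) ∞ q U' :=
      contMDiffOn_const.mul (g.contMDiffOn_inner hf hf)
    let U'' := U' ∩ q ⁻¹' Set.Ioi 0
    have hU'' : IsOpen U'' := hq.continuousOn.isOpen_inter_preimage hU' isOpen_Ioi
    have hqx₀ : q x₀ = 1 := by
      simp only [q, hfx₀]
      rw [he₀.2, if_pos rfl, units_sign_mul_self]
    have hnorm : ContMDiffOn (𝓡 (n + m)) 𝓘(ℝ, ℝ) ∞ (fun x => (Real.sqrt (q x))⁻¹) U'' := by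
      intro x hx
      have h1 : ContDiffAt ℝ ∞ (fun t : ℝ => (Real.sqrt t)⁻¹) (q x) :=
        (Real.contDiffAt_sqrt hx.2.ne').inv (Real.sqrt_pos.2 hx.2).ne'
      exact h1.contMDiffAt.comp_contMDiffWithinAt x ((hq x hx.1).mono Set.inter_subset_left)
    refine ⟨U'', fun x => Function.update (e x) a ((Real.sqrt (q x))⁻¹ • f x), hU'',
      ⟨hx₀, by change 0 < q x₀; rw [hqx₀]; exact one_pos⟩, fun i => ?_, fun x hx i => ?_, ?_,
      fun x hx i hi j hj => ?_⟩
    · by_cases hi : i = a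
      · subst hi
        simp only [Function.update_self]
        exact hnorm.smul_section (hf.mono Set.inter_subset_left)
      · simp only [Function.update_of_ne hi]
        exact (hsm i).mono Set.inter_subset_left
    · by_cases hi : i = a
      · subst hi
        simp only [Function.update_self]
        exact Submodule.smul_mem _ _ (hfmem x hx.1)
      · simp only [Function.update_of_ne hi]
        exact hmem x hx.1 i
    · change Function.update (e x₀) a ((Real.sqrt (q x₀))⁻¹ • f x₀) ∈ _
      rw [hqx₀, hfx₀, Real.sqrt_one, inv_one, one_smul, Function.update_eq_self]
      exact he₀
    · have hs : ∀ i ∈ s, i ≠ a := fun i hi h => ha (h ▸ hi)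
      have hpos : 0 < q x := hx.2
      rw [Finset.mem_insert] at hi hj
      rcases hi with rfl | hi <;> rcases hj with rfl | hj
      · simp only [Function.update_self, map_smul, FunLike.coe_smul, Pi.smul_apply, smul_eq_mul,
          if_true]
        have h1 : g.inner x (f x) (f x) = g.sign c j * q x := by
          simp only [q]; rw [← mul_assoc, units_sign_mul_self, one_mul]
        rw [h1]
        have h2 := Real.mul_self_sqrt hpos.le
        rw [← mul_assoc, ← mul_inv, h2, mul_left_comm, inv_mul_cancel₀ hpos.ne', mul_one]
      · simp only [Function.update_self, Function.update_of_ne (hs j hj), map_smul,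
          FunLike.coe_smul, Pi.smul_apply, if_neg (hs j hj).symm]
        rw [g.symm, hfort x hx.1 j hj, smul_zero]
      · simp only [Function.update_self, Function.update_of_ne (hs i hi), map_smul, if_neg (hs i hi)]
        rw [hfort x hx.1 i hi, smul_zero]
      · simp only [Function.update_of_ne (hs i hi), Function.update_of_ne (hs j hj)]
        exact hort x hx.1 i hi j hj

/-- An orthonormal basis at the point extends to smooth fields with values in the part, which are
then orthonormalized nearby. -/
theorem DMetric.exists_localSection [T2Space V] (c : HV) (x₀ : V) :
    ∃ U e, x₀ ∈ U ∧ IsLocalSection (g.frames c) U e := by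
  obtain ⟨e₀, he₀⟩ := g.signature c x₀
  choose X hX hmem hx using fun i => N.exists_smoothField_part (he₀.1 i)
  obtain ⟨U, e, hU, hxU, hsm, hm, -, ho⟩ := g.exists_gramSchmidt c (x₀ := x₀) Finset.univ
    (e := fun x i => X i x) isOpen_univ (Set.mem_univ _) (fun i => (hX i).contMDiffOn)
    (fun x _ i => hmem i x) (by
      have : (fun i => X i x₀) = e₀ := funext hx
      rw [this]
      exact he₀)
  exact ⟨U, e, hxU, hU, fun x hx => ⟨hm x hx, fun i j => ho x hx i (Finset.mem_univ _) j
    (Finset.mem_univ _)⟩, hsm⟩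

/-- The orthonormal frames form a principal bundle. -/
theorem DMetric.isFrameBundle [T2Space V] (c : HV) :
    IsFrameBundle (N.part c) g.inner (g.sign c) (pseudoOrthogonal (g.sign c)) (g.frames c) where
  le := le_rfl
  isOpen := Filter.Eventually.of_forall fun _ h => h
  orthonormal _ := subset_rfl
  act x e he a ha := (DMetric.frameMul_mem_frames_iff he _).2 ha
  transitive x e he e' he' := by
    have h := DMetric.frameMul_transition he he'.1
    obtain ⟨a, ha, hae⟩ := exists_pseudoOrthogonal_of_eq
      ((DMetric.frameMul_mem_frames_iff he _).1 (h ▸ he'))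
    refine ⟨a, ⟨ha, by rw [hae]; exact h⟩, fun b hb => Units.ext ?_⟩
    rw [hae, hb.2, DMetric.transition_frameMul he]
  localSection := g.exists_localSection c

end GramSchmidt

instance tangentSpace_t2Space {d : ℕ} {V : Type u} [TopologicalSpace V]
    [ChartedSpace (EuclideanSpace ℝ (Fin d)) V] (x : V) : T2Space (TangentSpace (𝓡 d) x) :=
  inferInstanceAs (T2Space (EuclideanSpace ℝ (Fin d)))

theorem isManifold_minSmoothness_two (d : ℕ) (V : Type u) [TopologicalSpace V]
    [ChartedSpace (EuclideanSpace ℝ (Fin d)) V] [IsManifold (𝓡 d) ∞ V] :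
    IsManifold (𝓡 d) (minSmoothness ℝ 2) V := by
  rw [minSmoothness_of_isRCLikeNormedField]
  infer_instance

/-! ### Raising an index, and the distortion of the canonical d-connection -/

section Raise

variable {n m : ℕ} {V : Type u} [TopologicalSpace V]
  [ChartedSpace (EuclideanSpace ℝ (Fin (n + m))) V] [IsManifold (𝓡 (n + m)) ∞ V]
  {N : NConnection n m V} (g : DMetric N)

theorem DMetric.eq_of_inner {x : V} {X Y : TangentSpace (𝓡 (n + m)) x}
    (h : ∀ Z, g.inner x X Z = g.inner x Y Z) : X = Y := by
  have key : ∀ c, N.toPart c x (X - Y) = 0 := fun c => by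
    refine g.eq_zero_of_inner (N.toPart_mem c x _) fun Z hZ => ?_
    rw [g.symm, g.inner_toPart_right hZ, g.symm, map_sub, sub_apply, h, sub_self]
  rw [← sub_eq_zero, ← N.toPart_add x (X - Y), key, key, add_zero]

/-- The vector dual to a linear form, in a couple of orthonormal frames. -/
noncomputable def DMetric.raise {x : V} (e : ∀ c : HV, Fin (c.dim n m) → TangentSpace (𝓡 (n + m)) x)
    (l : TangentSpace (𝓡 (n + m)) x → ℝ) : TangentSpace (𝓡 (n + m)) x :=
  ∑ i, (g.sign .h i * l (e .h i)) • e .h i + ∑ i, (g.sign .v i * l (e .v i)) • e .v i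

variable {g}

theorem DMetric.inner_raise {x : V} {e : ∀ c : HV, Fin (c.dim n m) → TangentSpace (𝓡 (n + m)) x}
    (he : ∀ c, e c ∈ g.frames c x) (l : TangentSpace (𝓡 (n + m)) x →ₗ[ℝ] ℝ)
    (Z : TangentSpace (𝓡 (n + m)) x) : g.inner x (g.raise e l) Z = l Z := by
  have key : ∀ c, g.inner x (∑ i, (g.sign c i * l (e c i)) • e c i) Z = l (N.toPart c x Z) := by
    intro c
    conv_rhs => rw [DMetric.eq_sum (he c) (N.toPart_mem c x Z)]
    simp only [map_sum, map_smul, FunLike.coe_sum, Finset.sum_apply, FunLike.coe_smul,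
      Pi.smul_apply, smul_eq_mul, g.inner_toPart_right ((he c).1 _)]
    exact Finset.sum_congr rfl fun i _ => by ring
  rw [DMetric.raise, map_add, add_apply, key, key, ← map_add, N.toPart_add]

end Raise

section Koszul

variable {n m : ℕ} {V : Type u} [TopologicalSpace V]
  [ChartedSpace (EuclideanSpace ℝ (Fin (n + m))) V] [IsManifold (𝓡 (n + m)) ∞ V]
  {N : NConnection n m V} (g : DMetric N) (D : LinConn (n + m) V)

/-- The part `c` of the covariant distortion tensor of the canonical d-connection. -/
noncomputable def koszulPart (c : HV) (x : V) (X Y Z : TangentSpace (𝓡 (n + m)) x) : ℝ :=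
  (g.inner x (D.torsion x X (N.toPart c x Z)) (N.toPart c x Y)
    - g.inner x (D.torsion x X (N.toPart c x Y)) (N.toPart c x Z)
    + g.inner x (D.torsion x (N.toPart c x Y) (N.toPart c x Z)) (N.toPart c x X)) / 2

/-- The covariant distortion tensor of the canonical d-connection with respect to `D`, as a linear
form in the last argument. -/
noncomputable def koszul (x : V) (X Y : TangentSpace (𝓡 (n + m)) x) :
    TangentSpace (𝓡 (n + m)) x →ₗ[ℝ] ℝ where
  toFun Z := koszulPart g D .h x X Y Z + koszulPart g D .v x X Y Z
  map_add' Z Z' := by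
    simp only [koszulPart, map_add, add_apply]; ring
  map_smul' a Z := by
    simp only [koszulPart, map_smul, smul_apply, smul_eq_mul, RingHom.id_apply]; ring

theorem koszul_apply (x : V) (X Y Z : TangentSpace (𝓡 (n + m)) x) :
    koszul g D x X Y Z = koszulPart g D .h x X Y Z + koszulPart g D .v x X Y Z := rfl

/-- The last index is raised in orthonormal frames; bilinearity follows from that of the Koszul
expression, as the metric is nondegenerate. -/
theorem exists_distortion (x : V) : ∃ A : TangentSpace (𝓡 (n + m)) x →L[ℝ]
    TangentSpace (𝓡 (n + m)) x →L[ℝ] TangentSpace (𝓡 (n + m)) x,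
    ∀ X Y Z, g.inner x (A Y X) Z = koszul g D x X Y Z := by
  choose e he using fun c => g.signature c x
  let A : TangentSpace (𝓡 (n + m)) x →ₗ[ℝ] TangentSpace (𝓡 (n + m)) x →ₗ[ℝ]
      TangentSpace (𝓡 (n + m)) x :=
    LinearMap.mk₂ ℝ (fun Y X => g.raise e (koszul g D x X Y))
      (fun Y Y' X => g.eq_of_inner fun Z => by
        simp only [map_add, add_apply, DMetric.inner_raise (g := g) he, koszul_apply, koszulPart]
        ring)
      (fun a Y X => g.eq_of_inner fun Z => by
        simp only [map_smul, smul_apply, smul_eq_mul, DMetric.inner_raise (g := g) he,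
          koszul_apply, koszulPart]
        ring)
      (fun Y X X' => g.eq_of_inner fun Z => by
        simp only [map_add, add_apply, DMetric.inner_raise (g := g) he, koszul_apply, koszulPart]
        ring)
      (fun a Y X => g.eq_of_inner fun Z => by
        simp only [map_smul, smul_apply, smul_eq_mul, DMetric.inner_raise (g := g) he,
          koszul_apply, koszulPart]
        ring)
  exact ⟨A.toContinuousBilinearMap, fun X Y Z => DMetric.inner_raise (g := g) he _ Z⟩

/-- The distortion tensor of the canonical d-connection with respect to `D`. -/
noncomputable def distortion (x : V) : TangentSpace (𝓡 (n + m)) x →L[ℝ]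
    TangentSpace (𝓡 (n + m)) x →L[ℝ] TangentSpace (𝓡 (n + m)) x :=
  (exists_distortion g D x).choose

theorem inner_distortion (x : V) (X Y Z : TangentSpace (𝓡 (n + m)) x) :
    g.inner x (distortion g D x Y X) Z = koszul g D x X Y Z :=
  (exists_distortion g D x).choose_spec X Y Z

/-- The frames are arbitrary, so smooth ones may be inserted near any point. This is how the tensor,
defined by a choice at each point, is seen to be smooth. -/
theorem distortion_eq_raise {x : V} {e : ∀ c : HV, Fin (c.dim n m) → TangentSpace (𝓡 (n + m)) x}
    (he : ∀ c, e c ∈ g.frames c x) (X Y : TangentSpace (𝓡 (n + m)) x) :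
    distortion g D x Y X = g.raise e (koszul g D x X Y) :=
  g.eq_of_inner fun Z => by rw [inner_distortion, DMetric.inner_raise he]

/-- The canonical d-connection constructed from a metric d-connection. -/
noncomputable def canonicalOf : LinConn (n + m) V := D.addOneForm (distortion g D)

theorem canonicalOf_apply (Y : ∀ x : V, TangentSpace (𝓡 (n + m)) x) (x : V)
    (X : TangentSpace (𝓡 (n + m)) x) :
    canonicalOf g D Y x X = D Y x X + distortion g D x (Y x) X := rfl

end Koszul

/-! ### Smoothness of covariant derivatives and torsion -/

section SmoothConnections

variable {d : ℕ} {V : Type u} [TopologicalSpace V] [ChartedSpace (EuclideanSpace ℝ (Fin d)) V]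
  [IsManifold (𝓡 d) ∞ V]

theorem LinConn.smoothField_apply {D : LinConn d V}
    (hD : ContMDiffCovariantDerivativeOn (EuclideanSpace ℝ (Fin d)) ∞ D.toFun Set.univ)
    {X Y : ∀ x : V, TangentSpace (𝓡 d) x} (hX : SmoothField X) (hY : SmoothField Y) :
    SmoothField fun x => D Y x (X x) := by
  have h := hD.contMDiff (σ := Y) (contMDiffOn_univ.2 hY)
  exact contMDiffOn_univ.1 (h.clm_bundle_apply (contMDiffOn_univ.2 hX))

theorem SmoothField.mlieBracket {X Y : ∀ x : V, TangentSpace (𝓡 d) x} (hX : SmoothField X)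
    (hY : SmoothField Y) : SmoothField (VectorField.mlieBracket (𝓡 d) X Y) := by
  have : IsManifold (𝓡 d) (((⊤ : ℕ∞) : ℕ∞ω) + 1) V := by simpa using ‹IsManifold (𝓡 d) ∞ V›
  have := isManifold_minSmoothness_two d V
  exact ContDiff.mlieBracket_vectorField (m := ⊤) (n := ⊤) hX hY (by simp)

theorem LinConn.smoothField_torsion {D : LinConn d V}
    (hD : ContMDiffCovariantDerivativeOn (EuclideanSpace ℝ (Fin d)) ∞ D.toFun Set.univ)
    {X Y : ∀ x : V, TangentSpace (𝓡 d) x} (hX : SmoothField X) (hY : SmoothField Y) :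
    SmoothField fun x => D.torsion x (X x) (Y x) := by
  have h : (fun x => D.torsion x (X x) (Y x))
      = (fun x => D Y x (X x)) - (fun x => D X x (Y x)) - VectorField.mlieBracket (𝓡 d) X Y := by
    funext x
    exact D.torsion_apply (hX.mdifferentiableAt x) (hY.mdifferentiableAt x)
  rw [h]
  exact ((LinConn.smoothField_apply hD hX hY).sub_section
    (LinConn.smoothField_apply hD hY hX)).sub_section (hX.mlieBracket hY)

end SmoothConnections

/-! ### Existence and uniqueness of the canonical d-connection -/

section Canonical

variable {n m : ℕ} {V : Type u} [TopologicalSpace V]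
  [ChartedSpace (EuclideanSpace ℝ (Fin (n + m))) V] [IsManifold (𝓡 (n + m)) ∞ V]
  {N : NConnection n m V} {g : DMetric N} {D : LinConn (n + m) V}

theorem DMetric.smooth_inner (g : DMetric N) {X Y : ∀ x : V, TangentSpace (𝓡 (n + m)) x}
    (hX : SmoothField X) (hY : SmoothField Y) :
    ContMDiff (𝓡 (n + m)) 𝓘(ℝ, ℝ) ∞ (fun x => g.inner x (X x) (Y x)) :=
  contMDiffOn_univ.1 (g.contMDiffOn_inner hX.contMDiffOn hY.contMDiffOn)

theorem contMDiff_koszul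
    (hD : ContMDiffCovariantDerivativeOn (EuclideanSpace ℝ (Fin (n + m))) ∞ D.toFun Set.univ)
    {X Y Z : ∀ x : V, TangentSpace (𝓡 (n + m)) x} (hX : SmoothField X) (hY : SmoothField Y)
    (hZ : SmoothField Z) :
    ContMDiff (𝓡 (n + m)) 𝓘(ℝ, ℝ) ∞ (fun x => koszul g D x (X x) (Y x) (Z x)) := by
  have h : ∀ c, ContMDiff (𝓡 (n + m)) 𝓘(ℝ, ℝ) ∞
      (fun x => koszulPart g D c x (X x) (Y x) (Z x)) := fun c => by
    have hX' := N.smoothField_toPart c hX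
    have hY' := N.smoothField_toPart c hY
    have hZ' := N.smoothField_toPart c hZ
    exact (((g.smooth_inner (LinConn.smoothField_torsion hD hX hZ') hY').sub
      (g.smooth_inner (LinConn.smoothField_torsion hD hX hY') hZ')).add
      (g.smooth_inner (LinConn.smoothField_torsion hD hY' hZ') hX')).div_const 2
  exact (h .h).add (h .v)

/-- Near `x₀` the tensor is obtained by raising an index in smooth orthonormal frames. These are cut
off to global fields, on which the Koszul expression is known to be smooth. -/
theorem smoothField_distortion [T2Space V]
    (hD : ContMDiffCovariantDerivativeOn (EuclideanSpace ℝ (Fin (n + m))) ∞ D.toFun Set.univ)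
    {X Y : ∀ x : V, TangentSpace (𝓡 (n + m)) x} (hX : SmoothField X) (hY : SmoothField Y) :
    SmoothField fun x => distortion g D x (Y x) (X x) := by
  intro x₀
  choose U e hx he using fun c => g.exists_localSection c x₀
  choose f hf hfe _hf0 using fun c i =>
    exists_smoothField_eventuallyEq (he c).isOpen ((he c).smooth i) (hx c)
  have hs : SmoothField fun x =>
      g.raise (fun c i => (f c i • fun x => e c x i) x) (koszul g D x (X x) (Y x)) := by
    have h : ∀ c, SmoothField fun x => ∑ i, (g.sign c i *
        koszul g D x (X x) (Y x) ((f c i • fun x => e c x i) x)) • (f c i • fun x => e c x i) x :=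
      fun c => ContMDiff.sum_section fun i _ => ContMDiff.smul_section
        (f := fun x => g.sign c i * koszul g D x (X x) (Y x) ((f c i • fun x => e c x i) x))
        (contMDiff_const.mul (contMDiff_koszul hD hX hY (hf c i))) (hf c i)
    exact (h .h).add_section (h .v)
  refine (hs x₀).congr_of_eventuallyEq ?_
  have hU : ∀ᶠ x in 𝓝 x₀, ∀ c, x ∈ U c := by
    filter_upwards [(he .h).isOpen.mem_nhds (hx .h), (he .v).isOpen.mem_nhds (hx .v)]
      with x h1 h2 c
    cases c <;> assumption
  have hE : ∀ c, ∀ᶠ x in 𝓝 x₀, ∀ i, (f c i • fun x => e c x i) x = e c x i := fun c =>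
    Filter.eventually_all.2 fun i => hfe c i
  filter_upwards [hU, hE .h, hE .v] with x h1 h2 h3
  have : (fun c i => (f c i • fun x => e c x i) x) = fun c => e c x := by
    funext c i
    cases c
    · exact h2 i
    · exact h3 i
  simp only [this]
  rw [distortion_eq_raise g D (e := fun c => e c x) (fun c => (he c).mem x (h1 c))]

theorem canonicalOf_smooth [T2Space V]
    (hD : ContMDiffCovariantDerivativeOn (EuclideanSpace ℝ (Fin (n + m))) ∞ D.toFun Set.univ) :
    ContMDiffCovariantDerivativeOn (EuclideanSpace ℝ (Fin (n + m))) ∞ (canonicalOf g D).toFun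
      Set.univ where
  contMDiff {Y} hY := by
    have hY : SmoothField Y := contMDiffOn_univ.1 hY
    refine contMDiffOn_univ.2 (contMDiff_hom_of_apply fun X hX => ?_)
    exact (LinConn.smoothField_apply hD hX hY).add_section (smoothField_distortion hD hX hY)

/-- One expression meets both requirements. For `X` in the same part it is the usual contorsion,
which removes the torsion inside the part. For `X` in the other part the last term drops out, and
the remaining half-difference turns D_X Y into the prescribed mixed derivative. -/
theorem koszul_of_mem {c : HV} {x : V} {X Y Z : TangentSpace (𝓡 (n + m)) x}
    (hY : Y ∈ N.part c x) (hZ : Z ∈ N.part c x) : koszul g D x X Y Z =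
      (g.inner x (D.torsion x X Z) Y - g.inner x (D.torsion x X Y) Z
        + g.inner x (D.torsion x Y Z) (N.toPart c x X)) / 2 := by
  rw [koszul_apply]
  unfold koszulPart
  cases c
  · rw [N.toPart_of_mem hY, N.toPart_of_mem hZ, N.toPart_of_mem_ne (c' := .v) (by simp) hY,
      N.toPart_of_mem_ne (c' := .v) (by simp) hZ]
    simp
  · rw [N.toPart_of_mem hY, N.toPart_of_mem hZ, N.toPart_of_mem_ne (c' := .h) (by simp) hY,
      N.toPart_of_mem_ne (c' := .h) (by simp) hZ]
    simp

theorem koszul_of_mem_ne {c c' : HV} (hc : c ≠ c') {x : V} {X Y Z : TangentSpace (𝓡 (n + m)) x}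
    (hY : Y ∈ N.part c x) (hZ : Z ∈ N.part c' x) : koszul g D x X Y Z = 0 := by
  rw [koszul_apply]
  unfold koszulPart
  cases c <;> cases c' <;> first | exact absurd rfl hc | skip
  · rw [N.toPart_of_mem_ne (c' := .v) (by simp) hY, N.toPart_of_mem_ne (c' := .h) (by simp) hZ]
    simp
  · rw [N.toPart_of_mem_ne (c' := .h) (by simp) hY, N.toPart_of_mem_ne (c' := .v) (by simp) hZ]
    simp

/-- Skewness in the last two arguments keeps the modified connection metric. -/
theorem koszul_swap (x : V) (X Y Z : TangentSpace (𝓡 (n + m)) x) :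
    koszul g D x X Z Y = - koszul g D x X Y Z := by
  rw [koszul_apply, koszul_apply]
  unfold koszulPart
  have h : ∀ c, D.torsion x (N.toPart c x Z) (N.toPart c x Y)
      = - D.torsion x (N.toPart c x Y) (N.toPart c x Z) := fun c => D.torsion_antisymm _ _
  rw [h .h, h .v]
  simp only [map_neg, neg_apply]
  ring

/-- Each part is the orthogonal complement of the other. -/
theorem DMetric.mem_part_of_inner (g : DMetric N) {c : HV} {x : V} {X : TangentSpace (𝓡 (n + m)) x}
    (h : ∀ c' ≠ c, ∀ Z ∈ N.part c' x, g.inner x X Z = 0) : X ∈ N.part c x := by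
  have key : ∀ c' ≠ c, N.toPart c' x X = 0 := fun c' hc' => by
    refine g.eq_zero_of_inner (N.toPart_mem c' x _) fun Z hZ => ?_
    rw [g.symm, g.inner_toPart_right hZ, g.symm, h c' hc' Z hZ]
  rw [← N.toPart_add x X]
  cases c
  · rw [key .v (by simp), add_zero]; exact N.toPart_mem _ _ _
  · rw [key .h (by simp), zero_add]; exact N.toPart_mem _ _ _

theorem distortion_mem {c : HV} {x : V} {Y : TangentSpace (𝓡 (n + m)) x} (hY : Y ∈ N.part c x)
    (X : TangentSpace (𝓡 (n + m)) x) : distortion g D x Y X ∈ N.part c x :=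
  g.mem_part_of_inner fun c' hc' Z hZ => by
    rw [inner_distortion, koszul_of_mem_ne hc'.symm hY hZ]

theorem canonicalOf_torsion [T2Space V] (x : V) (X Y : TangentSpace (𝓡 (n + m)) x) :
    (canonicalOf g D).torsion x X Y
      = D.torsion x X Y + distortion g D x Y X - distortion g D x X Y := by
  obtain ⟨X', hX, rfl⟩ := exists_smoothField_apply X
  obtain ⟨Y', hY, rfl⟩ := exists_smoothField_apply Y
  rw [(canonicalOf g D).torsion_apply (hX.mdifferentiableAt x) (hY.mdifferentiableAt x),
    D.torsion_apply (hX.mdifferentiableAt x) (hY.mdifferentiableAt x), canonicalOf_apply,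
    canonicalOf_apply]
  abel

/-- Paired with vectors of part `c`, the antisymmetrized distortion is exactly minus the old
torsion. -/
theorem canonicalOf_torsion_mem [T2Space V] {c c' : HV} (hc : c' ≠ c) {x : V}
    {X Y : TangentSpace (𝓡 (n + m)) x} (hX : X ∈ N.part c x) (hY : Y ∈ N.part c x) :
    (canonicalOf g D).torsion x X Y ∈ N.part c' x :=
  g.mem_part_of_inner fun c'' hc'' Z hZ => by
    have : c'' = c := by cases c <;> cases c' <;> cases c'' <;> simp_all
    subst this
    rw [canonicalOf_torsion]
    simp only [map_add, map_sub, add_apply, sub_apply, inner_distortion]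
    rw [koszul_of_mem hY hZ, koszul_of_mem hX hZ, N.toPart_of_mem hX, N.toPart_of_mem hY,
      D.torsion_antisymm Y X]
    simp only [map_neg, neg_apply]
    ring

theorem IsMetricDConnection.canonicalOf_isMetricDConnection [T2Space V]
    (hD : IsMetricDConnection N g D) : IsMetricDConnection N g (canonicalOf g D) where
  smooth := canonicalOf_smooth hD.smooth
  adapted c Y hY hYc x X :=
    Submodule.add_mem _ (hD.adapted c Y hY hYc x X) (distortion_mem (hYc x) X)
  metric Y Z hY hZ x X := by
    rw [hD.metric Y Z hY hZ, canonicalOf_apply, canonicalOf_apply, map_add, map_add, add_apply,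
      g.symm x (Y x) (distortion g D x (Z x) X), inner_distortion, inner_distortion, koszul_swap]
    ring

theorem IsMetricDConnection.isCanonical_canonicalOf [T2Space V] (hD : IsMetricDConnection N g D) :
    IsCanonical N g (canonicalOf g D) where
  isMetricDConnection := hD.canonicalOf_isMetricDConnection
  torsion_hhh x X hX Y hY := canonicalOf_torsion_mem (by simp) hX hY
  torsion_vvv x X hX Y hY := canonicalOf_torsion_mem (by simp) hX hY
  mixed c c' hc X Y Z hX hY hZ hXc hYc hZc x := by
    rw [canonicalOf_apply, map_add, add_apply, inner_distortion, koszul_of_mem (hYc x) (hZc x),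
      N.toPart_of_mem_ne hc (hXc x), hD.metric Y Z hY hZ,
      D.torsion_apply (hX.mdifferentiableAt x) (hY.mdifferentiableAt x),
      D.torsion_apply (hX.mdifferentiableAt x) (hZ.mdifferentiableAt x)]
    -- D_Y X and D_Z X stay in the part of `X`, so they are orthogonal to `Z` and `Y`. The torsion
    -- terms leave only D_X Y, D_X Z and the two brackets.
    have h1 := g.inner_of_ne hc (hD.adapted c X hX hXc x (Y x)) (hZc x)
    have h2 := g.inner_of_ne hc (hD.adapted c X hX hXc x (Z x)) (hYc x)
    simp only [map_sub, sub_apply, h1, h2, map_zero]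
    rw [g.symm x (Y x) (D Z x (X x))]
    ring

theorem IsCanonical.torsion_mem {D : LinConn (n + m) V} (hD : IsCanonical N g D) {c c' : HV}
    (hc : c' ≠ c) {x : V} {X Y : TangentSpace (𝓡 (n + m)) x} (hX : X ∈ N.part c x)
    (hY : Y ∈ N.part c x) : D.torsion x X Y ∈ N.part c' x := by
  cases c <;> cases c' <;> first | exact absurd rfl hc | skip
  · exact hD.torsion_hhh x X hX Y hY
  · exact hD.torsion_vvv x X hX Y hY

/-- The difference `S` is a tensor which preserves the parts and is skew for the metric. The mixed
formula kills it on arguments of different parts. On a single part the torsion condition makes it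
symmetric, and a trilinear form that is symmetric in one pair of arguments and skew in another is
zero. The comparison is restricted to fields differentiable at the point, where the Leibniz rule is
available. -/
theorem IsCanonical.unique [T2Space V] {D D' : LinConn (n + m) V} (hD : IsCanonical N g D)
    (hD' : IsCanonical N g D') (Y : ∀ x : V, TangentSpace (𝓡 (n + m)) x) (x : V)
    (hY : MDifferentiableAt (𝓡 (n + m)) (𝓡 (n + m)).tangent (T% Y) x) : D' Y x = D Y x := by
  have hm := isManifold_one (n + m) V
  let S := D'.difference D x
  have hS : ∀ Y : ∀ x : V, TangentSpace (𝓡 (n + m)) x,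
      MDifferentiableAt (𝓡 (n + m)) (𝓡 (n + m)).tangent (T% Y) x → S (Y x) = D' Y x - D Y x :=
    fun Y hY => IsCovariantDerivativeOn.difference_apply _ _ (Set.mem_univ x) hY
  have hmem : ∀ c, ∀ Y ∈ N.part c x, ∀ X, S Y X ∈ N.part c x := fun c Y hY X => by
    obtain ⟨Y', hY', hYc, rfl⟩ := N.exists_smoothField_part hY
    rw [hS _ (hY'.mdifferentiableAt x)]
    exact Submodule.sub_mem _ (hD'.isMetricDConnection.adapted c Y' hY' hYc x X)
      (hD.isMetricDConnection.adapted c Y' hY' hYc x X)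
  have hskew : ∀ X Y Z, g.inner x (S Y X) Z = - g.inner x (S Z X) Y := fun X Y Z => by
    obtain ⟨Y, hY, rfl⟩ := exists_smoothField_apply Y
    obtain ⟨Z, hZ, rfl⟩ := exists_smoothField_apply Z
    have h := hD.isMetricDConnection.metric Y Z hY hZ x X
    rw [hD'.isMetricDConnection.metric Y Z hY hZ x X] at h
    rw [hS _ (hY.mdifferentiableAt x), hS _ (hZ.mdifferentiableAt x)]
    simp only [map_sub, sub_apply]
    rw [g.symm x (D' Z x X), g.symm x (D Z x X)]
    linarith
  have hmixed : ∀ c c', c ≠ c' → ∀ X ∈ N.part c x, ∀ Y ∈ N.part c' x, S Y X = 0 :=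
    fun c c' hc X hX Y hY => by
      refine g.eq_zero_of_inner (hmem c' Y hY X) fun Z hZ => ?_
      obtain ⟨X, hX', hXc, rfl⟩ := N.exists_smoothField_part hX
      obtain ⟨Y, hY', hYc, rfl⟩ := N.exists_smoothField_part hY
      obtain ⟨Z, hZ', hZc, rfl⟩ := N.exists_smoothField_part hZ
      have h1 := hD.mixed c c' hc X Y Z hX' hY' hZ' hXc hYc hZc x
      have h2 := hD'.mixed c c' hc X Y Z hX' hY' hZ' hXc hYc hZc x
      rw [hS _ (hY'.mdifferentiableAt x)]
      simp only [map_sub, sub_apply]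
      linarith
  have hsymm : ∀ c, ∀ X ∈ N.part c x, ∀ Y ∈ N.part c x, S Y X = S X Y := fun c X hX Y hY => by
    rw [← sub_eq_zero]
    refine g.eq_zero_of_inner (Submodule.sub_mem _ (hmem c Y hY X) (hmem c X hX Y)) fun Z hZ => ?_
    obtain ⟨c', hc'⟩ : ∃ c' : HV, c' ≠ c := by
      cases c
      · exact ⟨.v, by simp⟩
      · exact ⟨.h, by simp⟩
    have hT := hD'.torsion_mem hc' hX hY
    have hT' := hD.torsion_mem hc' hX hY
    obtain ⟨X, hX', hXc, rfl⟩ := N.exists_smoothField_part hX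
    obtain ⟨Y, hY', hYc, rfl⟩ := N.exists_smoothField_part hY
    rw [hS _ (hY'.mdifferentiableAt x), hS _ (hX'.mdifferentiableAt x)]
    have h1 := D'.torsion_apply (hX'.mdifferentiableAt x) (hY'.mdifferentiableAt x)
    have h2 := D.torsion_apply (hX'.mdifferentiableAt x) (hY'.mdifferentiableAt x)
    have h3 : D' Y x (X x) - D Y x (X x) - (D' X x (Y x) - D X x (Y x))
        = D'.torsion x (X x) (Y x) - D.torsion x (X x) (Y x) := by
      rw [h1, h2]; abel
    rw [sub_apply, sub_apply, h3]
    exact g.inner_of_ne hc' (Submodule.sub_mem _ hT hT') hZ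
  -- Applying skewness and symmetry alternately, three times, returns to the initial term with the
  -- opposite sign.
  have hsame : ∀ c, ∀ X ∈ N.part c x, ∀ Y ∈ N.part c x, S Y X = 0 := fun c X hX Y hY => by
    refine g.eq_zero_of_inner (hmem c Y hY X) fun Z hZ => ?_
    have h1 := hskew X Y Z
    rw [hsymm c X hX Z hZ] at h1
    have h2 := hskew Z X Y
    rw [hsymm c Z hZ Y hY] at h2
    have h3 := hskew Y Z X
    rw [hsymm c Y hY X hX] at h3
    linarith
  have hz : ∀ c c', ∀ X ∈ N.part c x, ∀ Y ∈ N.part c' x, S Y X = 0 := fun c c' X hX Y hY => by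
    by_cases hc : c = c'
    · subst hc; exact hsame c X hX Y hY
    · exact hmixed c c' hc X hX Y hY
  have hS0 : ∀ Y X, S Y X = 0 := fun Y X => by
    have hz' : ∀ c c', S (N.toPart c' x Y) (N.toPart c x X) = 0 := fun c c' =>
      hz c c' _ (N.toPart_mem _ _ _) _ (N.toPart_mem _ _ _)
    rw [← N.toPart_add x Y, ← N.toPart_add x X]
    simp only [map_add, add_apply, hz', add_zero]
  ext1 X
  have := congrArg (fun L => L X) (hS Y hY)
  simp only [sub_apply] at this
  rw [hS0] at this
  exact (sub_eq_zero.1 this.symm)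

end Canonical

/-! ## The covering `Ĝ → G` and the lifting gerbe -/

section Covering

variable {r k : ℕ} {G : Subgroup (Matrix.GeneralLinearGroup (Fin r) ℝ)}
  {Ĝ : Type*} [Group Ĝ] [TopologicalSpace Ĝ]

/-- The kernel is the image of ℤ_k, hence finite, hence discrete in the Hausdorff group Ĝ; a
quotient map of groups with discrete kernel is a covering. -/
theorem CentralExtension.isLocalHomeomorph [NeZero k] [IsTopologicalGroup Ĝ] [T2Space Ĝ]
    (E : CentralExtension k G Ĝ) : IsLocalHomeomorph E.proj := by
  have hfin : (E.proj.ker : Set Ĝ).Finite := by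
    rw [← E.exact, MonoidHom.coe_range]
    have : Finite (Multiplicative (ZMod k)) := inferInstanceAs (Finite (ZMod k))
    exact Set.finite_range _
  exact (E.isOpenQuotientMap.isQuotientMap.isQuotientCoveringMap_of_isDiscrete_ker_monoidHom
    hfin.isDiscrete).isCoveringMap.isLocalHomeomorph

theorem CentralExtension.proj_eq_of_mat_eq (E : CentralExtension k G Ĝ) {a b : Ĝ}
    (h : E.mat a = E.mat b) : E.proj a = E.proj b :=
  Subtype.ext (Units.ext h)

/-- Locally an element of Ĝ is determined by its matrix. This serves to identify curves in Ĝ that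
have the same matrices. -/
theorem CentralExtension.exists_nhds_injOn_mat [NeZero k] [IsTopologicalGroup Ĝ] [T2Space Ĝ]
    (E : CentralExtension k G Ĝ) (a : Ĝ) : ∃ O ∈ 𝓝 a, Set.InjOn E.mat O := by
  obtain ⟨e, ha, he⟩ := E.isLocalHomeomorph a
  refine ⟨e.source, e.open_source.mem_nhds ha, fun b hb b' hb' h => e.injOn hb hb' ?_⟩
  rw [← he]
  exact E.proj_eq_of_mat_eq h

/-- The topology of the group of units also sees the inverse, which is continuous by Cramer's rule.
-/
theorem continuous_subgroup_of_entries {X : Type*} [TopologicalSpace X] {f : X → G}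
    (hf : ∀ i j, Continuous fun x =>
      ((f x : Matrix.GeneralLinearGroup (Fin r) ℝ) : Matrix (Fin r) (Fin r) ℝ) i j) :
    Continuous f := by
  have h : Continuous fun x =>
      ((f x : Matrix.GeneralLinearGroup (Fin r) ℝ) : Matrix (Fin r) (Fin r) ℝ) :=
    continuous_matrix hf
  refine continuous_induced_rng.2 (Units.continuous_iff.2 ⟨h, ?_⟩)
  have hinv : ∀ x, (((f x : Matrix.GeneralLinearGroup (Fin r) ℝ)⁻¹ :
      Matrix.GeneralLinearGroup (Fin r) ℝ) : Matrix (Fin r) (Fin r) ℝ)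
        = ((f x : Matrix.GeneralLinearGroup (Fin r) ℝ) : Matrix (Fin r) (Fin r) ℝ).det⁻¹ •
          ((f x : Matrix.GeneralLinearGroup (Fin r) ℝ) : Matrix (Fin r) (Fin r) ℝ).adjugate :=
    fun x => by rw [Matrix.coe_units_inv, Matrix.inv_def, Ring.inverse_eq_inv']
  simp only [Function.comp_def, hinv]
  exact (h.matrix_det.inv₀ fun x => (f x : Matrix.GeneralLinearGroup (Fin r) ℝ).det.ne_zero).smul
    h.matrix_adjugate

theorem exists_continuousOn_subgroup (G : Subgroup (Matrix.GeneralLinearGroup (Fin r) ℝ))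
    {X : Type*} [TopologicalSpace X] {O : Set X} {M : X → Matrix (Fin r) (Fin r) ℝ}
    (hM : ∀ i j, ContinuousOn (fun x => M x i j) O)
    (hG : ∀ x ∈ O, ∃ a ∈ G, (a : Matrix (Fin r) (Fin r) ℝ) = M x) :
    ∃ τ : X → G, ContinuousOn τ O ∧ ∀ x ∈ O,
      ((τ x : Matrix.GeneralLinearGroup (Fin r) ℝ) : Matrix (Fin r) (Fin r) ℝ) = M x := by
  have : ∀ x, ∃ τ : G, x ∈ O →
      ((τ : Matrix.GeneralLinearGroup (Fin r) ℝ) : Matrix (Fin r) (Fin r) ℝ) = M x := fun x => by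
    by_cases hx : x ∈ O
    · obtain ⟨a, ha, hax⟩ := hG x hx
      exact ⟨⟨a, ha⟩, fun _ => hax⟩
    · exact ⟨1, fun h => absurd h hx⟩
  choose τ hτ using this
  refine ⟨τ, ?_, hτ⟩
  rw [continuousOn_iff_continuous_domRestrict]
  refine continuous_subgroup_of_entries fun i j => ?_
  refine (continuousOn_iff_continuous_domRestrict.1 (hM i j)).congr fun x => ?_
  exact (congrFun (congrFun (hτ x x.2) i) j).symm

/-- Matrix-valued maps with values in `G` lift locally to `Ĝ`. -/
theorem CentralExtension.exists_lift [NeZero k] [IsTopologicalGroup Ĝ] [T2Space Ĝ]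
    (E : CentralExtension k G Ĝ) {X : Type*} [TopologicalSpace X] {O : Set X} (hO : IsOpen O)
    {M : X → Matrix (Fin r) (Fin r) ℝ} (hM : ∀ i j, ContinuousOn (fun x => M x i j) O)
    (hG : ∀ x ∈ O, ∃ a ∈ G, (a : Matrix (Fin r) (Fin r) ℝ) = M x) {x₀ : X} (hx₀ : x₀ ∈ O) {ψ₀ : Ĝ}
    (hψ₀ : E.mat ψ₀ = M x₀) :
    ∃ (O' : Set X) (ψ : X → Ĝ), IsOpen O' ∧ x₀ ∈ O' ∧ O' ⊆ O ∧ ContinuousOn ψ O' ∧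
      (∀ x ∈ O', E.mat (ψ x) = M x) ∧ ψ x₀ = ψ₀ := by
  obtain ⟨τ, hcont, hτ⟩ := exists_continuousOn_subgroup G hM hG
  obtain ⟨e, ha, he⟩ := E.isLocalHomeomorph ψ₀
  have h0 : e ψ₀ = τ x₀ := by
    rw [← he]
    exact Subtype.ext (Units.ext (hψ₀.trans (hτ x₀ hx₀).symm))
  -- The lift is the local inverse of the covering at `ψ₀`, on the part of `O` that τ maps into its
  -- domain.
  refine ⟨O ∩ τ ⁻¹' e.target, fun x => e.symm (τ x), hcont.isOpen_inter_preimage hO e.open_target,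
    ⟨hx₀, ?_⟩, Set.inter_subset_left, ?_, fun x hx => ?_, ?_⟩
  · rw [Set.mem_preimage, ← h0]
    exact e.map_source ha
  · exact e.continuousOn_symm.comp (hcont.mono Set.inter_subset_left) fun x hx => hx.2
  · have h1 : E.proj (e.symm (τ x)) = τ x := by rw [he]; exact e.right_inv hx.2
    rw [CentralExtension.mat, h1, hτ x hx.1]
  · simp only
    rw [← h0, e.left_inv ha]

theorem CentralExtension.mat_inc (E : CentralExtension k G Ĝ) (z : Multiplicative (ZMod k)) :
    E.mat (E.inc z) = 1 := by
  have h : E.inc z ∈ E.proj.ker := by rw [← E.exact]; exact ⟨z, rfl⟩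
  simp [CentralExtension.mat, MonoidHom.mem_ker.1 h]

theorem CentralExtension.mat_mul_mat_inv (E : CentralExtension k G Ĝ) (a : Ĝ) :
    E.mat a * E.mat a⁻¹ = 1 := by
  rw [← E.mat_mul, mul_inv_cancel, E.mat_one]

theorem CentralExtension.mat_inv_mul_mat (E : CentralExtension k G Ĝ) (a : Ĝ) :
    E.mat a⁻¹ * E.mat a = 1 := by
  rw [← E.mat_mul, inv_mul_cancel, E.mat_one]

end Covering

section Gerbe

variable {n m k : ℕ} {V : Type u} [TopologicalSpace V]
  [ChartedSpace (EuclideanSpace ℝ (Fin (n + m))) V] [IsManifold (𝓡 (n + m)) ∞ V]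
  {N : NConnection n m V} {g : DMetric N} {c : HV}
  {G : Subgroup (Matrix.GeneralLinearGroup (Fin (c.dim n m)) ℝ)}
  {B : FrameFamily (c.dim n m) (n + m) V}
  {Ĝ : Type*} [Group Ĝ] [TopologicalSpace Ĝ] {E : CentralExtension k G Ĝ}

theorem DMetric.contMDiffOn_transition {U : Set V}
    {e e' : ∀ x : V, Fin (c.dim n m) → TangentSpace (𝓡 (n + m)) x}
    (he : ∀ i, ContMDiffOn (𝓡 (n + m)) (𝓡 (n + m)).tangent ∞ (T% (fun x => e x i)) U)
    (he' : ∀ i, ContMDiffOn (𝓡 (n + m)) (𝓡 (n + m)).tangent ∞ (T% (fun x => e' x i)) U)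
    (i j : Fin (c.dim n m)) :
    ContMDiffOn (𝓡 (n + m)) 𝓘(ℝ, ℝ) ∞ (fun x => g.transition (e x) (e' x) i j) U :=
  contMDiffOn_const.mul (g.contMDiffOn_inner (he i) (he' j))

/-- Along two local sections of the frame bundle, an element of `Ψ` extends to a local section
of `Ψ`. -/
theorem IsFrameBundle.exists_isLift [NeZero k] [IsTopologicalGroup Ĝ] [T2Space Ĝ]
    (hB : IsFrameBundle (N.part c) g.inner (g.sign c) G B) {U₁ U₂ : Set V}
    {e₁ e₂ : ∀ x : V, Fin (c.dim n m) → TangentSpace (𝓡 (n + m)) x}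
    (h₁ : IsLocalSection B U₁ e₁) (h₂ : IsLocalSection B U₂ e₂) {x : V} (hx : x ∈ U₁ ∩ U₂)
    {ψ₀ : Ĝ} (hψ₀ : ψ₀ ∈ E.Psi (e₁ x) (e₂ x)) :
    ∃ O ψ, x ∈ O ∧ O ⊆ U₁ ∩ U₂ ∧ E.IsLift O e₁ e₂ ψ ∧ ψ x = ψ₀ := by
  have hf : ∀ y ∈ U₁ ∩ U₂, e₁ y ∈ g.frames c y := fun y hy => hB.orthonormal y (h₁.mem y hy.1)
  have htr : ∀ y ∈ U₁ ∩ U₂, ∀ a, e₂ y = frameMul (e₁ y) a → a = g.transition (e₁ y) (e₂ y) :=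
    fun y hy a ha => by rw [ha, DMetric.transition_frameMul (hf y hy)]
  obtain ⟨O, ψ, hO, hxO, hOU, hψ, hmat, h0⟩ := E.exists_lift
    (M := fun y => g.transition (e₁ y) (e₂ y)) (h₁.isOpen.inter h₂.isOpen)
    (fun i j => (DMetric.contMDiffOn_transition
      (fun i => (h₁.smooth i).mono Set.inter_subset_left)
      (fun i => (h₂.smooth i).mono Set.inter_subset_right) i j).continuousOn)
    (fun y hy => by
      obtain ⟨a, ⟨ha, hae⟩, -⟩ := hB.transitive y _ (h₁.mem y hy.1) _ (h₂.mem y hy.2)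
      exact ⟨a, ha, htr y hy _ hae⟩) hx (htr x hx _ hψ₀)
  refine ⟨O, ψ, hxO, hOU, ⟨hO, hψ, fun y hy => ?_⟩, h0⟩
  change e₂ y = _
  rw [hmat y hy]
  exact DMetric.frameMul_transition (hf y (hOU hy))
    (hB.orthonormal y (h₂.mem y (hOU hy).2)).1

/-- An orthonormal frame determines the matrix that carries it to another frame, so membership in Ψ
is a condition on matrices, smooth along local sections. -/
theorem CentralExtension.mem_Psi_iff (he : B ≤ g.frames c) {x : V}
    {e₁ e₂ : Fin (c.dim n m) → TangentSpace (𝓡 (n + m)) x} (h₁ : e₁ ∈ B x) (h₂ : e₂ ∈ B x) {a : Ĝ} :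
    a ∈ E.Psi e₁ e₂ ↔ E.mat a = g.transition e₁ e₂ := by
  constructor
  · intro h
    rw [show e₂ = _ from h, DMetric.transition_frameMul (he x h₁)]
  · intro h
    change e₂ = _
    rw [h]
    exact DMetric.frameMul_transition (he x h₁) (he x h₂).1

/-- The lifting bundle gerbe. -/
theorem IsFrameBundle.isBundleGerbe [NeZero k] [IsTopologicalGroup Ĝ] [T2Space Ĝ]
    (hB : IsFrameBundle (N.part c) g.inner (g.sign c) G B) : IsBundleGerbe B E where
  nonempty x e₁ h₁ e₂ h₂ := by
    obtain ⟨a, ⟨ha, hae⟩, -⟩ := hB.transitive x e₁ h₁ e₂ h₂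
    obtain ⟨ψ, hψ⟩ := E.isOpenQuotientMap.surjective ⟨a, ha⟩
    refine ⟨ψ, ?_⟩
    change e₂ = frameMul e₁ (E.mat ψ)
    rw [CentralExtension.mat, hψ]
    exact hae
  torsor x e₁ h₁ e₂ h₂ ψ hψ := by
    have hle : B ≤ g.frames c := hB.orthonormal
    refine ⟨fun z => ?_, fun ψ' hψ' => ?_⟩
    · rw [CentralExtension.mem_Psi_iff hle h₁ h₂] at hψ ⊢
      rw [E.mat_mul, E.mat_inc, one_mul, hψ]
    · rw [CentralExtension.mem_Psi_iff hle h₁ h₂] at hψ hψ'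
      have h : ψ' * ψ⁻¹ ∈ E.inc.range := by
        rw [E.exact, MonoidHom.mem_ker, map_mul, map_inv,
          E.proj_eq_of_mat_eq (hψ'.trans hψ.symm), mul_inv_cancel]
      obtain ⟨z, hz⟩ := h
      refine ⟨z, by simp only [hz, inv_mul_cancel_right], fun z' hz' => E.inc_injective ?_⟩
      rw [hz, show ψ' = _ from hz', mul_inv_cancel_right]
  product x e₁ _ e₂ _ e₃ _ ψ hψ ψ' hψ' := by
    refine ⟨E.mul_mem_Psi hψ hψ', fun z z' => ?_⟩
    rw [map_mul, mul_assoc, ← mul_assoc ψ, ← E.central z' ψ]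
    simp only [mul_assoc]
  locallyTrivial _ _ _ _ h₁ h₂ _ hx _ hψ₀ := hB.exists_isLift h₁ h₂ hx hψ₀

end Gerbe

/-! ## Entrywise calculus of matrices -/

section Entries

variable {r : ℕ}

/-- Derivatives and smoothness of matrix-valued maps are expressed entry by entry. A linear map then
contributes only constant coefficients. -/
theorem Matrix.linearMap_apply_eq_sum {F : Type*} [AddCommGroup F] [Module ℝ F]
    (Λ : Matrix (Fin r) (Fin r) ℝ →ₗ[ℝ] F) (M : Matrix (Fin r) (Fin r) ℝ) :
    Λ M = ∑ i, ∑ j, M i j • Λ (Matrix.single i j 1) := by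
  conv_lhs => rw [Matrix.matrix_eq_sum_single M]
  simp only [map_sum]
  refine Finset.sum_congr rfl fun i _ => Finset.sum_congr rfl fun j _ => ?_
  rw [← map_smul, Matrix.smul_single, smul_eq_mul, mul_one]

variable {H F : Type*} [NormedAddCommGroup H] [NormedSpace ℝ H] [NormedAddCommGroup F]
  [NormedSpace ℝ F] {n : WithTop ℕ∞}

theorem HasDerivAt.matrix_linearMap {M : ℝ → Matrix (Fin r) (Fin r) ℝ}
    {M' : Matrix (Fin r) (Fin r) ℝ} {t : ℝ} (hM : ∀ i j, HasDerivAt (fun s => M s i j) (M' i j) t)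
    (Λ : Matrix (Fin r) (Fin r) ℝ →ₗ[ℝ] F) : HasDerivAt (fun s => Λ (M s)) (Λ M') t := by
  rw [Matrix.linearMap_apply_eq_sum Λ M', show (fun s => Λ (M s)) =
    fun s => ∑ i, ∑ j, M s i j • Λ (Matrix.single i j 1) from
    funext fun s => Matrix.linearMap_apply_eq_sum Λ (M s)]
  exact HasDerivAt.fun_sum fun i _ => HasDerivAt.fun_sum fun j _ => (hM i j).smul_const _

theorem HasDerivAt.matrix_mul {M N : ℝ → Matrix (Fin r) (Fin r) ℝ}
    {M' N' : Matrix (Fin r) (Fin r) ℝ} {t : ℝ} (hM : ∀ i j, HasDerivAt (fun s => M s i j) (M' i j) t)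
    (hN : ∀ i j, HasDerivAt (fun s => N s i j) (N' i j) t) (i j : Fin r) :
    HasDerivAt (fun s => (M s * N s) i j) ((M' * N t + M t * N') i j) t := by
  simp only [Matrix.mul_apply, Matrix.add_apply, ← Finset.sum_add_distrib]
  exact HasDerivAt.fun_sum fun l _ => (hM i l).mul (hN l j)

theorem ContDiffAt.matrix_mul {M N : H → Matrix (Fin r) (Fin r) ℝ} {y : H}
    (hM : ∀ i j, ContDiffAt ℝ n (fun z => M z i j) y)
    (hN : ∀ i j, ContDiffAt ℝ n (fun z => N z i j) y) (i j : Fin r) :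
    ContDiffAt ℝ n (fun z => (M z * N z) i j) y := by
  simp only [Matrix.mul_apply]
  exact ContDiffAt.sum fun l _ => (hM i l).mul (hN l j)

theorem ContDiffAt.matrix_det {M : H → Matrix (Fin r) (Fin r) ℝ} {y : H}
    (hM : ∀ i j, ContDiffAt ℝ n (fun z => M z i j) y) : ContDiffAt ℝ n (fun z => (M z).det) y := by
  simp only [Matrix.det_apply]
  exact ContDiffAt.sum fun σ _ => (contDiffAt_prod fun i _ => hM (σ i) i).const_smul _

theorem ContDiffAt.matrix_inv {M : H → Matrix (Fin r) (Fin r) ℝ} {y : H}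
    (hM : ∀ i j, ContDiffAt ℝ n (fun z => M z i j) y) (h : (M y).det ≠ 0) (i j : Fin r) :
    ContDiffAt ℝ n (fun z => (M z)⁻¹ i j) y := by
  have : ∀ z, (M z)⁻¹ i j = (M z).det⁻¹ * ((M z).updateRow j (Pi.single i 1)).det := fun z => by
    rw [Matrix.inv_def, Ring.inverse_eq_inv', Matrix.smul_apply, Matrix.adjugate_apply, smul_eq_mul]
  simp only [this]
  refine ((ContDiffAt.matrix_det hM).inv h).mul (ContDiffAt.matrix_det fun a b => ?_)
  by_cases ha : a = j
  · subst ha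
    simp only [Matrix.updateRow_self]
    exact contDiffAt_const
  · simp only [Matrix.updateRow_ne ha]
    exact hM a b

end Entries

/-! ## The Cayley transform -/

section Cayley

variable {r : ℕ} {η : Fin r → ℤˣ}

/-- The Cayley transform. -/
noncomputable def cayley (ζ : Matrix (Fin r) (Fin r) ℝ) : Matrix (Fin r) (Fin r) ℝ :=
  (1 + (1 / 2 : ℝ) • ζ) * (1 - (1 / 2 : ℝ) • ζ)⁻¹

/-- The inverse of the Cayley transform. -/
noncomputable def cayleyInv (a : Matrix (Fin r) (Fin r) ℝ) : Matrix (Fin r) (Fin r) ℝ :=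
  (2 : ℝ) • ((a - 1) * (a + 1)⁻¹)

theorem mem_pseudoOrthogonalLie_iff {ξ : Matrix (Fin r) (Fin r) ℝ} :
    ξ ∈ pseudoOrthogonalLie η ↔ ξ.transpose * Matrix.diagonal (fun i => ((η i : ℤ) : ℝ))
      = -(Matrix.diagonal (fun i => ((η i : ℤ) : ℝ)) * ξ) := by
  rw [mem_skewAdjointMatricesSubmodule, Matrix.IsSkewAdjoint, Matrix.IsAdjointPair,
    Matrix.mul_neg]

theorem cayley_mul {ζ : Matrix (Fin r) (Fin r) ℝ} (h : (1 - (1 / 2 : ℝ) • ζ).det ≠ 0) :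
    cayley ζ * (1 - (1 / 2 : ℝ) • ζ) = 1 + (1 / 2 : ℝ) • ζ := by
  rw [cayley, Matrix.mul_assoc, Matrix.nonsing_inv_mul _ (isUnit_iff_ne_zero.2 h), Matrix.mul_one]

theorem cayleyInv_mul {a : Matrix (Fin r) (Fin r) ℝ} (h : (a + 1).det ≠ 0) :
    cayleyInv a * (a + 1) = (2 : ℝ) • (a - 1) := by
  rw [cayleyInv, Matrix.smul_mul, Matrix.mul_assoc, Matrix.nonsing_inv_mul _
    (isUnit_iff_ne_zero.2 h), Matrix.mul_one]

/-- Put p = 1 + ζ/2 and w = 1 - ζ/2. Skewness of ζ means that the adjoint with respect to `J`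
exchanges p and w; as these commute, p w⁻¹ preserves `J`. The factor 1/2 makes the derivative of the
transform at 0 the identity. -/
theorem exists_pseudoOrthogonal_cayley {ζ : Matrix (Fin r) (Fin r) ℝ}
    (hζ : ζ ∈ pseudoOrthogonalLie η) (h : (1 - (1 / 2 : ℝ) • ζ).det ≠ 0) :
    ∃ a ∈ pseudoOrthogonal η, (a : Matrix (Fin r) (Fin r) ℝ) = cayley ζ := by
  refine exists_pseudoOrthogonal_of_eq ?_
  rw [mem_pseudoOrthogonalLie_iff] at hζ
  set J := Matrix.diagonal (fun i => ((η i : ℤ) : ℝ)) with hJ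
  set p := 1 + (1 / 2 : ℝ) • ζ with hp
  set w := 1 - (1 / 2 : ℝ) • ζ with hw
  have hc := cayley_mul h
  have hwu : IsUnit w := (Matrix.isUnit_iff_isUnit_det _).2 (isUnit_iff_ne_zero.2 h)
  have hwt : IsUnit w.transpose := by
    rw [Matrix.isUnit_iff_isUnit_det, Matrix.det_transpose]
    exact isUnit_iff_ne_zero.2 h
  have h1 : p.transpose * J = J * w := by
    simp only [hp, hw, Matrix.transpose_add, Matrix.transpose_one, Matrix.transpose_smul,
      Matrix.add_mul, Matrix.one_mul, Matrix.smul_mul, hζ, smul_neg, sub_eq_add_neg, Matrix.mul_add,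
      Matrix.mul_neg, Matrix.mul_one, Matrix.mul_smul]
  have h2 : w.transpose * J = J * p := by
    simp only [hp, hw, Matrix.transpose_sub, Matrix.transpose_one, Matrix.transpose_smul,
      Matrix.sub_mul, Matrix.mul_add, Matrix.one_mul, Matrix.mul_one, Matrix.smul_mul,
      Matrix.mul_smul, hζ, smul_neg, sub_neg_eq_add]
  have h3 : w * p = p * w := by
    simp only [hp, hw, Matrix.sub_mul, Matrix.mul_add, Matrix.add_mul, Matrix.mul_sub,
      Matrix.one_mul, Matrix.mul_one]
    abel
  refine hwt.mul_left_cancel (hwu.mul_right_cancel ?_)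
  calc w.transpose * ((cayley ζ).transpose * J * cayley ζ) * w
      = (cayley ζ * w).transpose * J * (cayley ζ * w) := by
        rw [Matrix.transpose_mul]; simp only [Matrix.mul_assoc]
    _ = w.transpose * J * w := by
        rw [hc, h1, h2, Matrix.mul_assoc, Matrix.mul_assoc, h3]

/-- Multiplied by (a + 1)ᵀ on the left and by a + 1 on the right, the skewness becomes a polynomial
identity that follows from aᵀ J a = J. -/
theorem cayleyInv_mem {a : Matrix.GeneralLinearGroup (Fin r) ℝ} (ha : a ∈ pseudoOrthogonal η)
    (h : ((a : Matrix (Fin r) (Fin r) ℝ) + 1).det ≠ 0) :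
    cayleyInv (a : Matrix (Fin r) (Fin r) ℝ) ∈ pseudoOrthogonalLie η := by
  rw [mem_pseudoOrthogonal_iff] at ha
  rw [mem_pseudoOrthogonalLie_iff]
  set J := Matrix.diagonal (fun i => ((η i : ℤ) : ℝ)) with hJ
  set b : Matrix (Fin r) (Fin r) ℝ := a.val
  have hw : IsUnit (b + 1) := (Matrix.isUnit_iff_isUnit_det _).2 (isUnit_iff_ne_zero.2 h)
  have hwt : IsUnit (b + 1).transpose := by
    rw [Matrix.isUnit_iff_isUnit_det, Matrix.det_transpose]
    exact isUnit_iff_ne_zero.2 h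
  have hc := cayleyInv_mul h
  refine hwt.mul_left_cancel (hw.mul_right_cancel ?_)
  calc (b + 1).transpose * ((cayleyInv b).transpose * J) * (b + 1)
      = (cayleyInv b * (b + 1)).transpose * J * (b + 1) := by
        rw [Matrix.transpose_mul]; simp only [Matrix.mul_assoc]
    _ = -((b + 1).transpose * J * (cayleyInv b * (b + 1))) := by
        rw [hc]
        simp only [Matrix.transpose_smul, Matrix.transpose_sub, Matrix.transpose_add,
          Matrix.transpose_one, Matrix.smul_mul, Matrix.mul_smul, Matrix.sub_mul, Matrix.add_mul,
          Matrix.mul_add, Matrix.mul_sub, Matrix.one_mul, Matrix.mul_one, ha, smul_sub, smul_add]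
        abel
    _ = _ := by simp only [Matrix.mul_neg, Matrix.neg_mul, Matrix.mul_assoc]

theorem cayley_cayleyInv {a : Matrix (Fin r) (Fin r) ℝ} (h : (a + 1).det ≠ 0)
    (h' : (1 - (1 / 2 : ℝ) • cayleyInv a).det ≠ 0) : cayley (cayleyInv a) = a := by
  have hw : IsUnit (1 - (1 / 2 : ℝ) • cayleyInv a) :=
    (Matrix.isUnit_iff_isUnit_det _).2 (isUnit_iff_ne_zero.2 h')
  have ha : IsUnit (a + 1) := (Matrix.isUnit_iff_isUnit_det _).2 (isUnit_iff_ne_zero.2 h)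
  refine hw.mul_right_cancel (ha.mul_right_cancel ?_)
  rw [cayley_mul h', Matrix.mul_assoc, Matrix.add_mul, Matrix.sub_mul, Matrix.smul_mul,
    cayleyInv_mul h, smul_smul]
  rw [show (1 / 2 : ℝ) * 2 = 1 by norm_num, one_smul, Matrix.one_mul,
    show a + 1 - (a - 1) = 1 + 1 by abel, Matrix.mul_add, Matrix.mul_one]
  abel

theorem cayley_zero : cayley (0 : Matrix (Fin r) (Fin r) ℝ) = 1 := by simp [cayley]

theorem cayleyInv_one : cayleyInv (1 : Matrix (Fin r) (Fin r) ℝ) = 0 := by simp [cayleyInv]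

theorem det_one_add_one_ne_zero : ((1 : Matrix (Fin r) (Fin r) ℝ) + 1).det ≠ 0 := by
  rw [← two_smul ℝ (1 : Matrix (Fin r) (Fin r) ℝ), Matrix.det_smul, Matrix.det_one, mul_one]
  positivity

end Cayley

/-! ## The differential of a representation of `Ĝ` -/

section Differential

variable {r k : ℕ} [NeZero k] {η : Fin r → ℤˣ}
  {G : Subgroup (Matrix.GeneralLinearGroup (Fin r) ℝ)}
  {Ĝ : Type*} [Group Ĝ] [TopologicalSpace Ĝ] [IsTopologicalGroup Ĝ] [T2Space Ĝ]
  {E : CentralExtension k G Ĝ}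

theorem contDiff_linearEquiv_entry {l : ℕ}
    (T : EuclideanSpace ℝ (Fin l) ≃ₗ[ℝ] pseudoOrthogonalLie η) (i j : Fin r) :
    ContDiff ℝ ∞ fun y => (T y : Matrix (Fin r) (Fin r) ℝ) i j :=
  (LinearMap.toContinuousLinearMap ((Matrix.entryLinearMap ℝ ℝ i j).comp
    ((pseudoOrthogonalLie η).subtype.comp T.toLinearMap))).contDiff

theorem contDiffAt_half_smul {H : Type*} [NormedAddCommGroup H] [NormedSpace ℝ H] {n : WithTop ℕ∞}
    {M : H → Matrix (Fin r) (Fin r) ℝ} {y : H} (s : ℝ)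
    (hM : ∀ i j, ContDiffAt ℝ n (fun z => M z i j) y) (i j : Fin r) :
    ContDiffAt ℝ n (fun z => (1 + s • M z) i j) y := by
  simp only [Matrix.add_apply, Matrix.smul_apply, smul_eq_mul]
  exact contDiffAt_const.add (contDiffAt_const.mul (hM i j))

theorem contDiffAt_cayley {H : Type*} [NormedAddCommGroup H] [NormedSpace ℝ H] {n : WithTop ℕ∞}
    {M : H → Matrix (Fin r) (Fin r) ℝ} {y : H}
    (hM : ∀ i j, ContDiffAt ℝ n (fun z => M z i j) y) (h : (1 - (1 / 2 : ℝ) • M y).det ≠ 0)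
    (i j : Fin r) : ContDiffAt ℝ n (fun z => cayley (M z) i j) y := by
  refine ContDiffAt.matrix_mul (contDiffAt_half_smul _ hM) (ContDiffAt.matrix_inv ?_ h) i j
  simp only [sub_eq_add_neg, ← neg_smul]
  exact contDiffAt_half_smul _ hM

/-- The Cayley chart of `Ĝ` at `1`. -/
theorem CentralExtension.exists_chart (E : CentralExtension k G Ĝ)
    (hopen : ∀ᶠ a in 𝓝 (1 : Matrix.GeneralLinearGroup (Fin r) ℝ), a ∈ pseudoOrthogonal η → a ∈ G)
    {l : ℕ} (T : EuclideanSpace ℝ (Fin l) ≃ₗ[ℝ] pseudoOrthogonalLie η) :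
    ∃ (O : Set (EuclideanSpace ℝ (Fin l))) (f : EuclideanSpace ℝ (Fin l) → Ĝ),
      IsOpen O ∧ 0 ∈ O ∧ ContinuousOn f O ∧ f 0 = 1 ∧
      ∀ y ∈ O, (1 - (1 / 2 : ℝ) • (T y : Matrix (Fin r) (Fin r) ℝ)).det ≠ 0 ∧
        E.mat (f y) = cayley (T y) := by
  set O₁ : Set (EuclideanSpace ℝ (Fin l)) :=
    {y | (1 - (1 / 2 : ℝ) • (T y : Matrix (Fin r) (Fin r) ℝ)).det ≠ 0} with hO₁
  have hT : ∀ y, ∀ i j, ContDiffAt ℝ ∞ (fun y => (T y : Matrix (Fin r) (Fin r) ℝ) i j) y :=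
    fun y i j => (contDiff_linearEquiv_entry T i j).contDiffAt
  have hdet : Continuous fun y => (1 - (1 / 2 : ℝ) • (T y : Matrix (Fin r) (Fin r) ℝ)).det := by
    refine continuous_iff_continuousAt.2 fun y => (ContDiffAt.matrix_det (n := ∞) ?_).continuousAt
    simp only [sub_eq_add_neg, ← neg_smul]
    exact contDiffAt_half_smul _ (hT y)
  have hO₁o : IsOpen O₁ := isOpen_ne_fun hdet continuous_const
  have hc : ∀ i j, ContinuousOn (fun y => cayley (T y : Matrix (Fin r) (Fin r) ℝ) i j) O₁ :=
    fun i j y hy => (contDiffAt_cayley (hT y) hy i j).continuousAt.continuousWithinAt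
  obtain ⟨τ, hτ, hτm⟩ := exists_continuousOn_subgroup (pseudoOrthogonal η) hc
    fun y hy => exists_pseudoOrthogonal_cayley (T y).2 hy
  -- In the neighbourhood `S` of 1 the subgroup `G` exhausts the pseudo-orthogonal group. Where the
  -- Cayley transform lies in `S` it has values in `G`, and can be lifted to Ĝ.
  obtain ⟨S, hS, hSo, h1S⟩ := eventually_nhds_iff.1 hopen
  have h0 : (0 : EuclideanSpace ℝ (Fin l)) ∈ O₁ := by simp [hO₁]
  have hτ0 : ((τ 0 : pseudoOrthogonal η) : Matrix.GeneralLinearGroup (Fin r) ℝ) = 1 :=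
    Units.ext (by rw [hτm 0 h0]; simp [cayley_zero])
  have hO₂ : IsOpen (O₁ ∩ (fun y => (τ y : Matrix.GeneralLinearGroup (Fin r) ℝ)) ⁻¹' S) :=
    (continuous_subtype_val.comp_continuousOn hτ).isOpen_inter_preimage hO₁o hSo
  obtain ⟨O, f, hO, h0O, hOs, hf, hmat, hf0⟩ := E.exists_lift hO₂
    (fun i j => (hc i j).mono Set.inter_subset_left)
    (fun y hy => ⟨_, hS _ hy.2 (τ y).2, hτm y hy.1⟩) (x₀ := 0) ⟨h0, by
      rw [Set.mem_preimage, hτ0]; exact h1S⟩ (ψ₀ := 1) (by simp [E.mat_one, cayley_zero])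
  exact ⟨O, f, hO, h0O, hf, hf0, fun y hy => ⟨(hOs hy).1, hmat y hy⟩⟩

theorem exists_linearEquiv_pseudoOrthogonalLie (η : Fin r → ℤˣ) :
    ∃ l, Nonempty (EuclideanSpace ℝ (Fin l) ≃ₗ[ℝ] pseudoOrthogonalLie η) :=
  ⟨Module.finrank ℝ (pseudoOrthogonalLie η),
    ⟨(EuclideanSpace.equiv _ ℝ).toLinearEquiv.trans (Module.finBasis ℝ _).equivFun.symm⟩⟩

/-- Differentiating the relation at a point where M = 1 and N = 0 gives M' - N'/2 = N'/2: a curve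
through 1 and its Cayley coordinate have the same velocity. -/
theorem hasDerivAt_zero_of_cayley {M N : ℝ → Matrix (Fin r) (Fin r) ℝ} {t : ℝ}
    {M' N' : Matrix (Fin r) (Fin r) ℝ} (hM : ∀ i j, HasDerivAt (fun s => M s i j) (M' i j) t)
    (hN : ∀ i j, HasDerivAt (fun s => N s i j) (N' i j) t) (hN0 : N t = 0) (hM1 : M t = 1)
    (h : ∀ᶠ s in 𝓝 t, M s * (1 - (1 / 2 : ℝ) • N s) = 1 + (1 / 2 : ℝ) • N s) : M' = N' := by
  have h1 : ∀ a : ℝ, ∀ i j, HasDerivAt (fun s => (1 + a • N s) i j) ((a • N') i j) t := fun a i j => by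
    simp only [Matrix.add_apply, Matrix.smul_apply, smul_eq_mul]
    exact ((hN i j).const_mul a).const_add _
  have h2 := fun i j => HasDerivAt.matrix_mul hM (h1 (-(1 / 2))) i j
  ext i j
  have h3 := (h2 i j).unique ((h1 (1 / 2) i j).congr_of_eventuallyEq (h.mono fun s hs => by
    simp only [neg_smul, ← sub_eq_add_neg, hs]))
  rw [hN0, hM1] at h3
  simp at h3
  linarith

theorem CentralExtension.contDiffOn_chart {l : ℕ}
    {T : EuclideanSpace ℝ (Fin l) ≃ₗ[ℝ] pseudoOrthogonalLie η}
    {O : Set (EuclideanSpace ℝ (Fin l))} {f : EuclideanSpace ℝ (Fin l) → Ĝ}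
    (h : ∀ y ∈ O, (1 - (1 / 2 : ℝ) • (T y : Matrix (Fin r) (Fin r) ℝ)).det ≠ 0 ∧
        E.mat (f y) = cayley (T y)) (i j : Fin r) :
    ContDiffOn ℝ ∞ (fun y => E.mat (f y) i j) O := by
  refine ContDiffOn.congr (f := fun y => cayley (T y : Matrix (Fin r) (Fin r) ℝ) i j)
    (fun y hy => ?_) fun y hy => by rw [(h y hy).2]
  exact (contDiffAt_cayley (fun i j => (contDiff_linearEquiv_entry T i j).contDiffAt)
    (h y hy).1 i j).contDiffWithinAt

/-- There are smooth curves in `Ĝ` with arbitrary velocity at `1`. -/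
theorem CentralExtension.exists_curve (E : CentralExtension k G Ĝ)
    (hopen : ∀ᶠ a in 𝓝 (1 : Matrix.GeneralLinearGroup (Fin r) ℝ), a ∈ pseudoOrthogonal η → a ∈ G)
    (ξ : pseudoOrthogonalLie η) :
    ∃ γ : ℝ → Ĝ, Continuous γ ∧ γ 0 = 1 ∧ (∀ i j, ContDiff ℝ ∞ fun t => E.mat (γ t) i j) ∧
      ∀ i j, HasDerivAt (fun t => E.mat (γ t) i j) ((ξ : Matrix (Fin r) (Fin r) ℝ) i j) 0 := by
  obtain ⟨l, ⟨T⟩⟩ := exists_linearEquiv_pseudoOrthogonalLie η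
  obtain ⟨O, f, hO, h0, hf, hf0, hOf⟩ := E.exists_chart hopen T
  obtain ⟨δ, hδ, hball⟩ := Metric.isOpen_iff.1 hO 0 h0
  set y₁ := T.symm ξ with hy₁
  set ε := δ / (‖y₁‖ + 1) with hε
  have hy : 0 < ‖y₁‖ + 1 := by positivity
  have hε0 : 0 < ε := div_pos hδ hy
  -- A curve defined for all times is required, but the chart only contains a ball. The function ε
  -- sin(t/ε) has derivative 1 at 0 and is bounded by ε, which is small enough to keep its multiples
  -- of `y₁` in the ball.
  set χ : ℝ → ℝ := fun t => ε * Real.sin (t / ε) with hχ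
  have hχs : ContDiff ℝ ∞ χ := contDiff_const.mul (Real.contDiff_sin.comp (contDiff_id.div_const _))
  have hχ0 : χ 0 = 0 := by simp [hχ]
  have hχd : HasDerivAt χ 1 0 := by
    have h := (((Real.hasDerivAt_sin (0 / ε)).comp 0 ((hasDerivAt_id (0 : ℝ)).div_const ε)).const_mul ε)
    have h' : ε * (Real.cos (0 / ε) * (1 / ε)) = 1 := by
      rw [zero_div, Real.cos_zero]; field_simp
    rw [h'] at h
    exact h
  have hmem : ∀ t, χ t • y₁ ∈ O := fun t => hball (by
    rw [mem_ball_zero_iff, norm_smul, Real.norm_eq_abs, hχ, abs_mul, abs_of_pos hε0]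
    calc ε * |Real.sin (t / ε)| * ‖y₁‖ ≤ ε * 1 * ‖y₁‖ := by
          gcongr; exact Real.abs_sin_le_one _
      _ < ε * (‖y₁‖ + 1) := by nlinarith
      _ = δ := by rw [hε]; field_simp)
  have hsm : ContDiff ℝ ∞ fun t => χ t • y₁ := hχs.smul contDiff_const
  have hcd : ∀ i j, ContDiff ℝ ∞ fun t => E.mat (f (χ t • y₁)) i j := fun i j =>
    contDiffOn_univ.1 ((CentralExtension.contDiffOn_chart hOf i j).comp hsm.contDiffOn
      fun t _ => hmem t)
  have hT : ∀ t, (T (χ t • y₁) : Matrix (Fin r) (Fin r) ℝ) = χ t • (ξ : Matrix (Fin r) (Fin r) ℝ) :=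
    fun t => by rw [map_smul, hy₁, T.apply_symm_apply]; rfl
  refine ⟨fun t => f (χ t • y₁), hf.comp_continuous hsm.continuous hmem, by simp [hχ0, hf0], hcd, ?_⟩
  have hd : ∀ i j, HasDerivAt (fun t => E.mat (f (χ t • y₁)) i j)
      (Matrix.of (fun i j => deriv (fun t => E.mat (f (χ t • y₁)) i j) 0) i j) 0 := fun i j =>
    ((hcd i j).differentiable (by simp)).differentiableAt.hasDerivAt
  have hkey := hasDerivAt_zero_of_cayley hd
    (N := fun t => χ t • (ξ : Matrix (Fin r) (Fin r) ℝ)) (N' := ξ)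
    (fun i j => by simpa using hχd.mul_const ((ξ : Matrix (Fin r) (Fin r) ℝ) i j))
    (by simp [hχ0]) (by simp [hχ0, hf0, E.mat_one]) (Filter.Eventually.of_forall fun t => by
      have h := hOf _ (hmem t)
      rw [hT] at h
      rw [h.2, cayley_mul h.1])
  rw [hkey] at hd
  exact hd

variable {q : ℤ} {v : Type*} [NormedAddCommGroup v] [NormedSpace ℂ v]

/-- `L` is the derivative of ρ at the origin of the Cayley chart. A curve through 1 agrees, near
that time, with the chart applied to its Cayley coordinate: both have the same matrices, and the
covering is locally injective. The chain rule concludes. Only C¹ regularity at the time `t` is asked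
for, because the curves that come from lifts over V are merely local. -/
theorem WeightRep.exists_hasDerivAt (R : WeightRep E q v) (hle : G ≤ pseudoOrthogonal η)
    (hopen : ∀ᶠ a in 𝓝 (1 : Matrix.GeneralLinearGroup (Fin r) ℝ), a ∈ pseudoOrthogonal η → a ∈ G) :
    ∃ L : pseudoOrthogonalLie η →ₗ[ℝ] (v →L[ℂ] v), ∀ (ξ : pseudoOrthogonalLie η) (γ : ℝ → Ĝ) (t : ℝ),
      ContinuousAt γ t → γ t = 1 → (∀ i j, ContDiffAt ℝ 1 (fun s => E.mat (γ s) i j) t) →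
      (∀ i j, deriv (fun s => E.mat (γ s) i j) t = (ξ : Matrix (Fin r) (Fin r) ℝ) i j) →
      HasDerivAt (fun s => R.ρ (γ s)) (L ξ) t := by
  obtain ⟨l, ⟨T⟩⟩ := exists_linearEquiv_pseudoOrthogonalLie η
  obtain ⟨O, f, hO, h0, hf, hf0, hOf⟩ := E.exists_chart hopen T
  have hρ := R.smooth l O f hO hf (CentralExtension.contDiffOn_chart hOf)
  have hρ0 : HasFDerivAt (fun y => R.ρ (f y)) (fderiv ℝ (fun y => R.ρ (f y)) 0) 0 :=
    ((hρ.contDiffAt (hO.mem_nhds h0)).differentiableAt (by simp)).hasFDerivAt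
  refine ⟨(fderiv ℝ (fun y => R.ρ (f y)) 0).toLinearMap.comp T.symm.toLinearMap,
    fun ξ γ t hγ hγ1 hγs hγd => ?_⟩
  -- The inverse Cayley transform is known to lie in the Lie algebra only near `t`; the projection
  -- `P` makes the coordinate `y` defined at all times.
  obtain ⟨P, hP⟩ := LinearMap.exists_leftInverse_of_injective (pseudoOrthogonalLie η).subtype
    (Submodule.ker_subtype _)
  set N : ℝ → Matrix (Fin r) (Fin r) ℝ := fun s => cayleyInv (E.mat (γ s)) with hN
  have hN0 : N t = 0 := by simp only [hN, hγ1, E.mat_one, cayleyInv_one]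
  have hadd : ∀ a : ℝ, ∀ i j, ContDiffAt ℝ 1 (fun s => (E.mat (γ s) + a • 1) i j) t := fun a i j => by
    simp only [Matrix.add_apply]
    exact (hγs i j).add contDiffAt_const
  have hNs : ∀ i j, ContDiffAt ℝ 1 (fun s => N s i j) t := fun i j => by
    simp only [hN, cayleyInv, Matrix.smul_apply, smul_eq_mul]
    refine contDiffAt_const.mul (ContDiffAt.matrix_mul ?_ (ContDiffAt.matrix_inv ?_ ?_) i j)
    · simpa [sub_eq_add_neg] using hadd (-1)
    · simpa using hadd 1
    · rw [hγ1, E.mat_one]; exact det_one_add_one_ne_zero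
  have hNd : ∀ i j, HasDerivAt (fun s => N s i j)
      (Matrix.of (fun i j => deriv (fun s => N s i j) t) i j) t := fun i j =>
    ((hNs i j).differentiableAt (by simp)).hasDerivAt
  have hMd : ∀ i j, HasDerivAt (fun s => E.mat (γ s) i j) ((ξ : Matrix (Fin r) (Fin r) ℝ) i j) t :=
    fun i j => by
      rw [← hγd i j]
      exact ((hγs i j).differentiableAt (by simp)).hasDerivAt
  have hdet1 : ∀ᶠ s in 𝓝 t, (E.mat (γ s) + 1).det ≠ 0 := by
    have : ContinuousAt (fun s => (E.mat (γ s) + 1).det) t :=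
      (ContDiffAt.matrix_det (n := 1) (by simpa using hadd 1)).continuousAt
    exact this.eventually_ne (by rw [hγ1, E.mat_one]; exact det_one_add_one_ne_zero)
  have hdet2 : ∀ᶠ s in 𝓝 t, (1 - (1 / 2 : ℝ) • N s).det ≠ 0 := by
    have : ContinuousAt (fun s => (1 - (1 / 2 : ℝ) • N s).det) t := by
      refine (ContDiffAt.matrix_det (n := 1) ?_).continuousAt
      simp only [sub_eq_add_neg, ← neg_smul]
      exact contDiffAt_half_smul _ hNs
    exact this.eventually_ne (by rw [hN0]; simp)
  have hkey := hasDerivAt_zero_of_cayley hMd hNd hN0 (by rw [hγ1, E.mat_one]) (by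
    filter_upwards [hdet1, hdet2] with s h1 h2
    rw [← cayley_mul h2, hN, cayley_cayleyInv h1 h2])
  rw [← hkey] at hNd
  set y : ℝ → EuclideanSpace ℝ (Fin l) := fun s => T.symm (P (N s)) with hy
  have hyd : HasDerivAt y (T.symm ξ) t := by
    have h := HasDerivAt.matrix_linearMap hNd (T.symm.toLinearMap.comp P)
    have h' : P (ξ : Matrix (Fin r) (Fin r) ℝ) = ξ := LinearMap.congr_fun hP ξ
    simp only [LinearMap.comp_apply, h'] at h
    exact h
  have hy0 : y t = 0 := by simp only [hy, hN0, map_zero]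
  obtain ⟨S, hS, hinj⟩ := E.exists_nhds_injOn_mat 1
  have hyO : ∀ᶠ s in 𝓝 t, y s ∈ O :=
    hyd.continuousAt.eventually (by rw [hy0]; exact hO.mem_nhds h0)
  have hfy : ∀ᶠ s in 𝓝 t, f (y s) ∈ S := by
    have h1 : ContinuousAt (fun s => f (y s)) t :=
      ContinuousAt.comp (g := f) (by rw [hy0]; exact hf.continuousAt (hO.mem_nhds h0))
        hyd.continuousAt
    refine h1.eventually ?_
    change S ∈ 𝓝 (f (y t))
    rw [hy0, hf0]
    exact hS
  have heq : ∀ᶠ s in 𝓝 t, R.ρ (γ s) = R.ρ (f (y s)) := by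
    filter_upwards [hdet1, hdet2, hyO, hfy, hγ.eventually (by rw [hγ1]; exact hS)]
      with s h1 h2 h3 h4 h5
    refine congrArg R.ρ (hinj h5 h4 ?_)
    have hmem : N s ∈ pseudoOrthogonalLie η := cayleyInv_mem (hle (E.proj (γ s)).2) h1
    have hPN : P (N s) = ⟨N s, hmem⟩ := LinearMap.congr_fun hP ⟨N s, hmem⟩
    rw [(hOf _ h3).2, hy, T.apply_symm_apply, hPN]
    exact (cayley_cayleyInv h1 h2).symm
  have hρ1 : HasFDerivAt (fun y => R.ρ (f y)) (fderiv ℝ (fun y => R.ρ (f y)) 0) (y t) := by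
    rw [hy0]; exact hρ0
  exact (hρ1.comp_hasDerivAt t hyd).congr_of_eventuallyEq heq

variable {R : WeightRep E q v} {L : pseudoOrthogonalLie η →ₗ[ℝ] (v →L[ℂ] v)}

/-- Every velocity is realized by a curve on which both differentials are tested. -/
theorem WeightRep.IsDifferential.unique (hL : R.IsDifferential L)
    (hopen : ∀ᶠ a in 𝓝 (1 : Matrix.GeneralLinearGroup (Fin r) ℝ), a ∈ pseudoOrthogonal η → a ∈ G)
    {L' : pseudoOrthogonalLie η →ₗ[ℝ] (v →L[ℂ] v)} (hL' : R.IsDifferential L') : L' = L := by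
  ext1 ξ
  obtain ⟨γ, h1, h2, h3, h4⟩ := E.exists_curve hopen ξ
  exact (hL' ξ γ h1 h2 h3 fun i j => (h4 i j).deriv).unique
    (hL ξ γ h1 h2 h3 fun i j => (h4 i j).deriv)

theorem WeightRep.exists_isDifferential (R : WeightRep E q v) (hle : G ≤ pseudoOrthogonal η)
    (hopen : ∀ᶠ a in 𝓝 (1 : Matrix.GeneralLinearGroup (Fin r) ℝ), a ∈ pseudoOrthogonal η → a ∈ G) :
    ∃ L : pseudoOrthogonalLie η →ₗ[ℝ] (v →L[ℂ] v), R.IsDifferential L := by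
  obtain ⟨L, hL⟩ := R.exists_hasDerivAt hle hopen
  exact ⟨L, fun ξ γ h1 h2 h3 h4 => hL ξ γ 0 h1.continuousAt h2
    (fun i j => ((h3 i j).of_le (by simp)).contDiffAt) h4⟩

/-- `IsDifferential` only tests global smooth curves at time 0. By uniqueness `L` is the
differential constructed above, which also handles local C¹ curves at any time. -/
theorem WeightRep.IsDifferential.hasDerivAt (hL : R.IsDifferential L)
    (hle : G ≤ pseudoOrthogonal η)
    (hopen : ∀ᶠ a in 𝓝 (1 : Matrix.GeneralLinearGroup (Fin r) ℝ), a ∈ pseudoOrthogonal η → a ∈ G)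
    (ξ : pseudoOrthogonalLie η) {γ : ℝ → Ĝ} {t : ℝ} (h1 : ContinuousAt γ t) (h2 : γ t = 1)
    (h3 : ∀ i j, ContDiffAt ℝ 1 (fun s => E.mat (γ s) i j) t)
    (h4 : ∀ i j, deriv (fun s => E.mat (γ s) i j) t = (ξ : Matrix (Fin r) (Fin r) ℝ) i j) :
    HasDerivAt (fun s => R.ρ (γ s)) (L ξ) t := by
  obtain ⟨L', hL'⟩ := R.exists_hasDerivAt hle hopen
  have hd : R.IsDifferential L' := fun ξ γ h1 h2 h3 h4 => hL' ξ γ 0 h1.continuousAt h2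
    (fun i j => ((h3 i j).of_le (by simp)).contDiffAt) h4
  rw [← hL.unique hopen hd]
  exact hL' ξ γ t h1 h2 h3 h4

end Differential

/-! ## Vector fields and `1`-forms in charts -/

section Fields

variable {d : ℕ} {V : Type u} [TopologicalSpace V] [ChartedSpace (EuclideanSpace ℝ (Fin d)) V]
  [IsManifold (𝓡 d) ∞ V]
variable {F : Type*} [NormedAddCommGroup F] [NormedSpace ℝ F]

theorem trivializationAt_snd {x₀ x : V} (hx : x ∈ (extChartAt (𝓡 d) x₀).source)
    (X : TangentSpace (𝓡 d) x) :
    (trivializationAt (EuclideanSpace ℝ (Fin d)) (TangentSpace (𝓡 d)) x₀ ⟨x, X⟩).2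
      = chartD x₀ x X := by
  have := isManifold_one d V
  rw [extChartAt_source] at hx
  have h := TangentBundle.continuousLinearMapAt_trivializationAt (I := 𝓡 d) hx
  have hb : x ∈ (trivializationAt (EuclideanSpace ℝ (Fin d)) (TangentSpace (𝓡 d)) x₀).baseSet := by
    simpa using hx
  unfold chartD
  rw [← h]
  exact (Bundle.Trivialization.continuousLinearMapAt_apply_of_mem (R := ℝ) _ hb X).symm

theorem SmoothField.contMDiffOn_chartD {X : ∀ x : V, TangentSpace (𝓡 d) x} (hX : SmoothField X)
    (x₀ : V) : ContMDiffOn (𝓡 d) 𝓘(ℝ, EuclideanSpace ℝ (Fin d)) ∞ (fun x => chartD x₀ x (X x))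
      (extChartAt (𝓡 d) x₀).source := by
  have hb : (extChartAt (𝓡 d) x₀).source
      ⊆ (trivializationAt (EuclideanSpace ℝ (Fin d)) (TangentSpace (𝓡 d)) x₀).baseSet := by simp
  refine (((Bundle.Trivialization.contMDiffOn_section_iff _ (isOpen_extChartAt_source x₀) hb).1
    hX.contMDiffOn)).congr fun x hx => (trivializationAt_snd hx _).symm

/-- The coordinate vector fields of a chart. -/
theorem exists_coordField (x₀ : V) (u : EuclideanSpace ℝ (Fin d)) :
    ∃ X : ∀ x : V, TangentSpace (𝓡 d) x,
      ContMDiffOn (𝓡 d) (𝓡 d).tangent ∞ (T% X) (extChartAt (𝓡 d) x₀).source ∧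
      ∀ y ∈ (extChartAt (𝓡 d) x₀).target,
        X ((extChartAt (𝓡 d) x₀).symm y) = chartDSymm x₀ y u := by
  set e := trivializationAt (EuclideanSpace ℝ (Fin d)) (TangentSpace (𝓡 d) : V → Type) x₀ with he
  have hb : (extChartAt (𝓡 d) x₀).source ⊆ e.baseSet := by simp [he]
  refine ⟨fun x => e.symm x u, ?_, fun y hy => ?_⟩
  · refine (Bundle.Trivialization.contMDiffOn_section_iff e (isOpen_extChartAt_source x₀) hb).2
      ((contMDiffOn_const (c := u)).congr fun x hx => ?_)
    rw [e.apply_mk_symm (hb hx)]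
  · have hs := (extChartAt (𝓡 d) x₀).map_target hy
    have h : e ⟨_, chartDSymm x₀ y u⟩ = ((extChartAt (𝓡 d) x₀).symm y, u) :=
      Prod.ext (e.coe_fst (by rw [e.mem_source]; exact hb hs))
        ((trivializationAt_snd hs _).trans (chartD_chartDSymm hy u))
    have h2 := e.symm_apply_apply_mk (hb hs) (chartDSymm x₀ y u)
    rw [h] at h2
    exact h2

/-- The coordinate fields of a chart, cut off to global fields, span all directions near a given
point. -/
theorem DForm.smoothOn_of_smoothField [T2Space V] [FiniteDimensional ℝ F] {α : DForm d V 1 F}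
    {U : Set V}
    (h : ∀ X, SmoothField (d := d) X → ContMDiffOn (𝓡 d) 𝓘(ℝ, F) ∞ (fun x => α x ![X x]) U) :
    DForm.SmoothOn α U := by
  refine DForm.smoothOn_of_apply fun x₀ u y hy => ?_
  obtain ⟨X, hX, hXu⟩ := exists_coordField x₀ (u 0)
  have hs := (extChartAt (𝓡 d) x₀).map_target hy.1
  obtain ⟨f, hf, hfX, -⟩ := exists_smoothField_eventuallyEq (isOpen_extChartAt_source x₀) hX hs
  have h1 := contDiffOn_comp_chart_symm le_rfl (h _ hf) x₀ y hy
  have hc : ContinuousAt (extChartAt (𝓡 d) x₀).symm y := continuousAt_extChartAt_symm'' hy.1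
  have hev : ∀ᶠ z in 𝓝 y, α ((extChartAt (𝓡 d) x₀).symm z) (fun i => chartDSymm x₀ z (u i))
      = α ((extChartAt (𝓡 d) x₀).symm z) ![(f • X) ((extChartAt (𝓡 d) x₀).symm z)] := by
    filter_upwards [hc.eventually hfX, (isOpen_extChartAt_target x₀).mem_nhds hy.1] with z hz hzt
    rw [hz, hXu z hzt]
    congr 1
    funext i
    fin_cases i
    rfl
  exact h1.congr_of_eventuallyEq (hev.filter_mono nhdsWithin_le_nhds) hev.self_of_nhds

theorem apply_eq_oneChart (α : DForm d V 1 F) {x₀ : V} {y : EuclideanSpace ℝ (Fin d)}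
    (hy : y ∈ (extChartAt (𝓡 d) x₀).target)
    (X : TangentSpace (𝓡 d) ((extChartAt (𝓡 d) x₀).symm y)) :
    α ((extChartAt (𝓡 d) x₀).symm y) ![X] = DForm.oneChart α x₀ y (chartD x₀ _ X) := by
  rw [DForm.oneChart_apply, chartDSymm_chartD hy]

/-- A vector field in the preferred chart at `x₀`. -/
noncomputable def chartField (x₀ : V) (X : ∀ x : V, TangentSpace (𝓡 d) x)
    (z : EuclideanSpace ℝ (Fin d)) : EuclideanSpace ℝ (Fin d) :=
  chartD x₀ ((extChartAt (𝓡 d) x₀).symm z) (X ((extChartAt (𝓡 d) x₀).symm z))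

theorem SmoothField.contDiffAt_chartField {X : ∀ x : V, TangentSpace (𝓡 d) x} (hX : SmoothField X)
    {x₀ : V} {y : EuclideanSpace ℝ (Fin d)} (hy : y ∈ (extChartAt (𝓡 d) x₀).target) :
    ContDiffAt ℝ ∞ (chartField x₀ X) y :=
  (contDiffOn_comp_chart_symm le_rfl (hX.contMDiffOn_chartD x₀) x₀).contDiffAt
    ((chart_target_inter_preimage_isOpen x₀ (isOpen_extChartAt_source x₀)).mem_nhds
      ⟨hy, (extChartAt (𝓡 d) x₀).map_target hy⟩)

theorem DForm.SmoothOn.hasFDerivAt_apply {α : DForm d V 1 F} {U : Set V} (hU : IsOpen U)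
    (hα : DForm.SmoothOn α U) {Y : ∀ x : V, TangentSpace (𝓡 d) x} (hY : SmoothField Y) {x₀ : V}
    {y : EuclideanSpace ℝ (Fin d)} (hy : y ∈ (extChartAt (𝓡 d) x₀).target)
    (hyU : (extChartAt (𝓡 d) x₀).symm y ∈ U) :
    HasFDerivAt (fun z => α ((extChartAt (𝓡 d) x₀).symm z) ![Y ((extChartAt (𝓡 d) x₀).symm z)])
      ((DForm.oneChart α x₀ y).comp (fderiv ℝ (chartField x₀ Y) y)
        + (fderiv ℝ (DForm.oneChart α x₀) y).flip (chartField x₀ Y y)) y := by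
  have h1 := ((hα.contDiffAt_oneChart hU hy hyU).differentiableAt (by simp)).hasFDerivAt
  have h2 := ((hY.contDiffAt_chartField hy).differentiableAt (by simp)).hasFDerivAt
  refine (h1.clm_apply h2).congr_of_eventuallyEq ?_
  filter_upwards [(isOpen_extChartAt_target x₀).mem_nhds hy] with z hz
  exact apply_eq_oneChart α hz _

theorem chartD_mlieBracket {X Y : ∀ x : V, TangentSpace (𝓡 d) x} (x : V) :
    chartD x x (VectorField.mlieBracket (𝓡 d) X Y x)
      = VectorField.lieBracket ℝ
          (chartField x X) (chartField x Y) (extChartAt (𝓡 d) x x) := by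
  have := isManifold_one d V
  have hpull : ∀ Z : ∀ x : V, TangentSpace (𝓡 d) x,
      VectorField.mpullbackWithin 𝓘(ℝ, EuclideanSpace ℝ (Fin d)) (𝓡 d) (extChartAt (𝓡 d) x).symm Z
        (Set.range (𝓡 d)) =ᶠ[𝓝 (extChartAt (𝓡 d) x x)]
      chartField x Z := by
    intro Z
    filter_upwards [(isOpen_extChartAt_target x).mem_nhds (mem_extChartAt_target x)] with z hz
    rw [VectorField.mpullbackWithin_apply, ContinuousLinearMap.inverse_eq
      (mfderivWithin_extChartAt_symm_comp_mfderiv_extChartAt hz)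
      (mfderiv_extChartAt_comp_mfderivWithin_extChartAt_symm hz)]
    rfl
  have hs : (extChartAt (𝓡 d) x).symm ⁻¹' (Set.univ : Set V) ∩ Set.range (𝓡 d) = Set.univ := by
    simp
  -- The bracket on V unfolds to a bracket within the set of `hs`; quantifying over `s` allows this
  -- set to be replaced by the whole space.
  have h1 : ∀ s, s = Set.univ → VectorField.lieBracketWithin ℝ
      (VectorField.mpullbackWithin 𝓘(ℝ, EuclideanSpace ℝ (Fin d)) (𝓡 d) (extChartAt (𝓡 d) x).symm X
        (Set.range (𝓡 d)))
      (VectorField.mpullbackWithin 𝓘(ℝ, EuclideanSpace ℝ (Fin d)) (𝓡 d) (extChartAt (𝓡 d) x).symm Y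
        (Set.range (𝓡 d))) s (extChartAt (𝓡 d) x x)
      = VectorField.lieBracket ℝ (chartField x X) (chartField x Y) (extChartAt (𝓡 d) x x) := by
    rintro s rfl
    exact (congrFun VectorField.lieBracketWithin_univ _).trans
      ((hpull X).lieBracket_vectorField_eq (hpull Y))
  exact ((isInvertible_mfderiv_extChartAt (mem_extChartAt_source x)).self_apply_inverse _).trans
    (h1 _ hs)

/-- `dα(X, Y) = X α(Y) - Y α(X) - α([X, Y])`. -/
theorem DForm.extD_apply_smoothField {α : DForm d V 1 F} {U : Set V} (hU : IsOpen U)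
    (hα : DForm.SmoothOn α U) {X Y : ∀ x : V, TangentSpace (𝓡 d) x} (hX : SmoothField X)
    (hY : SmoothField Y) {x : V} (hx : x ∈ U)
    (hαX : MDifferentiableAt (𝓡 d) 𝓘(ℝ, F) (fun y => α y ![X y]) x)
    (hαY : MDifferentiableAt (𝓡 d) 𝓘(ℝ, F) (fun y => α y ![Y y]) x) :
    DForm.extD α x ![X x, Y x] = mvfderiv (𝓡 d) (fun y => α y ![Y y]) x (X x)
      - mvfderiv (𝓡 d) (fun y => α y ![X y]) x (Y x)
      - α x ![VectorField.mlieBracket (𝓡 d) X Y x] := by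
  -- `x` is both the centre of the chart and the point of evaluation. Under the separate name `x'`
  -- the point can be replaced by the image of `y` without touching the chart.
  have hmain : ∀ (y : EuclideanSpace ℝ (Fin d)) (hy : y ∈ (extChartAt (𝓡 d) x).target)
      (x' : V) (hx' : (extChartAt (𝓡 d) x).symm y = x') (hx'U : x' ∈ U)
      (hX' : MDifferentiableAt (𝓡 d) 𝓘(ℝ, F) (fun y => α y ![X y]) x')
      (hY' : MDifferentiableAt (𝓡 d) 𝓘(ℝ, F) (fun y => α y ![Y y]) x')
      (W : TangentSpace (𝓡 d) x') (hW : chartD x x' W = VectorField.lieBracket ℝ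
          (chartField x X) (chartField x Y) y),
      DForm.extD α x' ![X x', Y x'] = mvfderiv (𝓡 d) (fun y => α y ![Y y]) x' (X x')
        - mvfderiv (𝓡 d) (fun y => α y ![X y]) x' (Y x') - α x' ![W] := by
    rintro y hy x' rfl hx'U hX' hY' W hW
    have h1 := DForm.extD_apply_chartDSymm hU hα hy hx'U (chartField x X y) (chartField x Y y)
    have hX1 : chartDSymm x y (chartField x X y) = X _ := chartDSymm_chartD hy _
    have hY1 : chartDSymm x y (chartField x Y y) = Y _ := chartDSymm_chartD hy _
    rw [hX1, hY1] at h1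
    have h2 := fderiv_comp_chart_symm hy hX' (chartField x Y y)
    have h3 := fderiv_comp_chart_symm hy hY' (chartField x X y)
    rw [hY1, (hα.hasFDerivAt_apply hU hX hy hx'U).fderiv] at h2
    rw [hX1, (hα.hasFDerivAt_apply hU hY hy hx'U).fderiv] at h3
    rw [h1, ← h2, ← h3, apply_eq_oneChart α hy W, hW, VectorField.lieBracket_eq]
    simp only [add_apply, ContinuousLinearMap.comp_apply, ContinuousLinearMap.flip_apply, map_sub]
    abel
  exact hmain _ (mem_extChartAt_target x) x (extChartAt_to_inv x) hx hαX hαY _ (chartD_mlieBracket x)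

end Fields

/-! ## The differential of a representation is an equivariant homomorphism of Lie algebras -/

section LieAlgebra

variable {r : ℕ} {η : Fin r → ℤˣ}

theorem pseudoOrthogonalLie_conj_mem {a b ξ : Matrix (Fin r) (Fin r) ℝ}
    (ha : a.transpose * Matrix.diagonal (fun i => ((η i : ℤ) : ℝ)) * a
        = Matrix.diagonal (fun i => ((η i : ℤ) : ℝ))) (hba : b * a = 1)
    (hξ : ξ ∈ pseudoOrthogonalLie η) : a * ξ * b ∈ pseudoOrthogonalLie η := by
  rw [mem_pseudoOrthogonalLie_iff] at hξ ⊢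
  set J := Matrix.diagonal (fun i => ((η i : ℤ) : ℝ)) with hJ
  have hu : IsUnit a := IsUnit.of_mul_eq_one_right b hba
  have hut : IsUnit a.transpose := (Matrix.isUnit_transpose a).2 hu
  refine hut.mul_left_cancel (hu.mul_right_cancel ?_)
  have h1 : a * ξ * b * a = a * ξ := by rw [Matrix.mul_assoc, hba, Matrix.mul_one]
  calc a.transpose * ((a * ξ * b).transpose * J) * a
      = (a * ξ * b * a).transpose * J * a := by
        rw [Matrix.transpose_mul _ a]; simp only [Matrix.mul_assoc]
    _ = ξ.transpose * (a.transpose * J * a) := by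
        rw [h1, Matrix.transpose_mul]; simp only [Matrix.mul_assoc]
    _ = -(a.transpose * J * a * ξ) := by rw [ha, hξ]
    _ = -(a.transpose * J * (a * ξ * b * a)) := by rw [h1]; simp only [Matrix.mul_assoc]
    _ = _ := by simp only [Matrix.mul_neg, Matrix.neg_mul, Matrix.mul_assoc]

theorem pseudoOrthogonalLie_lie_mem {ξ ζ : Matrix (Fin r) (Fin r) ℝ}
    (hξ : ξ ∈ pseudoOrthogonalLie η) (hζ : ζ ∈ pseudoOrthogonalLie η) :
    ξ * ζ - ζ * ξ ∈ pseudoOrthogonalLie η := by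
  rw [mem_pseudoOrthogonalLie_iff] at hξ hζ ⊢
  rw [Matrix.transpose_sub, Matrix.transpose_mul, Matrix.transpose_mul, Matrix.sub_mul,
    Matrix.mul_assoc, hξ, Matrix.mul_assoc, hζ, Matrix.mul_neg, Matrix.mul_neg, ← Matrix.mul_assoc,
    hζ, ← Matrix.mul_assoc, hξ, Matrix.mul_sub, Matrix.neg_mul, Matrix.neg_mul]
  simp only [Matrix.mul_assoc]
  abel

variable {k : ℕ} [NeZero k] {G : Subgroup (Matrix.GeneralLinearGroup (Fin r) ℝ)}
  {Ĝ : Type*} [Group Ĝ] [TopologicalSpace Ĝ] [IsTopologicalGroup Ĝ] [T2Space Ĝ]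
  {E : CentralExtension k G Ĝ} {q : ℤ} {v : Type*} [NormedAddCommGroup v] [NormedSpace ℂ v]
  {R : WeightRep E q v} {L : pseudoOrthogonalLie η →ₗ[ℝ] (v →L[ℂ] v)}

theorem CentralExtension.mat_inv (E : CentralExtension k G Ĝ) (a : Ĝ) :
    E.mat a⁻¹ = (E.mat a)⁻¹ :=
  (Matrix.inv_eq_right_inv (E.mat_mul_mat_inv a)).symm

theorem CentralExtension.det_mat_ne_zero (E : CentralExtension k G Ĝ) (a : Ĝ) :
    (E.mat a).det ≠ 0 :=
  (E.proj a : Matrix.GeneralLinearGroup (Fin r) ℝ).det.ne_zero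

/-- The derivative of `ρ` along a curve in `Ĝ`. -/
theorem WeightRep.IsDifferential.hasDerivAt_mul (hL : R.IsDifferential L)
    (hle : G ≤ pseudoOrthogonal η)
    (hopen : ∀ᶠ a in 𝓝 (1 : Matrix.GeneralLinearGroup (Fin r) ℝ), a ∈ pseudoOrthogonal η → a ∈ G)
    (ξ : pseudoOrthogonalLie η) {γ : ℝ → Ĝ} {t : ℝ} (h1 : ContinuousAt γ t)
    (h3 : ∀ i j, ContDiffAt ℝ 1 (fun s => E.mat (γ s) i j) t)
    (h4 : ∀ i j, deriv (fun s => E.mat (γ s) i j) t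
      = (E.mat (γ t) * (ξ : Matrix (Fin r) (Fin r) ℝ)) i j) :
    HasDerivAt (fun s => R.ρ (γ s)) (R.ρ (γ t) * L ξ) t := by
  have hc : ∀ i j, ContDiffAt ℝ 1 (fun _ : ℝ => E.mat (γ t)⁻¹ i j) t := fun _ _ => contDiffAt_const
  have hd : ∀ i j, HasDerivAt (fun s => E.mat (γ s) i j)
      ((E.mat (γ t) * (ξ : Matrix (Fin r) (Fin r) ℝ)) i j) t := fun i j => by
    rw [← h4]
    exact ((h3 i j).differentiableAt (by simp)).hasDerivAt
  have hd' := HasDerivAt.matrix_mul (M := fun _ => E.mat (γ t)⁻¹) (M' := 0)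
    (fun _ _ => hasDerivAt_const _ _) hd
  -- The curve is translated to 1, where the differential applies, and afterwards multiplied back by
  -- ρ(γ(t)).
  have h := hL.hasDerivAt hle hopen ξ (γ := fun s => (γ t)⁻¹ * γ s) (t := t)
    (continuousAt_const.mul h1) (inv_mul_cancel _)
    (fun i j => by simp only [E.mat_mul]; exact ContDiffAt.matrix_mul hc h3 i j)
    (fun i j => by
      simp only [E.mat_mul]
      rw [(hd' i j).deriv, Matrix.zero_mul, zero_add, ← Matrix.mul_assoc, E.mat_inv_mul_mat,
        Matrix.one_mul])
  have h' := h.const_mul (R.ρ (γ t))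
  refine h'.congr_of_eventuallyEq (Filter.Eventually.of_forall fun s => ?_)
  simp only [← map_mul, mul_inv_cancel_left]

/-- Differentiate ρ(a γ a⁻¹) = ρ(a) ρ(γ) ρ(a⁻¹) along a curve γ through 1; the hypothesis says that
ξ' is the conjugate of ξ by `a`. -/
theorem WeightRep.IsDifferential.mul_eq_mul (hL : R.IsDifferential L)
    (hopen : ∀ᶠ a in 𝓝 (1 : Matrix.GeneralLinearGroup (Fin r) ℝ), a ∈ pseudoOrthogonal η → a ∈ G)
    (a : Ĝ) (ξ ξ' : pseudoOrthogonalLie η)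
    (h : E.mat a * (ξ : Matrix (Fin r) (Fin r) ℝ) = (ξ' : Matrix (Fin r) (Fin r) ℝ) * E.mat a) :
    R.ρ a * L ξ = L ξ' * R.ρ a := by
  obtain ⟨γ, h1, h2, h3, h4⟩ := E.exists_curve hopen ξ
  have hd := HasDerivAt.matrix_mul (M := fun _ => E.mat a) (M' := 0)
    (fun _ _ => hasDerivAt_const _ _) h4
  have hd' := HasDerivAt.matrix_mul hd (N := fun _ => E.mat a⁻¹) (N' := 0)
    (fun _ _ => hasDerivAt_const _ _)
  have hconj := hL ξ' (fun t => a * γ t * a⁻¹) ((continuous_const.mul h1).mul continuous_const)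
    (by simp [h2])
    (fun i j => contDiff_iff_contDiffAt.2 fun t => by
      simp only [E.mat_mul]
      exact ContDiffAt.matrix_mul (M := fun t => E.mat a * E.mat (γ t)) (N := fun _ => E.mat a⁻¹)
        (ContDiffAt.matrix_mul (M := fun _ => E.mat a) (fun _ _ => contDiffAt_const)
          fun i j => (h3 i j).contDiffAt) (fun _ _ => contDiffAt_const) i j)
    (fun i j => by
      simp only [E.mat_mul]
      rw [(hd' i j).deriv, h2, E.mat_one, Matrix.zero_mul, zero_add, Matrix.mul_zero, add_zero, h,
        Matrix.mul_assoc, E.mat_mul_mat_inv, Matrix.mul_one])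
  have hγ := hL ξ γ h1 h2 h3 fun i j => (h4 i j).deriv
  have hγ' := (hγ.const_mul (R.ρ a)).mul_const (R.ρ a⁻¹)
  have heq : R.ρ a * L ξ * R.ρ a⁻¹ = L ξ' := by
    refine hγ'.unique (hconj.congr_of_eventuallyEq (Filter.Eventually.of_forall fun s => ?_))
    simp only [map_mul]
  rw [← heq, mul_assoc, ← map_mul, inv_mul_cancel, map_one, mul_one]

/-- Differentiate ρ(γ) L(ζ) ρ(γ⁻¹) = L(γ ζ γ⁻¹) along a curve γ with velocity ξ. An extension Λ of
`L` to all matrices allows the right side to be differentiated entry by entry. -/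
theorem WeightRep.IsDifferential.map_lie (hL : R.IsDifferential L)
    (hle : G ≤ pseudoOrthogonal η)
    (hopen : ∀ᶠ a in 𝓝 (1 : Matrix.GeneralLinearGroup (Fin r) ℝ), a ∈ pseudoOrthogonal η → a ∈ G)
    (ξ ζ : pseudoOrthogonalLie η) :
    L ⟨ξ * ζ - ζ * ξ, pseudoOrthogonalLie_lie_mem ξ.2 ζ.2⟩ = L ξ * L ζ - L ζ * L ξ := by
  obtain ⟨Λ, hΛ⟩ := L.exists_extend
  have hΛ' : ∀ ξ : pseudoOrthogonalLie η, Λ ξ = L ξ := fun ξ => LinearMap.congr_fun hΛ ξ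
  obtain ⟨γ, h1, h2, h3, h4⟩ := E.exists_curve hopen ξ
  have hγ := hL ξ γ h1 h2 h3 fun i j => (h4 i j).deriv
  have hsm : ∀ i j, ContDiff ℝ ∞ fun t => E.mat (γ t)⁻¹ i j := fun i j =>
    contDiff_iff_contDiffAt.2 fun t => by
      simp only [E.mat_inv]
      exact ContDiffAt.matrix_inv (fun i j => (h3 i j).contDiffAt) (E.det_mat_ne_zero _) i j
  have hd : ∀ i j, HasDerivAt (fun t => E.mat (γ t)⁻¹ i j)
      (Matrix.of (fun i j => deriv (fun t => E.mat (γ t)⁻¹ i j) 0) i j) 0 := fun i j =>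
    ((hsm i j).differentiable (by simp)).differentiableAt.hasDerivAt
  -- The product rule for γ γ⁻¹ = 1 shows that γ⁻¹ has velocity -ξ.
  have hinv : Matrix.of (fun i j => deriv (fun t => E.mat (γ t)⁻¹ i j) 0)
      = -(ξ : Matrix (Fin r) (Fin r) ℝ) := by
    have h5 : (ξ : Matrix (Fin r) (Fin r) ℝ)
        + Matrix.of (fun i j => deriv (fun t => E.mat (γ t)⁻¹ i j) 0) = 0 := by
      ext i j
      have h := HasDerivAt.matrix_mul h4 hd i j
      simp only [E.mat_mul_mat_inv, h2, inv_one, E.mat_one, Matrix.mul_one, Matrix.one_mul] at h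
      exact h.unique (hasDerivAt_const _ _)
    exact eq_neg_of_add_eq_zero_right h5
  rw [hinv] at hd
  have hγinv : HasDerivAt (fun t => R.ρ (γ t)⁻¹) (L (-ξ)) 0 :=
    hL (-ξ) (fun t => (γ t)⁻¹) h1.inv (by simp [h2]) hsm fun i j => (hd i j).deriv
  have hr := (hγ.mul_const (L ζ)).mul hγinv
  have hl := HasDerivAt.matrix_linearMap (HasDerivAt.matrix_mul
    (HasDerivAt.matrix_mul h4 (N := fun _ => ζ) (N' := 0) fun _ _ => hasDerivAt_const _ _) hd) Λ
  have heq := hl.unique (hr.congr_of_eventuallyEq (Filter.Eventually.of_forall fun t => ?_))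
  · simp only [h2, E.mat_one, inv_one, map_one, add_zero, mul_zero, mul_one, one_mul, map_neg, mul_neg, ← sub_eq_add_neg] at heq
    rw [← heq, ← hΛ']
  · have hmem := pseudoOrthogonalLie_conj_mem (hle (E.proj (γ t)).2) (E.mat_inv_mul_mat (γ t)) ζ.2
    have h := hL.mul_eq_mul hopen (γ t) ζ ⟨_, hmem⟩ (by
      change _ = E.mat (γ t) * (ζ : Matrix (Fin r) (Fin r) ℝ) * E.mat (γ t)⁻¹ * E.mat (γ t)
      rw [Matrix.mul_assoc, E.mat_inv_mul_mat, Matrix.mul_one])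
    simp only [Pi.mul_apply]
    rw [h, mul_assoc (L _) (R.ρ (γ t)), ← map_mul, mul_inv_cancel, map_one, mul_one, ← hΛ']
    rfl

end LieAlgebra

/-! ## Connection matrices -/

section Directional

variable {d r : ℕ} {V : Type u} [TopologicalSpace V] [ChartedSpace (EuclideanSpace ℝ (Fin d)) V]
  [IsManifold (𝓡 d) ∞ V] {F : Type*} [NormedAddCommGroup F] [NormedSpace ℝ F]

/-- A directional derivative on V is an ordinary derivative along a coordinate line. This transfers
the results on curves of matrices and on curves in Ĝ to V. -/
theorem hasDerivAt_chart_line {f : V → F} {x₀ : V} {y : EuclideanSpace ℝ (Fin d)}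
    (hy : y ∈ (extChartAt (𝓡 d) x₀).target)
    (hf : MDifferentiableAt (𝓡 d) 𝓘(ℝ, F) f ((extChartAt (𝓡 d) x₀).symm y))
    (u : EuclideanSpace ℝ (Fin d)) :
    HasDerivAt (fun t : ℝ => f ((extChartAt (𝓡 d) x₀).symm (y + t • u)))
      (mvfderiv (𝓡 d) f ((extChartAt (𝓡 d) x₀).symm y) (chartDSymm x₀ y u)) 0 := by
  have hd : DifferentiableAt ℝ (fun z => f ((extChartAt (𝓡 d) x₀).symm z)) y :=
    (hf.comp y (mdifferentiableAt_chart_symm hy)).differentiableAt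
  have hl : HasDerivAt (fun t : ℝ => y + t • u) u 0 := by
    simpa using ((hasDerivAt_id (0 : ℝ)).smul_const u).const_add y
  have h0 : y + (0 : ℝ) • u = y := by simp
  rw [← fderiv_comp_chart_symm hy hf]
  exact HasFDerivAt.comp_hasDerivAt (0 : ℝ) (by rw [h0]; exact hd.hasFDerivAt) hl

/-- The derivative of a matrix-valued function in the direction of a tangent vector. -/
noncomputable def matrixDeriv (M : V → Matrix (Fin r) (Fin r) ℝ) (x : V)
    (X : TangentSpace (𝓡 d) x) : Matrix (Fin r) (Fin r) ℝ :=
  Matrix.of fun i j => mvfderiv (𝓡 d) (fun y => M y i j) x X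

theorem mvfderiv_matrix_linearMap {M : V → Matrix (Fin r) (Fin r) ℝ} {x : V}
    (hM : ∀ i j, MDifferentiableAt (𝓡 d) 𝓘(ℝ, ℝ) (fun y => M y i j) x)
    (Λ : Matrix (Fin r) (Fin r) ℝ →ₗ[ℝ] F) (X : TangentSpace (𝓡 d) x)
    (hΛ : MDifferentiableAt (𝓡 d) 𝓘(ℝ, F) (fun y => Λ (M y)) x) :
    mvfderiv (𝓡 d) (fun y => Λ (M y)) x X = Λ (matrixDeriv M x X) := by
  obtain ⟨x₀, y, hy, rfl⟩ := exists_chart_point (d := d) x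
  rw [← chartDSymm_chartD hy X]
  have h1 := hasDerivAt_chart_line hy hΛ (chartD x₀ _ X)
  have h2 := HasDerivAt.matrix_linearMap
    (M' := matrixDeriv M _ (chartDSymm x₀ y (chartD x₀ _ X)))
    (fun i j => hasDerivAt_chart_line hy (hM i j) (chartD x₀ _ X)) Λ
  exact h1.unique h2

theorem contMDiffOn_matrix_linearMap {M : V → Matrix (Fin r) (Fin r) ℝ} {U : Set V}
    (hM : ∀ i j, ContMDiffOn (𝓡 d) 𝓘(ℝ, ℝ) ∞ (fun y => M y i j) U)
    (Λ : Matrix (Fin r) (Fin r) ℝ →ₗ[ℝ] F) :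
    ContMDiffOn (𝓡 d) 𝓘(ℝ, F) ∞ (fun y => Λ (M y)) U := by
  rw [show (fun y => Λ (M y)) = fun y => ∑ i, ∑ j, M y i j • Λ (Matrix.single i j 1) from
    funext fun y => Matrix.linearMap_apply_eq_sum Λ (M y)]
  exact contMDiffOn_finsetSum fun i _ => contMDiffOn_finsetSum fun j _ =>
    (hM i j).smul contMDiffOn_const

/-- A linear projection onto the Lie algebra fixes `M` on `U`, hence also its derivative. -/
theorem matrixDeriv_mem {η : Fin r → ℤˣ} {M : V → Matrix (Fin r) (Fin r) ℝ} {x : V} {U : Set V}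
    (hU : IsOpen U) (hx : x ∈ U) (hM : ∀ i j, ContMDiffOn (𝓡 d) 𝓘(ℝ, ℝ) ∞ (fun y => M y i j) U)
    (hmem : ∀ y ∈ U, M y ∈ pseudoOrthogonalLie η) (X : TangentSpace (𝓡 d) x) :
    matrixDeriv M x X ∈ pseudoOrthogonalLie η := by
  obtain ⟨P, hP⟩ := LinearMap.exists_leftInverse_of_injective (pseudoOrthogonalLie η).subtype
    (Submodule.ker_subtype _)
  have hMd : ∀ i j, MDifferentiableAt (𝓡 d) 𝓘(ℝ, ℝ) (fun y => M y i j) x := fun i j =>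
    ((hM i j).contMDiffAt (hU.mem_nhds hx)).mdifferentiableAt (by simp)
  have h : matrixDeriv M x X = (P (matrixDeriv M x X) : Matrix (Fin r) (Fin r) ℝ) := by
    ext i j
    set Λ : Matrix (Fin r) (Fin r) ℝ →ₗ[ℝ] ℝ := (Matrix.entryLinearMap ℝ ℝ i j).comp
      ((pseudoOrthogonalLie η).subtype.comp P) with hΛ
    have hev : (fun y => Λ (M y)) =ᶠ[𝓝 x] fun y => M y i j := by
      filter_upwards [hU.mem_nhds hx] with y hy
      have : P (M y) = ⟨M y, hmem y hy⟩ := LinearMap.congr_fun hP ⟨M y, hmem y hy⟩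
      simp [hΛ, this]
    have h1 := mvfderiv_matrix_linearMap hMd Λ X ((hMd i j).congr_of_eventuallyEq hev)
    refine Eq.trans ?_ h1
    change mvfderiv (𝓡 d) (fun y => M y i j) x X = _
    unfold mvfderiv
    rw [hev.mfderiv_eq]
    rfl
  rw [h]
  exact (P (matrixDeriv M x X)).2

end Directional

section Leibniz

variable {d : ℕ} {V : Type u} [TopologicalSpace V] [ChartedSpace (EuclideanSpace ℝ (Fin d)) V]
  [IsManifold (𝓡 d) ∞ V] (D : LinConn d V)

theorem LinConn.congr_of_eventuallyEq {Y Y' : ∀ x : V, TangentSpace (𝓡 d) x} {x : V}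
    (hY : MDifferentiableAt (𝓡 d) (𝓡 d).tangent (T% Y) x) (h : Y' =ᶠ[𝓝 x] Y) : D Y' x = D Y x := by
  have hY' : MDifferentiableAt (𝓡 d) (𝓡 d).tangent (T% Y') x :=
    hY.congr_of_eventuallyEq (h.mono fun y hy => by simp only [hy])
  exact D.isCovariantDerivativeOnUniv.congr_of_eventuallyEq hY' hY Filter.univ_mem h

theorem LinConn.apply_sum_smul {ι : Type*} (s : Finset ι) {f : ι → V → ℝ}
    {Y : ι → ∀ x : V, TangentSpace (𝓡 d) x} {x : V}
    (hf : ∀ i, MDifferentiableAt (𝓡 d) 𝓘(ℝ, ℝ) (f i) x)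
    (hY : ∀ i, MDifferentiableAt (𝓡 d) (𝓡 d).tangent (T% (Y i)) x) (X : TangentSpace (𝓡 d) x) :
    D (fun y => ∑ i ∈ s, f i y • Y i y) x X
      = ∑ i ∈ s, (mvfderiv (𝓡 d) (f i) x X • Y i x + f i x • D (Y i) x X) := by
  classical
  have hs : ∀ i, MDifferentiableAt (𝓡 d) (𝓡 d).tangent (T% (f i • Y i)) x := fun i =>
    (hf i).smul_section (hY i)
  induction s using Finset.induction_on with
  | empty =>
    have h : (fun y : V => ∑ i ∈ (∅ : Finset ι), f i y • Y i y) = 0 := by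
      funext y; simp
    rw [h, CovariantDerivative.zero]
    simp
  | insert a s ha ih =>
    have h : (fun y : V => ∑ i ∈ insert a s, f i y • Y i y)
        = (f a • Y a) + fun y => ∑ i ∈ s, f i y • Y i y := by
      funext y; rw [Finset.sum_insert ha]; rfl
    have hsum : MDifferentiableAt (𝓡 d) (𝓡 d).tangent (T% fun y => ∑ i ∈ s, f i y • Y i y) x :=
      MDifferentiableAt.sum_section (t := fun i y => f i y • Y i y) fun i _ => hs i
    rw [h, Finset.sum_insert ha, ← ih]
    have h1 := D.isCovariantDerivativeOnUniv.add (hs a) hsum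
    have h2 := D.isCovariantDerivativeOnUniv.leibniz (hY a) (hf a)
    have h3 := congrArg (fun L => L X) (h1.trans (congrArg (· + _) h2))
    refine Eq.trans h3 ?_
    simp only [add_apply, smul_apply, ContinuousLinearMap.smulRight_apply]
    rw [add_comm (f a x • _)]

end Leibniz

section ConnMatrix

variable {n m : ℕ} {V : Type u} [TopologicalSpace V]
  [ChartedSpace (EuclideanSpace ℝ (Fin (n + m))) V] [IsManifold (𝓡 (n + m)) ∞ V]
  {N : NConnection n m V} {g : DMetric N} {c : HV} {D : LinConn (n + m) V}

theorem IsLocalSection.mono {d r : ℕ} {V : Type u} [TopologicalSpace V]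
    [ChartedSpace (EuclideanSpace ℝ (Fin d)) V] [IsManifold (𝓡 d) ∞ V] {B B' : FrameFamily r d V}
    (hB : ∀ x, B x ⊆ B' x) {U : Set V} {e : ∀ x : V, Fin r → TangentSpace (𝓡 d) x}
    (he : IsLocalSection B U e) : IsLocalSection B' U e :=
  ⟨he.isOpen, fun x hx => hB x (he.mem x hx), he.smooth⟩

theorem IsLocalSection.mdifferentiableAt {d r : ℕ} {V : Type u} [TopologicalSpace V]
    [ChartedSpace (EuclideanSpace ℝ (Fin d)) V] [IsManifold (𝓡 d) ∞ V] {B : FrameFamily r d V}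
    {U : Set V} {e : ∀ x : V, Fin r → TangentSpace (𝓡 d) x}
    (he : IsLocalSection B U e) {x : V} (hx : x ∈ U) (j : Fin r) :
    MDifferentiableAt (𝓡 d) (𝓡 d).tangent (T% fun y => e y j) x :=
  ((he.smooth j).contMDiffAt (he.isOpen.mem_nhds hx)).mdifferentiableAt (by simp)

variable (g D) in
/-- The matrix of the connection form of `D` in the frame `e`. -/
noncomputable def connMatrix (e : ∀ x : V, Fin (c.dim n m) → TangentSpace (𝓡 (n + m)) x) (x : V)
    (X : TangentSpace (𝓡 (n + m)) x) : Matrix (Fin (c.dim n m)) (Fin (c.dim n m)) ℝ :=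
  g.transition (e x) fun j => D (fun y => e y j) x X

variable {U : Set V} {e : ∀ x : V, Fin (c.dim n m) → TangentSpace (𝓡 (n + m)) x}

/-- The condition on d-connections concerns global fields, so the frame vector is cut off; outside
of `U` the cut-off vanishes and lies in every subspace. -/
theorem IsMetricDConnection.apply_mem [T2Space V] (hD : IsMetricDConnection N g D)
    (he : IsLocalSection (g.frames c) U e) {x : V} (hx : x ∈ U) (j : Fin (c.dim n m))
    (X : TangentSpace (𝓡 (n + m)) x) : D (fun y => e y j) x X ∈ N.part c x := by
  obtain ⟨f, hf, hfe, hf0⟩ := exists_smoothField_eventuallyEq he.isOpen (he.smooth j) hx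
  rw [← D.congr_of_eventuallyEq (he.mdifferentiableAt hx j) hfe]
  refine hD.adapted c _ hf (fun y => ?_) x X
  by_cases hy : y ∈ U
  · exact Submodule.smul_mem _ _ ((he.mem y hy).1 j)
  · change f y • e y j ∈ _
    rw [hf0 y hy, zero_smul]
    exact Submodule.zero_mem _

theorem IsMetricDConnection.apply_eq_frameMul [T2Space V] (hD : IsMetricDConnection N g D)
    (he : IsLocalSection (g.frames c) U e) {x : V} (hx : x ∈ U) (X : TangentSpace (𝓡 (n + m)) x) :
    (fun j => D (fun y => e y j) x X) = frameMul (e x) (connMatrix g D e x X) :=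
  DMetric.frameMul_transition (he.mem x hx) fun j => hD.apply_mem he hx j X

/-- The functions g(e_i, e_j) are constant, and metricity turns their vanishing derivative into
skewness. -/
theorem IsMetricDConnection.connMatrix_mem [T2Space V] (hD : IsMetricDConnection N g D)
    (he : IsLocalSection (g.frames c) U e) {x : V} (hx : x ∈ U) (X : TangentSpace (𝓡 (n + m)) x) :
    connMatrix g D e x X ∈ pseudoOrthogonalLie (g.sign c) := by
  have hskew : ∀ i j, g.inner x (D (fun y => e y i) x X) (e x j)
      + g.inner x (e x i) (D (fun y => e y j) x X) = 0 := fun i j => by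
    obtain ⟨f, hf, hfe, -⟩ := exists_smoothField_eventuallyEq he.isOpen (he.smooth i) hx
    obtain ⟨f', hf', hfe', -⟩ := exists_smoothField_eventuallyEq he.isOpen (he.smooth j) hx
    have h := hD.metric _ _ hf hf' x X
    rw [D.congr_of_eventuallyEq (he.mdifferentiableAt hx i) hfe,
      D.congr_of_eventuallyEq (he.mdifferentiableAt hx j) hfe', hfe.self_of_nhds,
      hfe'.self_of_nhds] at h
    rw [← h]
    have hc : (fun y => g.inner y ((f • fun y => e y i) y) ((f' • fun y => e y j) y))
        =ᶠ[𝓝 x] fun _ => if i = j then ((g.sign c i : ℤ) : ℝ) else 0 := by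
      filter_upwards [hfe, hfe', he.isOpen.mem_nhds hx] with y h1 h2 h3
      rw [h1, h2]
      exact (he.mem y h3).2 i j
    unfold mvfderiv
    rw [hc.mfderiv_eq, mfderiv_const]
    rfl
  rw [mem_pseudoOrthogonalLie_iff]
  ext i j
  rw [Matrix.mul_diagonal, Matrix.neg_apply, Matrix.diagonal_mul, Matrix.transpose_apply]
  unfold connMatrix DMetric.transition
  have h := hskew i j
  rw [g.symm] at h
  have h1 := units_sign_mul_self (g.sign c i)
  have h2 := units_sign_mul_self (g.sign c j)
  calc _ = (((g.sign c j : ℤ) : ℝ) * ((g.sign c j : ℤ) : ℝ))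
        * g.inner x (e x j) (D (fun y => e y i) x X) := by ring
    _ = -((((g.sign c i : ℤ) : ℝ) * ((g.sign c i : ℤ) : ℝ))
        * g.inner x (e x i) (D (fun y => e y j) x X)) := by rw [h1, h2]; linarith
    _ = _ := by ring

theorem IsMetricDConnection.contMDiffOn_apply [T2Space V] (hD : IsMetricDConnection N g D)
    (he : IsLocalSection (g.frames c) U e) {X : ∀ x : V, TangentSpace (𝓡 (n + m)) x}
    (hX : SmoothField X) (j : Fin (c.dim n m)) :
    ContMDiffOn (𝓡 (n + m)) (𝓡 (n + m)).tangent ∞ (T% fun x => D (fun y => e y j) x (X x)) U := by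
  intro x hx
  obtain ⟨f, hf, hfe, -⟩ := exists_smoothField_eventuallyEq he.isOpen (he.smooth j) hx
  have h := LinConn.smoothField_apply hD.smooth hX hf
  refine ((h x).congr_of_eventuallyEq ?_).contMDiffWithinAt
  filter_upwards [hfe.eventually_nhds, he.isOpen.mem_nhds hx] with y hy hyU
  rw [D.congr_of_eventuallyEq (he.mdifferentiableAt hyU j) hy]

theorem IsMetricDConnection.contMDiffOn_connMatrix [T2Space V] (hD : IsMetricDConnection N g D)
    (he : IsLocalSection (g.frames c) U e) {X : ∀ x : V, TangentSpace (𝓡 (n + m)) x}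
    (hX : SmoothField X) (i j : Fin (c.dim n m)) :
    ContMDiffOn (𝓡 (n + m)) 𝓘(ℝ, ℝ) ∞ (fun x => connMatrix g D e x (X x) i j) U :=
  DMetric.contMDiffOn_transition he.smooth (fun j => hD.contMDiffOn_apply he hX j) i j

theorem frameMul_add {r : ℕ} {T : Type*} [AddCommGroup T] [Module ℝ T] (e : Fin r → T)
    (a b : Matrix (Fin r) (Fin r) ℝ) : frameMul e (a + b) = frameMul e a + frameMul e b := by
  funext j
  simp [frameMul, add_smul, Finset.sum_add_distrib]

theorem frameMul_sub {r : ℕ} {T : Type*} [AddCommGroup T] [Module ℝ T] (e : Fin r → T)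
    (a b : Matrix (Fin r) (Fin r) ℝ) : frameMul e (a - b) = frameMul e a - frameMul e b := by
  funext j
  simp [frameMul, sub_smul, Finset.sum_sub_distrib]

/-- The covariant derivative of a frame `e · a`. -/
theorem IsMetricDConnection.apply_frameMul [T2Space V] (hD : IsMetricDConnection N g D)
    (he : IsLocalSection (g.frames c) U e) {x : V} (hx : x ∈ U)
    {a : V → Matrix (Fin (c.dim n m)) (Fin (c.dim n m)) ℝ}
    (ha : ∀ i j, MDifferentiableAt (𝓡 (n + m)) 𝓘(ℝ, ℝ) (fun y => a y i j) x)
    (X : TangentSpace (𝓡 (n + m)) x) :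
    (fun j => D (fun y => frameMul (e y) (a y) j) x X)
      = frameMul (e x) (matrixDeriv a x X + connMatrix g D e x X * a x) := by
  funext j
  refine (D.apply_sum_smul Finset.univ (fun i => ha i j) (fun i => he.mdifferentiableAt hx i)
    X).trans ?_
  rw [Finset.sum_add_distrib, frameMul_add, frameMul_mul, ← hD.apply_eq_frameMul he hx]
  rfl

/-- The gauge law θ' = a⁻¹ da + a⁻¹ θ a, written without inverses; it is the Leibniz rule for the
frame e · a. -/
theorem IsMetricDConnection.mul_connMatrix [T2Space V] (hD : IsMetricDConnection N g D)
    (he : IsLocalSection (g.frames c) U e) {U' : Set V}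
    {e' : ∀ x : V, Fin (c.dim n m) → TangentSpace (𝓡 (n + m)) x}
    (he' : IsLocalSection (g.frames c) U' e') {x : V} (hx : x ∈ U) (hx' : x ∈ U')
    {a : V → Matrix (Fin (c.dim n m)) (Fin (c.dim n m)) ℝ}
    (ha : ∀ i j, MDifferentiableAt (𝓡 (n + m)) 𝓘(ℝ, ℝ) (fun y => a y i j) x)
    (hea : ∀ᶠ y in 𝓝 x, e' y = frameMul (e y) (a y)) (X : TangentSpace (𝓡 (n + m)) x) :
    a x * connMatrix g D e' x X = matrixDeriv a x X + connMatrix g D e x X * a x := by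
  have h1 := hD.apply_eq_frameMul he' hx' X
  have h2 : (fun j => D (fun y => frameMul (e y) (a y) j) x X)
      = fun j => D (fun y => e' y j) x X := by
    funext j
    rw [D.congr_of_eventuallyEq (he'.mdifferentiableAt hx' j)
      (hea.mono fun y hy => (congrFun hy j).symm)]
  rw [hD.apply_frameMul he hx ha, h1, hea.self_of_nhds, ← frameMul_mul] at h2
  have h3 := congrArg (g.transition (e x)) h2
  rw [DMetric.transition_frameMul (he.mem x hx), DMetric.transition_frameMul (he.mem x hx)] at h3
  exact h3.symm

/-- The matrix of the curvature of `D` in the frame `e`. -/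
theorem IsMetricDConnection.curv_eq_frameMul [T2Space V] (hD : IsMetricDConnection N g D)
    (he : IsLocalSection (g.frames c) U e) {X Y : ∀ x : V, TangentSpace (𝓡 (n + m)) x}
    (hX : SmoothField X) (hY : SmoothField Y) {x : V} (hx : x ∈ U) :
    (fun j => D.curv X Y (fun y => e y j) x) = frameMul (e x)
      (matrixDeriv (fun y => connMatrix g D e y (Y y)) x (X x)
        - matrixDeriv (fun y => connMatrix g D e y (X y)) x (Y x)
        - connMatrix g D e x (VectorField.mlieBracket (𝓡 (n + m)) X Y x)
        + (connMatrix g D e x (X x) * connMatrix g D e x (Y x)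
          - connMatrix g D e x (Y x) * connMatrix g D e x (X x))) := by
  -- D_X D_Y e = e · (X θ(Y) + θ(X) θ(Y)). Antisymmetrizing and subtracting D_[X,Y] e gives the
  -- structure equation.
  have key : ∀ X Y : (∀ x : V, TangentSpace (𝓡 (n + m)) x), SmoothField Y →
      (fun j => D (fun y => D (fun z => e z j) y (Y y)) x (X x)) = frameMul (e x)
        (matrixDeriv (fun y => connMatrix g D e y (Y y)) x (X x)
          + connMatrix g D e x (X x) * connMatrix g D e x (Y x)) := by
    intro X Y hY
    rw [← hD.apply_frameMul he hx (a := fun y => connMatrix g D e y (Y y)) (fun i j =>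
      ((hD.contMDiffOn_connMatrix he hY i j).contMDiffAt
        (he.isOpen.mem_nhds hx)).mdifferentiableAt (by simp))]
    funext j
    have h := D.congr_of_eventuallyEq
      (Y' := fun y => frameMul (e y) (connMatrix g D e y (Y y)) j)
      (((hD.contMDiffOn_apply he hY j).contMDiffAt
        (he.isOpen.mem_nhds hx)).mdifferentiableAt (by simp)) (by
        filter_upwards [he.isOpen.mem_nhds hx] with y hy
        exact (congrFun (hD.apply_eq_frameMul he hy (Y y)) j).symm)
    exact (congrArg (fun L => L (X x)) h).symm
  have h3 := hD.apply_eq_frameMul he hx (VectorField.mlieBracket (𝓡 (n + m)) X Y x)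
  have h : (fun j => D.curv X Y (fun y => e y j) x)
      = (fun j => D (fun y => D (fun z => e z j) y (Y y)) x (X x))
        - (fun j => D (fun y => D (fun z => e z j) y (X y)) x (Y x))
        - (fun j => D (fun z => e z j) x (VectorField.mlieBracket (𝓡 (n + m)) X Y x)) := rfl
  rw [h, key X Y hY, key Y X hX, h3, ← frameMul_sub, ← frameMul_sub]
  congr 1
  abel

end ConnMatrix

/-! ## Modules associated with representations, induced connections -/

section Lifts

variable {d r k : ℕ} [NeZero k] {η : Fin r → ℤˣ} {V : Type u} [TopologicalSpace V]
  [ChartedSpace (EuclideanSpace ℝ (Fin d)) V] [IsManifold (𝓡 d) ∞ V]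
  {G : Subgroup (Matrix.GeneralLinearGroup (Fin r) ℝ)}
  {Ĝ : Type*} [Group Ĝ] [TopologicalSpace Ĝ]
  {E : CentralExtension k G Ĝ} {q : ℤ} {v : Type*} [NormedAddCommGroup v] [NormedSpace ℂ v]
  {R : WeightRep E q v} {L : pseudoOrthogonalLie η →ₗ[ℝ] (v →L[ℂ] v)} {O : Set V} {ψ : V → Ĝ}

/-- Smoothness of ρ is tested on maps from open sets of Euclidean spaces, hence the passage through
a chart. -/
theorem WeightRep.contMDiffOn (R : WeightRep E q v) (hO : IsOpen O) (hψ : ContinuousOn ψ O)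
    (hs : ∀ i j, ContMDiffOn (𝓡 d) 𝓘(ℝ, ℝ) ∞ (fun x => E.mat (ψ x) i j) O) :
    ContMDiffOn (𝓡 d) 𝓘(ℝ, v →L[ℂ] v) ∞ (fun x => R.ρ (ψ x)) O := by
  intro x hx
  have hopen := chart_target_inter_preimage_isOpen (d := d) x hO
  have h := R.smooth d ((extChartAt (𝓡 d) x).target ∩ (extChartAt (𝓡 d) x).symm ⁻¹' O)
    (fun y => ψ ((extChartAt (𝓡 d) x).symm y)) hopen
    (hψ.comp ((continuousOn_extChartAt_symm x).mono Set.inter_subset_left) fun y hy => hy.2)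
    fun i j => contDiffOn_comp_chart_symm le_rfl (hs i j) x
  have h1 : ContDiffAt ℝ ∞ (fun y => R.ρ (ψ ((extChartAt (𝓡 d) x).symm y)))
      (extChartAt (𝓡 d) x x) :=
    h.contDiffAt (hopen.mem_nhds ⟨mem_extChartAt_target x, by
      rw [Set.mem_preimage, extChartAt_to_inv]; exact hx⟩)
  have h2 : ContMDiffAt (𝓡 d) 𝓘(ℝ, v →L[ℂ] v) ∞
      (fun z => R.ρ (ψ ((extChartAt (𝓡 d) x).symm (extChartAt (𝓡 d) x z)))) x :=
    h1.contMDiffAt.comp x contMDiffAt_extChartAt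
  refine (h2.congr_of_eventuallyEq ?_).contMDiffWithinAt
  filter_upwards [extChartAt_source_mem_nhds (I := 𝓡 d) x] with z hz
  rw [(extChartAt (𝓡 d) x).left_inv hz]

/-- Restricted to a coordinate line, ψ is a curve in Ĝ whose velocity, translated to 1, is ξ. -/
theorem WeightRep.IsDifferential.mvfderiv_apply [IsTopologicalGroup Ĝ] [T2Space Ĝ]
    (hL : R.IsDifferential L) (hle : G ≤ pseudoOrthogonal η)
    (hopen : ∀ᶠ a in 𝓝 (1 : Matrix.GeneralLinearGroup (Fin r) ℝ), a ∈ pseudoOrthogonal η → a ∈ G)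
    (hO : IsOpen O) (hψ : ContinuousOn ψ O)
    (hs : ∀ i j, ContMDiffOn (𝓡 d) 𝓘(ℝ, ℝ) ∞ (fun x => E.mat (ψ x) i j) O) {x : V} (hx : x ∈ O)
    {X : TangentSpace (𝓡 d) x} {ξ : pseudoOrthogonalLie η}
    (hξ : matrixDeriv (fun y => E.mat (ψ y)) x X
      = E.mat (ψ x) * (ξ : Matrix (Fin r) (Fin r) ℝ)) :
    mvfderiv (𝓡 d) (fun y => R.ρ (ψ y)) x X = R.ρ (ψ x) * L ξ := by
  have hR : MDifferentiableAt (𝓡 d) 𝓘(ℝ, v →L[ℂ] v) (fun x => R.ρ (ψ x)) x :=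
    ((R.contMDiffOn hO hψ hs).contMDiffAt (hO.mem_nhds hx)).mdifferentiableAt (by simp)
  have hs' : ∀ i j, MDifferentiableAt (𝓡 d) 𝓘(ℝ, ℝ) (fun x => E.mat (ψ x) i j) x := fun i j =>
    ((hs i j).contMDiffAt (hO.mem_nhds hx)).mdifferentiableAt (by simp)
  obtain ⟨x₀, y, hy, rfl⟩ := exists_chart_point (d := d) x
  obtain ⟨u, rfl⟩ : ∃ u, chartDSymm x₀ y u = X := ⟨_, chartDSymm_chartD hy X⟩
  have hl : ContDiffAt ℝ 1 (fun t : ℝ => y + t • u) 0 :=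
    contDiffAt_const.add (contDiffAt_id.smul contDiffAt_const)
  have h0 : y + (0 : ℝ) • u = y := by simp
  have hopen' := chart_target_inter_preimage_isOpen (d := d) x₀ hO
  set γ : ℝ → Ĝ := fun t => ψ ((extChartAt (𝓡 d) x₀).symm (y + t • u)) with hγ
  have hγ0 : γ 0 = ψ ((extChartAt (𝓡 d) x₀).symm y) := by simp only [hγ, h0]
  have hc : ContinuousAt γ 0 := by
    have h1 : ContinuousAt (fun z => ψ ((extChartAt (𝓡 d) x₀).symm z)) (y + (0 : ℝ) • u) := by
      rw [h0]
      exact ContinuousAt.comp (g := ψ) (hψ.continuousAt (hO.mem_nhds hx))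
        (continuousAt_extChartAt_symm'' hy)
    exact h1.comp (f := fun t : ℝ => y + t • u) hl.continuousAt
  have hsm : ∀ i j, ContDiffAt ℝ 1 (fun t => E.mat (γ t) i j) 0 := fun i j => by
    have h1 : ContDiffAt ℝ 1 (fun z => E.mat (ψ ((extChartAt (𝓡 d) x₀).symm z)) i j)
        (y + (0 : ℝ) • u) := by
      rw [h0]
      exact ((contDiffOn_comp_chart_symm le_rfl (hs i j) x₀).contDiffAt
        (hopen'.mem_nhds ⟨hy, hx⟩)).of_le (by simp)
    exact h1.comp (f := fun t : ℝ => y + t • u) 0 hl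
  have h := hL.hasDerivAt_mul hle hopen ξ hc hsm fun i j => by
    rw [hγ0, ← hξ]
    exact (hasDerivAt_chart_line hy (hs' i j) u).deriv
  rw [hγ0] at h
  exact (hasDerivAt_chart_line hy hR u).unique h

end Lifts

section Associated

variable {n m k : ℕ} [NeZero k] {V : Type u} [TopologicalSpace V]
  [ChartedSpace (EuclideanSpace ℝ (Fin (n + m))) V] [IsManifold (𝓡 (n + m)) ∞ V]
  {N : NConnection n m V} {g : DMetric N} {c : HV}
  {G : Subgroup (Matrix.GeneralLinearGroup (Fin (c.dim n m)) ℝ)}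
  {B : FrameFamily (c.dim n m) (n + m) V}
  {Ĝ : Type*} [Group Ĝ] [TopologicalSpace Ĝ] {E : CentralExtension k G Ĝ}
  {q : ℤ} {v : Type*} [NormedAddCommGroup v] [NormedSpace ℂ v]

theorem IsFrameBundle.contMDiffOn_mat (hB : IsFrameBundle (N.part c) g.inner (g.sign c) G B)
    {U₁ U₂ O : Set V} {e₁ e₂ : ∀ x : V, Fin (c.dim n m) → TangentSpace (𝓡 (n + m)) x}
    (h₁ : IsLocalSection B U₁ e₁) (h₂ : IsLocalSection B U₂ e₂) (hO : O ⊆ U₁ ∩ U₂) {ψ : V → Ĝ}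
    (hψ : E.IsLift O e₁ e₂ ψ) (i j : Fin (c.dim n m)) :
    ContMDiffOn (𝓡 (n + m)) 𝓘(ℝ, ℝ) ∞ (fun x => E.mat (ψ x) i j) O := by
  refine (DMetric.contMDiffOn_transition (g := g) (fun i => (h₁.smooth i).mono fun x hx => (hO hx).1)
    (fun i => (h₂.smooth i).mono fun x hx => (hO hx).2) i j).congr fun x hx => ?_
  rw [(CentralExtension.mem_Psi_iff hB.orthonormal (h₁.mem x (hO hx).1)
    (h₂.mem x (hO hx).2)).1 (hψ.mem x hx)]

/-- The module associated with a representation. -/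
def associatedModule (hB : IsFrameBundle (N.part c) g.inner (g.sign c) G B)
    (R : WeightRep E q v) : PsiModule.{u, u} B E q v where
  -- All local sections of `B` serve as indices, as `IsAssociated` demands.
  ι := {p : Set V × (∀ x : V, Fin (c.dim n m) → TangentSpace (𝓡 (n + m)) x) //
    IsLocalSection B p.1 p.2}
  U i := i.1.1
  s i := i.1.2
  isLocalSection i := i.2
  cover x := by
    obtain ⟨U, e, hx, he⟩ := hB.localSection x
    exact ⟨⟨(U, e), he⟩, hx⟩
  φ _ _ _ ψ := R.ρ ψ
  cocycle _ _ _ _ _ ψ _ ψ' _ := map_mul R.ρ ψ ψ'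
  weight _ _ _ z := R.weight z
  smooth i j _ _ hO hψ := R.contMDiffOn hψ.isOpen hψ.cont (hB.contMDiffOn_mat i.2 j.2 hO hψ)

theorem isAssociated_associatedModule (hB : IsFrameBundle (N.part c) g.inner (g.sign c) G B)
    (R : WeightRep E q v) : (associatedModule hB R).IsAssociated R where
  all U e he := ⟨⟨(U, e), he⟩, rfl, rfl⟩
  φ_eq _ _ _ _ _ _ := rfl

/-- The form obtained from the connection form of `D` in the frame `e` by a linear map. -/
noncomputable def inducedForm {F : Type*} [NormedAddCommGroup F] [NormedSpace ℝ F]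
    (g : DMetric N) (D : LinConn (n + m) V)
    (Λ : Matrix (Fin (c.dim n m)) (Fin (c.dim n m)) ℝ →ₗ[ℝ] F)
    (e : ∀ x : V, Fin (c.dim n m) → TangentSpace (𝓡 (n + m)) x) : DForm (n + m) V 1 F := fun x =>
  ContinuousAlternatingMap.ofSubsingleton ℝ _ _ 0 (LinearMap.toContinuousLinearMap
    { toFun := fun X => Λ (connMatrix g D e x X)
      map_add' := fun X Y => by
        rw [← map_add]
        congr 1
        ext i j
        simp [connMatrix, DMetric.transition, mul_add]
      map_smul' := fun a X => by
        rw [RingHom.id_apply, ← map_smul]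
        congr 1
        ext i j
        simp [connMatrix, DMetric.transition, mul_left_comm] })

theorem inducedForm_apply {F : Type*} [NormedAddCommGroup F] [NormedSpace ℝ F]
    (D : LinConn (n + m) V) (Λ : Matrix (Fin (c.dim n m)) (Fin (c.dim n m)) ℝ →ₗ[ℝ] F)
    (e : ∀ x : V, Fin (c.dim n m) → TangentSpace (𝓡 (n + m)) x) (x : V)
    (X : TangentSpace (𝓡 (n + m)) x) :
    inducedForm g D Λ e x ![X] = Λ (connMatrix g D e x X) := rfl

variable {D : LinConn (n + m) V} [T2Space V]

theorem IsMetricDConnection.contMDiffOn_inducedForm {F : Type*} [NormedAddCommGroup F]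
    [NormedSpace ℝ F] (hD : IsMetricDConnection N g D)
    (Λ : Matrix (Fin (c.dim n m)) (Fin (c.dim n m)) ℝ →ₗ[ℝ] F) {U : Set V}
    {e : ∀ x : V, Fin (c.dim n m) → TangentSpace (𝓡 (n + m)) x}
    (he : IsLocalSection (g.frames c) U e) {X : ∀ x : V, TangentSpace (𝓡 (n + m)) x}
    (hX : SmoothField X) :
    ContMDiffOn (𝓡 (n + m)) 𝓘(ℝ, F) ∞ (fun x => inducedForm g D Λ e x ![X x]) U :=
  contMDiffOn_matrix_linearMap (fun i j => hD.contMDiffOn_connMatrix he hX i j) Λ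

theorem IsMetricDConnection.smoothOn_inducedForm {F : Type*} [NormedAddCommGroup F]
    [NormedSpace ℝ F] [FiniteDimensional ℝ F] (hD : IsMetricDConnection N g D)
    (Λ : Matrix (Fin (c.dim n m)) (Fin (c.dim n m)) ℝ →ₗ[ℝ] F) {U : Set V}
    {e : ∀ x : V, Fin (c.dim n m) → TangentSpace (𝓡 (n + m)) x}
    (he : IsLocalSection (g.frames c) U e) : DForm.SmoothOn (inducedForm g D Λ e) U :=
  DForm.smoothOn_of_smoothField fun _ hX => hD.contMDiffOn_inducedForm Λ he hX

/-- The matrix of the curvature of `D` in the frame `e`. -/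
noncomputable def curvMatrix (g : DMetric N) (D : LinConn (n + m) V)
    (e : ∀ x : V, Fin (c.dim n m) → TangentSpace (𝓡 (n + m)) x)
    (X Y : ∀ x : V, TangentSpace (𝓡 (n + m)) x) (x : V) :
    Matrix (Fin (c.dim n m)) (Fin (c.dim n m)) ℝ :=
  matrixDeriv (fun y => connMatrix g D e y (Y y)) x (X x)
    - matrixDeriv (fun y => connMatrix g D e y (X y)) x (Y x)
    - connMatrix g D e x (VectorField.mlieBracket (𝓡 (n + m)) X Y x)
    + (connMatrix g D e x (X x) * connMatrix g D e x (Y x)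
      - connMatrix g D e x (Y x) * connMatrix g D e x (X x))

theorem IsMetricDConnection.extD_inducedForm {F : Type*} [NormedAddCommGroup F]
    [NormedSpace ℝ F] [FiniteDimensional ℝ F] (hD : IsMetricDConnection N g D)
    (Λ : Matrix (Fin (c.dim n m)) (Fin (c.dim n m)) ℝ →ₗ[ℝ] F) {U : Set V}
    {e : ∀ x : V, Fin (c.dim n m) → TangentSpace (𝓡 (n + m)) x}
    (he : IsLocalSection (g.frames c) U e) {X Y : ∀ x : V, TangentSpace (𝓡 (n + m)) x}
    (hX : SmoothField X) (hY : SmoothField Y) {x : V} (hx : x ∈ U) :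
    DForm.extD (inducedForm g D Λ e) x ![X x, Y x]
      = Λ (matrixDeriv (fun y => connMatrix g D e y (Y y)) x (X x)
        - matrixDeriv (fun y => connMatrix g D e y (X y)) x (Y x)
        - connMatrix g D e x (VectorField.mlieBracket (𝓡 (n + m)) X Y x)) := by
  have hU := he.isOpen.mem_nhds hx
  have h1 : ∀ Z : (∀ x : V, TangentSpace (𝓡 (n + m)) x), SmoothField Z →
      MDifferentiableAt (𝓡 (n + m)) 𝓘(ℝ, F) (fun y => inducedForm g D Λ e y ![Z y]) x :=
    fun Z hZ => ((hD.contMDiffOn_inducedForm Λ he hZ).contMDiffAt hU).mdifferentiableAt (by simp)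
  have h2 : ∀ Z : (∀ x : V, TangentSpace (𝓡 (n + m)) x), SmoothField Z → ∀ W,
      mvfderiv (𝓡 (n + m)) (fun y => inducedForm g D Λ e y ![Z y]) x W
        = Λ (matrixDeriv (fun y => connMatrix g D e y (Z y)) x W) := fun Z hZ W =>
    mvfderiv_matrix_linearMap (fun i j =>
      ((hD.contMDiffOn_connMatrix he hZ i j).contMDiffAt hU).mdifferentiableAt (by simp)) Λ W
      (h1 Z hZ)
  rw [DForm.extD_apply_smoothField he.isOpen (hD.smoothOn_inducedForm Λ he) hX hY hx (h1 X hX)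
    (h1 Y hY), h2 Y hY, h2 X hX, inducedForm_apply, map_sub, map_sub]

variable [IsTopologicalGroup Ĝ] [T2Space Ĝ] [FiniteDimensional ℂ v]
  {R : WeightRep E q v} {L : pseudoOrthogonalLie (g.sign c) →ₗ[ℝ] (v →L[ℂ] v)}

/-- A metric d-connection induces a unique connection on an associated module, and the curvature of
the latter is induced by the curvature of the former. -/
theorem IsMetricDConnection.exists_isInduced (hD : IsMetricDConnection N g D)
    (hB : IsFrameBundle (N.part c) g.inner (g.sign c) G B) (hL : R.IsDifferential L) :
    ∃ A : (associatedModule hB R).ι → DForm (n + m) V 1 (v →L[ℂ] v),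
      (associatedModule hB R).IsConnection A ∧ (associatedModule hB R).IsInduced L D A ∧
      (associatedModule hB R).CurvInduced L D A ∧
      ∀ A', (associatedModule hB R).IsInduced L D A' →
        ∀ i, ∀ x ∈ (associatedModule hB R).U i, A' i x = A i x := by
  -- The connection matrix need not lie in the Lie algebra outside of the domain of a section. With
  -- the extension Λ of `L` the induced form is defined at every point.
  obtain ⟨Λ, hΛ⟩ := L.exists_extend
  have hΛ' : ∀ ξ : pseudoOrthogonalLie (g.sign c), Λ ξ = L ξ := fun ξ => LinearMap.congr_fun hΛ ξ
  have hsec : ∀ i : (associatedModule hB R).ι,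
      IsLocalSection (g.frames c) ((associatedModule hB R).U i) ((associatedModule hB R).s i) :=
    fun i => i.2.mono hB.orthonormal
  have hfin : FiniteDimensional ℝ (v →L[ℂ] v) := FiniteDimensional.complexToReal _
  refine ⟨fun i => inducedForm g D Λ ((associatedModule hB R).s i), ⟨fun i =>
    hD.smoothOn_inducedForm Λ (hsec i), ?_⟩, ?_, ?_, ?_⟩
  · intro i j O ψ hO hψ x hx X
    have hsm := hB.contMDiffOn_mat i.2 j.2 hO hψ
    have hmul := hD.mul_connMatrix (hsec i) (hsec j) (hO hx).1 (hO hx).2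
      (a := fun y => E.mat (ψ y))
      (fun i j => ((hsm i j).contMDiffAt (hψ.isOpen.mem_nhds hx)).mdifferentiableAt (by simp))
      (by filter_upwards [hψ.isOpen.mem_nhds hx] with y hy; exact hψ.mem y hy) X
    set θ := connMatrix g D ((associatedModule hB R).s i) x X with hθ
    set θ' := connMatrix g D ((associatedModule hB R).s j) x X with hθ'
    have hθm : θ ∈ pseudoOrthogonalLie (g.sign c) := hD.connMatrix_mem (hsec i) (hO hx).1 X
    have hθm' : θ' ∈ pseudoOrthogonalLie (g.sign c) := hD.connMatrix_mem (hsec j) (hO hx).2 X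
    -- Write a for the matrix of ψ. The gauge law reads da = a (θ' - ξ) with ξ = a⁻¹ θ a, so ρ(ψ)
    -- has the derivative ρ(ψ) (L θ' - L ξ); equivariance of `L` replaces ρ(ψ) L ξ by L θ ρ(ψ).
    have hξm := pseudoOrthogonalLie_conj_mem (hB.le (E.proj (ψ x)⁻¹).2)
      (E.mat_mul_mat_inv (ψ x)) hθm
    set ξ : pseudoOrthogonalLie (g.sign c) := ⟨E.mat (ψ x)⁻¹ * θ * E.mat (ψ x), hξm⟩ with hξ
    have hξeq : E.mat (ψ x) * (ξ : Matrix (Fin (c.dim n m)) (Fin (c.dim n m)) ℝ)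
        = θ * E.mat (ψ x) := by
      rw [hξ, ← Matrix.mul_assoc, ← Matrix.mul_assoc, E.mat_mul_mat_inv, Matrix.one_mul]
    have hd := hL.mvfderiv_apply hB.le hB.isOpen hψ.isOpen hψ.cont hsm hx (X := X)
      (ξ := ⟨θ', hθm'⟩ - ξ) (by
        rw [Submodule.coe_sub, Matrix.mul_sub, hξeq]
        exact eq_sub_of_add_eq hmul.symm)
    have hc := hL.mul_eq_mul hB.isOpen (ψ x) ξ ⟨θ, hθm⟩ hξeq
    change R.ρ (ψ x) * Λ θ' = mvfderiv (𝓡 (n + m)) (fun y => R.ρ (ψ y)) x X + Λ θ * R.ρ (ψ x)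
    rw [hd, hΛ' ⟨θ, hθm⟩, ← hc, hΛ' ⟨θ', hθm'⟩, ← mul_add, map_sub, sub_add_cancel]
  · intro i x hx X
    exact ⟨⟨_, hD.connMatrix_mem (hsec i) hx X⟩, fun j =>
      congrFun (hD.apply_eq_frameMul (hsec i) hx X) j, hΛ' ⟨_, hD.connMatrix_mem (hsec i) hx X⟩⟩
  · intro i X Y hX hY x hx
    set e := (associatedModule hB R).s i with he
    have hm := fun Z => hD.connMatrix_mem (hsec i) hx Z
    have hdm : ∀ Z : (∀ x : V, TangentSpace (𝓡 (n + m)) x), SmoothField Z → ∀ W,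
        matrixDeriv (fun y => connMatrix g D e y (Z y)) x W ∈ pseudoOrthogonalLie (g.sign c) :=
      fun Z hZ W => matrixDeriv_mem (hsec i).isOpen hx
        (fun a b => hD.contMDiffOn_connMatrix (hsec i) hZ a b)
        (fun y hy => hD.connMatrix_mem (hsec i) hy _) W
    have h1 := Submodule.sub_mem _ (Submodule.sub_mem _ (hdm Y hY (X x)) (hdm X hX (Y x)))
      (hm (VectorField.mlieBracket (𝓡 (n + m)) X Y x))
    have h2 := pseudoOrthogonalLie_lie_mem (hm (X x)) (hm (Y x))
    refine ⟨⟨curvMatrix g D e X Y x, Submodule.add_mem _ h1 h2⟩, fun j =>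
      congrFun (hD.curv_eq_frameMul (hsec i) hX hY hx) j, ?_⟩
    -- The quadratic part of the curvature is a commutator of values of `L`, hence the image of the
    -- bracket of the connection matrices.
    have h3 := hL.map_lie hB.le hB.isOpen ⟨_, hm (X x)⟩ ⟨_, hm (Y x)⟩
    unfold formCurv
    rw [hD.extD_inducedForm Λ (hsec i) hX hY hx, inducedForm_apply, inducedForm_apply,
      hΛ' ⟨_, hm (X x)⟩, hΛ' ⟨_, hm (Y x)⟩, ← h3, hΛ' ⟨_, h1⟩, ← map_add]
    rfl
  · intro A' hA' i x hx
    ext X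
    obtain ⟨θ, hθ, hAθ⟩ := hA' i x hx (X 0)
    have hX : X = ![X 0] := by
      funext a
      fin_cases a
      rfl
    -- A matrix is determined by its action on an orthonormal frame, so the θ of the hypothesis is
    -- the connection matrix.
    have h1 : connMatrix g D ((associatedModule hB R).s i) x (X 0) = θ := by
      have h2 : (fun j => D (fun y => (associatedModule hB R).s i y j) x (X 0))
          = frameMul ((associatedModule hB R).s i x) θ := funext hθ
      unfold connMatrix
      rw [h2, DMetric.transition_frameMul ((hsec i).mem x hx)]
    rw [hX, hAθ, inducedForm_apply, h1, hΛ']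

end Associated

/-! ### Assembly of the theorem -/

theorem mainTheorem4 {n m : ℕ} {V : Type u} [TopologicalSpace V] [T2Space V] [SigmaCompactSpace V]
    [ChartedSpace (EuclideanSpace ℝ (Fin (n + m))) V] [IsManifold (𝓡 (n + m)) ∞ V]
    (M : RiemannCartan n m V) :
    -- the bundles of all N-adapted orthonormal frames are principal bundles
    (∀ c : HV, IsFrameBundle (M.N.part c) M.g.inner (M.g.sign c) (pseudoOrthogonal (M.g.sign c))
      (orthonormalFrames (M.N.part c) M.g.inner (M.g.sign c))) ∧
    -- the canonical d-connection exists and is unique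
    ∃ Dcan : LinConn (n + m) V, IsCanonical M.N M.g Dcan ∧
      (∀ D' : LinConn (n + m) V, IsCanonical M.N M.g D' →
        ∀ (Y : ∀ x : V, TangentSpace (𝓡 (n + m)) x) (x : V),
          MDifferentiableAt (𝓡 (n + m)) (𝓡 (n + m)).tangent (T% Y) x → D' Y x = Dcan Y x) ∧
      -- for every principal d-bundle of N-adapted orthonormal frames and every central extension
      ∀ (G : ∀ c : HV, Subgroup (Matrix.GeneralLinearGroup (Fin (c.dim n m)) ℝ))
        (B : ∀ c : HV, FrameFamily (c.dim n m) (n + m) V)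
        (_ : ∀ c : HV, IsFrameBundle (M.N.part c) M.g.inner (M.g.sign c) (G c) (B c))
        (k : ℕ) [NeZero k] (Ĝ : HV → Type u₁) [∀ c, Group (Ĝ c)] [∀ c, TopologicalSpace (Ĝ c)]
        [∀ c, IsTopologicalGroup (Ĝ c)] [∀ c, T2Space (Ĝ c)]
        (E : ∀ c : HV, CentralExtension k (G c) (Ĝ c)),
        -- there is the lifting bundle d-gerbe `Ψ`
        (∀ c : HV, IsBundleGerbe (B c) (E c)) ∧
        ∀ (q : ℤ) (v : HV → Type u₂) [∀ c, NormedAddCommGroup (v c)] [∀ c, NormedSpace ℂ (v c)]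
          [∀ c, FiniteDimensional ℂ (v c)],
          -- all module d-connections on a `Ψ^q`-module have the same Chern character class
          (∀ W : (∀ c : HV, PsiModule.{u, w} (B c) (E c) q (v c)),
            (∀ A : (∀ c, (W c).ι → DForm (n + m) V 1 (v c →L[ℂ] v c)),
              (∀ c, (W c).IsConnection (A c)) →
              (∀ c, (W c).CurvDescends (A c)) ∧
              (∃! ch, IsChernCharacter W A ch) ∧
              ∀ ch, IsChernCharacter W A ch → ∀ p, DForm.extD (ch p) = 0) ∧
            ∀ A A' : (∀ c, (W c).ι → DForm (n + m) V 1 (v c →L[ℂ] v c)),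
              (∀ c, (W c).IsConnection (A c)) → (∀ c, (W c).IsConnection (A' c)) →
              ∀ ch ch', IsChernCharacter W A ch → IsChernCharacter W A' ch' →
                ∀ p, DForm.IsExact (ch p - ch' p)) ∧
          -- the globalization by means of d-representations
          ∀ R : (∀ c : HV, WeightRep (E c) q (v c)),
            ∃ L : (∀ c : HV, pseudoOrthogonalLie (M.g.sign c) →ₗ[ℝ] (v c →L[ℂ] v c)),
              (∀ c, (R c).IsDifferential (L c)) ∧
              (∀ c L', (R c).IsDifferential L' → L' = L c) ∧
              ∃ W : (∀ c : HV, PsiModule.{u, u} (B c) (E c) q (v c)),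
                (∀ c, (W c).IsAssociated (R c)) ∧
                -- every metric d-connection (in particular `M.D`) induces a module d-connection
                (∀ D : LinConn (n + m) V, IsMetricDConnection M.N M.g D →
                  ∃ A : (∀ c, (W c).ι → DForm (n + m) V 1 (v c →L[ℂ] v c)),
                    ∀ c, (W c).IsConnection (A c) ∧ (W c).IsInduced (L c) D (A c) ∧
                      (W c).CurvInduced (L c) D (A c) ∧
                      ∀ A', (W c).IsConnection A' → (W c).IsInduced (L c) D A' →
                        ∀ i, ∀ x ∈ (W c).U i, A' i x = A c i x) ∧
                -- the character computed from the curvature of the canonical d-connection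
                -- represents the Chern character class of the configuration
                ∃ (A : ∀ c, (W c).ι → DForm (n + m) V 1 (v c →L[ℂ] v c))
                  (ch : ∀ p : ℕ, DForm (n + m) V (2 * p) ℂ),
                  (∀ c, (W c).IsConnection (A c) ∧ (W c).IsInduced (L c) Dcan (A c) ∧
                    (W c).CurvInduced (L c) Dcan (A c)) ∧
                  IsChernCharacter W A ch ∧ (∀ p, DForm.extD (ch p) = 0) ∧
                  ∀ A' ch', (∀ c, (W c).IsConnection (A' c)) → IsChernCharacter W A' ch' →
                    ∀ p, DForm.IsExact (ch' p - ch p) := by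
  -- The given metric d-connection is the starting point from which the canonical one is built; by
  -- uniqueness the result does not depend on it.
  have hcan := M.isMetricDConnection.isCanonical_canonicalOf
  refine ⟨fun c => M.g.isFrameBundle c, canonicalOf M.g M.D, hcan,
    fun D' hD' Y x hY => hcan.unique hD' Y x hY, ?_⟩
  intro G B hB k _ Ĝ _ _ _ _ E
  have hgerbe : ∀ c, IsBundleGerbe (B c) (E c) := fun c => (hB c).isBundleGerbe
  refine ⟨hgerbe, fun q v _ _ _ => ⟨fun W => ⟨fun A hA => ⟨fun c => (hA c).curvDescends (hgerbe c),
    ?_, ?_⟩, fun A A' hA hA' ch ch' h h' p => h.isExact_sub hgerbe hA hA' h' p⟩, fun R => ?_⟩⟩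
  · obtain ⟨ch, hch, -⟩ := exists_isChernCharacter hgerbe hA
    exact ⟨ch, hch, fun ch' h' => h'.unique hch⟩
  · obtain ⟨ch, hch, hd⟩ := exists_isChernCharacter hgerbe hA
    intro ch' h'
    rw [h'.unique hch]
    exact hd
  choose L hL using fun c => (R c).exists_isDifferential (hB c).le (hB c).isOpen
  refine ⟨L, hL, fun c L' hL' => (hL c).unique (hB c).isOpen hL',
    fun c => associatedModule (hB c) (R c), fun c => isAssociated_associatedModule (hB c) (R c),
    fun D hD => ?_, ?_⟩
  · choose A hA using fun c => hD.exists_isInduced (hB c) (hL c)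
    exact ⟨A, fun c => ⟨(hA c).1, (hA c).2.1, (hA c).2.2.1, fun A' _ h' => (hA c).2.2.2 A' h'⟩⟩
  · choose A hA using fun c => hcan.isMetricDConnection.exists_isInduced (hB c) (hL c)
    obtain ⟨ch, hch, hd⟩ := exists_isChernCharacter hgerbe fun c => (hA c).1
    exact ⟨A, ch, fun c => ⟨(hA c).1, (hA c).2.1, (hA c).2.2.1⟩, hch, hd,
      fun A' ch' hA' h' p => h'.isExact_sub hgerbe hA' (fun c => (hA c).1) hch p⟩
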